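/- **Theorem (Khinchin-type theorem).** Let $(X,d)$ be a Busemann regular hyperbolic space, i.e. a Gromov hyperbolic metric space that is proper and uniquely geodesic, and for which, for all $x,y\in X$, the function $z\mapsto d(x,z)-d(y,z)$ extends continuously to the boundary $\partial X$ (geodesic rays up to bounded distance); write $\beta_\xi(x,y)=\lim_{z\to\xi}(d(x,z)-d(y,z))$. Fix $o\in X$. Let $\Gamma$ be a group acting on $X$ by isometries, properly discontinuously and geometrically finitely: every point of the limit set $\Lambda_\Gamma\subset\partial X$ is conical or bounded parabolic. Assume that $\Gamma$ is non-elementary ($\Lambda_\Gamma$ has more than two points) and that the set $P\subset\Lambda_\Gamma$ of parabolic points (limit points whose stabilizer is infinite and contains no loxodromic element) is non-empty. For a subgroup $\Pi<\Gamma$ let $\delta_\Pi=\limsup_{t\to\infty}\frac1t\log\#\{g\in\Pi: d(o,go)\le t\}$ be its critical exponent. Let the rank of $p\in P$ be $k(p)=2\delta_{\mathrm{Stab}_\Gamma(p)}$, and let $k_{\max}=\sup_{p\in P}k(p)$. For $\xi\in\partial X$ and $s>0$ let $H_\xi(s)=\{x:\beta_\xi(x,o)\le\log s\}$ be the horoball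 centred at $\xi$ of radius $s$ (so that its signed distance from $o$ is $-\log s$), and let $\mathcal H_\xi(s)\subset\partial X$ be its shadow: the set of endpoints of geodesic rays from $o$ that meet $H_\xi(s)$. Fix a $\Gamma$-invariant horoball packing, i.e. radii $r_p>0$ $(p\in P)$ such that the interiors $\{x:\beta_p(x,o)<\log r_p\}$ of the horoballs $H_p(r_p)$ are pairwise disjoint and permuted equivariantly by $\Gamma$. Let $(\mu_x)_{x\in X}$ be a $\delta$-conformal density, $\delta>0$: the $\mu_x$ are finite Borel measures on $\partial X$ carried by $\Lambda_\Gamma$ with $\gamma_*\mu_x=\mu_{\gamma x}$ for $\gamma\in\Gamma$ and $\frac{d\mu_x}{d\mu_y}(\eta)=e^{-\delta\beta_\eta(x,y)}$. Suppose that $\mu=\mu_o$ satisfies the global shadow lemma: there is $C>0$ such that for every $\xi\in\Lambda_\Gamma$, every $t\ge0$ and every ray $[o,\xi)$, with $\xi_t$ its point at distance $t$ from $o$, $$C^{-1}e^{-\delta t+(2\delta_\Pi-\delta)d(\xi_t,\Gamma o)}\le\mu(V(o,\xi,t))\le C\,e^{-\delta t+(2\delta_\Pi-\delta)d(\xi_t,\Gamma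 o)}.$$ Here $V(o,\xi,t)$ consists of $\xi$ and of all $\eta\in\partial X$ having a closest point projection to a ray $[o,\xi)$ (a point of the ray minimizing $\beta_\eta(\cdot,o)$) at distance more than $t$ from $o$; and $\Pi=\mathrm{Stab}_\Gamma(p)$ if $\xi_t$ lies in the interior of $H_p(r_p)$ for some $p\in P$, while $\Pi=\{\mathrm{id}\}$ if there is no such $p$. Let $\varphi:(0,\infty)\to(0,\infty)$ be a Khinchin function: it is non-decreasing, and there are constants $0<b_1<1$ and $b_2>0$ with $\varphi(b_1x)\ge b_2\varphi(x)$ for all $x>0$. Let $0<\lambda<1$, let $H_n=\{p\in P:\lambda^{n+1}\le r_p\le\lambda^n\}$, and let $$\Omega_\infty^\varphi=\bigcap_{n\ge0}\ \bigcup_{m\ge n}\ \bigcup_{p\in H_m}\mathcal H_p\bigl(r_p\varphi(r_p)\bigr).$$ Then: 1. $\mu(\Omega_\infty^\varphi)=0$ if $\sum_{n\ge0}\varphi(\lambda^n)^{2\delta-k_{\max}}<\infty$; 2. $\Omega_\infty^\varphi$ has full $\mu$-measure, i.e. $\mu(\partial X\setminus\Omega_\infty^\varphi)=0$, if $\sum_{n\ge0}\varphi(\lambda^n)^{2\delta-k_{\max}}=\infty$.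 -/

import Mathlib

open Filter Topology MeasureTheory
open scoped NNReal Pointwise

noncomputable section

namespace HypBoundary

/-! ### Hyperbolic metric spaces and their boundary -/

section Space

variable {X : Type*} [MetricSpace X]

/-- The Gromov product of `x` and `y` seen from `o`. -/
def gromovProduct (o x y : X) : ℝ := (dist x o + dist y o - dist x y) / 2

variable (X) in
/-- Gromov hyperbolicity (four-point condition). -/
def IsGromovHyperbolic : Prop :=
  ∃ α : ℝ, ∀ o x y z : X,
    min (gromovProduct o x z) (gromovProduct o z y) - α ≤ gromovProduct o x y

variable (X) in
/-- Any two points are joined by exactly one geodesic segment. -/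
def IsUniquelyGeodesic : Prop :=
  ∀ x y : X, ∃! f : Set.Icc (0 : ℝ) (dist x y) → X,
    Isometry f ∧ f ⟨0, Set.left_mem_Icc.2 dist_nonneg⟩ = x ∧
      f ⟨dist x y, Set.right_mem_Icc.2 dist_nonneg⟩ = y

variable (X) in
/-- Geodesic rays, parametrized by arc length, with the topology of pointwise convergence (which
for isometric maps is the same as uniform convergence on bounded intervals). -/
def GeodesicRay : Type _ := {γ : ℝ≥0 → X // Isometry γ}

instance : CoeFun (GeodesicRay X) (fun _ => ℝ≥0 → X) := ⟨Subtype.val⟩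

instance : TopologicalSpace (GeodesicRay X) :=
  inferInstanceAs (TopologicalSpace {γ : ℝ≥0 → X // Isometry γ})

variable (X) in
/-- Two rays are asymptotic if they stay within bounded distance of each other. -/
instance asymptoticSetoid : Setoid (GeodesicRay X) where
  r γ γ' := ∃ C : ℝ, ∀ t, dist (γ t) (γ' t) ≤ C
  iseqv :=
    { refl := fun _ => ⟨0, fun _ => (dist_self _).le⟩
      symm := fun ⟨C, h⟩ => ⟨C, fun t => by rw [dist_comm]; exact h t⟩
      trans := fun ⟨C, h⟩ ⟨D, k⟩ =>
        ⟨C + D, fun t => (dist_triangle _ _ _).trans (add_le_add (h t) (k t))⟩ }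

variable (X) in
/-- The boundary at infinity: geodesic rays up to bounded distance, with the quotient topology. -/
def Boundary : Type _ := Quotient (asymptoticSetoid X)

instance : TopologicalSpace (Boundary X) :=
  inferInstanceAs (TopologicalSpace (Quotient (asymptoticSetoid X)))

instance : MeasurableSpace (Boundary X) := borel _

instance : BorelSpace (Boundary X) := ⟨rfl⟩

/-- The endpoint at infinity of a ray. -/
def GeodesicRay.endpoint (γ : GeodesicRay X) : Boundary X := Quotient.mk _ γ

/-- `γ` is a ray `[o, ξ)`. -/
def IsRay (γ : GeodesicRay X) (o : X) (ξ : Boundary X) : Prop :=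
  γ 0 = o ∧ γ.endpoint = ξ

/-- The filter on `X` of convergence to the boundary point `ξ`: the point `z` tends to `ξ` when
the Gromov product of `z` and `ξ` tends to infinity. -/
def nhdsInfty (ξ : Boundary X) : Filter X :=
  ⨅ (γ : GeodesicRay X) (_ : γ.endpoint = ξ) (R : ℝ),
    𝓟 {z | ∀ᶠ t in atTop, R ≤ gromovProduct (γ 0) z (γ t)}

variable (X) in
/-- A Busemann regular hyperbolic space: a hyperbolic space that is proper and uniquely geodesic,
and whose Busemann functions `z ↦ d(x, z) - d(y, z)` extend continuously to the boundary. -/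
structure IsBusemannRegularHyperbolic : Prop where
  hyperbolic : IsGromovHyperbolic X
  proper : ProperSpace X
  uniquelyGeodesic : IsUniquelyGeodesic X
  busemann_extends : ∀ x y : X, ∃ F : Boundary X → ℝ, Continuous F ∧
    ∀ ξ, Tendsto (fun z => dist x z - dist y z) (nhdsInfty ξ) (𝓝 (F ξ))

/-- The Busemann function `β_ξ(x, y) = lim_{z → ξ} (d(x, z) - d(y, z))`. -/
def busemann (ξ : Boundary X) (x y : X) : ℝ :=
  limUnder (nhdsInfty ξ) (fun z => dist x z - dist y z)

/-- The (closed) horoball centred at `ξ` of radius `s > 0` with respect to `o`: its signed distance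
from `o` is `-log s`. -/
def horoball (o : X) (ξ : Boundary X) (s : ℝ) : Set X :=
  {x | busemann ξ x o ≤ Real.log s}

/-- The corresponding open horoball. -/
def openHoroball (o : X) (ξ : Boundary X) (s : ℝ) : Set X :=
  {x | busemann ξ x o < Real.log s}

/-- The shadow of a set, seen from `o`: all endpoints of rays from `o` that meet the set. -/
def shadowOf (o : X) (S : Set X) : Set (Boundary X) :=
  {η | ∃ γ : GeodesicRay X, IsRay γ o η ∧ ∃ t, γ t ∈ S}

/-- The shadow `V(o, ξ, t)`: the point `ξ` and all boundary points `η` whose projection to a ray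
`[o, ξ)`, i.e. the point of the ray where `β_η(·, o)` is minimal, is at distance more than `t`
from `o`. -/
def shadow (o : X) (ξ : Boundary X) (t : ℝ) : Set (Boundary X) :=
  {η | η = ξ ∨ ∃ γ : GeodesicRay X, IsRay γ o ξ ∧ ∃ s : ℝ≥0, t < s ∧
    ∀ s' : ℝ≥0, busemann η (γ s) o ≤ busemann η (γ s') o}

end Space

/-! ### Groups of isometries -/

section Action

variable (Γ : Type*) [Group Γ] {X : Type*} [MetricSpace X] [MulAction Γ X] [IsIsometricSMul Γ X]

variable {Γ} in
/-- The image of a ray under an isometry. -/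
def GeodesicRay.translate (g : Γ) (γ : GeodesicRay X) : GeodesicRay X :=
  ⟨fun t => g • γ t, (isometry_smul X g).comp γ.2⟩

/-- The action on the boundary. -/
instance : MulAction Γ (Boundary X) where
  smul g := Quotient.map (GeodesicRay.translate g) (by
    rintro γ γ' ⟨C, h⟩
    exact ⟨C, fun t => by simpa [GeodesicRay.translate] using h t⟩)
  one_smul ξ := by
    induction ξ using Quotient.inductionOn with
    | h γ => exact congrArg (Quotient.mk _) (Subtype.ext (funext fun t => one_smul Γ (γ t)))
  mul_smul g h ξ := by
    induction ξ using Quotient.inductionOn with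
    | h γ => exact congrArg (Quotient.mk _) (Subtype.ext (funext fun t => mul_smul g h (γ t)))

variable (o : X)

/-- The action is (metrically) properly discontinuous. -/
def IsDiscreteAction (X : Type*) [MetricSpace X] [MulAction Γ X] : Prop :=
  ∀ (x : X) (R : ℝ), {g : Γ | dist x (g • x) ≤ R}.Finite

/-- The limit set: the accumulation points of the orbit of `o` in the boundary. -/
def limitSet : Set (Boundary X) :=
  {ξ | ∃ᶠ x in nhdsInfty ξ, x ∈ MulAction.orbit Γ o}

/-- Conical limit points: limits of a sequence of orbit points that stays within bounded distance
of a ray `[o, ξ)`. -/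
def IsConical (ξ : Boundary X) : Prop :=
  ∃ γ : GeodesicRay X, IsRay γ o ξ ∧ ∃ (R : ℝ) (u : ℕ → Γ),
    Tendsto (fun n => u n • o) atTop (nhdsInfty ξ) ∧ ∀ n, ∃ t, dist (u n • o) (γ t) ≤ R

variable {Γ} in
/-- Loxodromic isometries: those with positive translation length. -/
def IsLoxodromic (g : Γ) : Prop := ∃ c > 0, ∀ n : ℕ, c * (n : ℝ) ≤ dist o (g ^ n • o)

/-- The set `P` of parabolic points: limit points whose stabilizer is a parabolic subgroup, that is,
it is infinite and has no loxodromic elements. -/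
def parabolicPoints : Set (Boundary X) :=
  {p | p ∈ limitSet Γ o ∧ (MulAction.stabilizer Γ p : Set Γ).Infinite ∧
    ∀ g ∈ MulAction.stabilizer Γ p, ¬ IsLoxodromic o g}

/-- Bounded parabolic points: the stabilizer acts cocompactly on the rest of the limit set. -/
def IsBoundedParabolic (p : Boundary X) : Prop :=
  p ∈ parabolicPoints Γ o ∧ ∃ K ⊆ limitSet Γ o \ {p}, IsCompact K ∧
    limitSet Γ o \ {p} ⊆ ⋃ g ∈ MulAction.stabilizer Γ p, g • K

/-- Geometrically finite actions. -/
structure IsGeometricallyFinite : Prop where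
  discrete : IsDiscreteAction Γ X
  conical_or_parabolic : ∀ ξ ∈ limitSet Γ o, IsConical Γ o ξ ∨ IsBoundedParabolic Γ o ξ

variable {Γ} in
/-- The critical exponent of a subgroup:
`δ_Q = limsup_{t → ∞} (1 / t) log #{g ∈ Q : d(o, g o) ≤ t}`. -/
def criticalExponent (Q : Subgroup Γ) : ℝ :=
  limsup (fun t : ℝ => Real.log ({g : Γ | g ∈ Q ∧ dist o (g • o) ≤ t}.ncard : ℝ) / t) atTop

/-- The rank of a parabolic point, normalized as twice the critical exponent of its stabilizer. -/
def rank (p : Boundary X) : ℝ := 2 * criticalExponent o (MulAction.stabilizer Γ p)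

/-- The maximal rank `k_max` of a parabolic point. -/
def maxRank : ℝ := ⨆ p : parabolicPoints Γ o, rank Γ o (p : Boundary X)

/-- The radii `r p` describe a `Γ`-invariant packing by pairwise disjoint (open) horoballs, one
centred at each parabolic point. -/
structure IsHoroballPacking (r : Boundary X → ℝ) : Prop where
  pos : ∀ p ∈ parabolicPoints Γ o, 0 < r p
  invariant : ∀ g : Γ, ∀ p ∈ parabolicPoints Γ o,
    g • openHoroball o p (r p) = openHoroball o (g • p) (r (g • p))
  disjoint : ∀ p ∈ parabolicPoints Γ o, ∀ q ∈ parabolicPoints Γ o, p ≠ q →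
    Disjoint (openHoroball o p (r p)) (openHoroball o q (r q))

/-- A conformal density of dimension `δ` on the limit set: finite measures `μ x`, equivariant under
the group, with `dμ_x / dμ_y (η) = exp (-δ β_η(x, y))`. -/
structure IsConformalDensity (δ : ℝ) (μ : X → Measure (Boundary X)) : Prop where
  dim_pos : 0 < δ
  finite : ∀ x, IsFiniteMeasure (μ x)
  supported : ∀ x, μ x (limitSet Γ o)ᶜ = 0
  equivariant : ∀ (g : Γ) (x : X), (μ x).map (fun ξ => g • ξ) = μ (g • x)
  conformal : ∀ x y : X,
    μ x = (μ y).withDensity (fun η => ENNReal.ofReal (Real.exp (-δ * busemann η x y)))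

/-- The parabolic subgroup attached to a point `x`: trivial if `x` lies in the thick part (the
complement of the packing), and otherwise the stabilizer of the horoball that contains `x`. -/
def IsCuspSubgroup (r : Boundary X → ℝ) (x : X) (Q : Subgroup Γ) : Prop :=
  ((∀ p ∈ parabolicPoints Γ o, x ∉ openHoroball o p (r p)) ∧ Q = ⊥) ∨
    ∃ p ∈ parabolicPoints Γ o, x ∈ openHoroball o p (r p) ∧ Q = MulAction.stabilizer Γ p

/-- The global shadow lemma for the measure `ν = μ_o`: up to a uniform constant, the shadow
`V(o, ξ, t)` has measure `exp (-δ t + (2 δ_Q - δ) d(ξ_t, Γ o))` for all limit points `ξ` and all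
`t ≥ 0`. -/
def SatisfiesShadowLemma (r : Boundary X → ℝ) (δ : ℝ) (ν : Measure (Boundary X)) : Prop :=
  ∃ C > 0, ∀ ξ ∈ limitSet Γ o, ∀ γ : GeodesicRay X, IsRay γ o ξ →
    ∀ (t : ℝ≥0) (Q : Subgroup Γ), IsCuspSubgroup Γ o r (γ t) Q →
      C⁻¹ * Real.exp (-δ * t + (2 * criticalExponent o Q - δ) *
          Metric.infDist (γ t) (MulAction.orbit Γ o)) ≤ ν.real (shadow o ξ t) ∧
        ν.real (shadow o ξ t) ≤ C * Real.exp (-δ * t + (2 * criticalExponent o Q - δ) *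
          Metric.infDist (γ t) (MulAction.orbit Γ o))

/-- The set `H_n` of parabolic points whose horoball has radius in `[l ^ (n + 1), l ^ n]`. -/
def horoballLevel (r : Boundary X → ℝ) (l : ℝ) (n : ℕ) : Set (Boundary X) :=
  {p | p ∈ parabolicPoints Γ o ∧ l ^ (n + 1) ≤ r p ∧ r p ≤ l ^ n}

/-- The limsup set of the shadows of the rescaled horoballs `H_p(r_p φ(r_p))`. -/
def khinchinSet (r : Boundary X → ℝ) (l : ℝ) (φ : ℝ → ℝ) : Set (Boundary X) :=
  ⋂ n : ℕ, ⋃ m ≥ n, ⋃ p ∈ horoballLevel Γ o r l m, shadowOf o (horoball o p (r p * φ (r p)))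

end Action

/-- Khinchin functions: positive increasing functions on the positive half-line with
`φ (b₁ x) ≥ b₂ φ x` for some constants `0 < b₁ < 1` and `b₂ > 0`. -/
structure IsKhinchinFunction (φ : ℝ → ℝ) : Prop where
  pos : ∀ x, 0 < x → 0 < φ x
  mono : MonotoneOn φ (Set.Ioi 0)
  doubling : ∃ b₁ b₂ : ℝ, 0 < b₁ ∧ b₁ < 1 ∧ 0 < b₂ ∧ ∀ x, 0 < x → b₂ * φ x ≤ φ (b₁ * x)

end HypBoundary

end

/-! Everything is expressed through the visual balls `visualBall o ξ t`, the points whose Gromov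
product with `ξ` exceeds `t`. Up to additive constants in `t` they agree with the shadows `V(o, ξ,
t)` (`shadow_subset_visualBall`, `visualBall_subset_shadow`) and with shadows of horoballs
(`shadowOf_horoball_subset`, `visualBall_subset_shadowOf`). Write T_p = -log r_p. Along the ray to a
parabolic point p, the distance to the orbit at time t > T_p is t - T_p up to a constant, so the
shadow lemma gives mass about exp(-δ T_p - (2δ - k(p)) s) to the ball of level T_p + s at p. With s
= -log φ(r_p) this is r_p^δ φ(r_p)^(2δ - k(p)).

The geometric input is threefold. Disjoint horoballs force (p|q) ≤ (T_p + T_q)/2 + const, so balls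
at centres of comparable level are disjoint slightly beyond their level, and the sum of r_p^δ over
one level is bounded. The part of the rays that stays out of deep horoballs is cobounded
(`exists_forall_exists_dist_le`), hence at each time t a ray to a limit point is either deep in a
horoball or in the shadow of a horoball of level about t from one chosen orbit
(`exists_cusp_dichotomy`). Finally 2δ > k(p) (`rank_lt`), and k_max is attained
(`exists_rank_eq_maxRank`); the chosen orbit is one of maximal rank, for which the mass estimate has
exponent exactly κ = 2δ - k_max. These facts are packaged in `CuspShadows`, after which the argument
is pure measure theory.

Convergence is Borel–Cantelli: the n-th level has shrunken mass at most const · φ(λ^n)^κ. For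
divergence, deep horoballs occupy at most half of the shadow of any horoball, so horoballs of the
chosen orbit fill a definite part of it at every later level (`exists_local_count`). Their shrunken
shadows at widely spaced levels are quasi-independent, and a second moment estimate shows that they
cover a fixed proportion of every horoball shadow (`exists_le_measure_inter`). A Vitali covering
argument in place of a density theorem turns this into full measure (`ae_forall_exists_mem`). -/

namespace HypBoundary

/-! ### Gromov products with boundary points, visual balls and shadows. -/

section Hyperbolic

variable {X : Type*} [MetricSpace X]

theorem GeodesicRay.dist_eq (γ : GeodesicRay X) (s t : ℝ≥0) :
    dist (γ s) (γ t) = |(s : ℝ) - t| := by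
  rw [γ.2.dist_eq, NNReal.dist_eq]

theorem endpoint_eq_iff (γ γ' : GeodesicRay X) :
    γ.endpoint = γ'.endpoint ↔ ∃ C : ℝ, ∀ t, dist (γ t) (γ' t) ≤ C :=
  Quotient.eq (r := asymptoticSetoid X)

theorem exists_endpoint_eq (ξ : Boundary X) : ∃ γ : GeodesicRay X, γ.endpoint = ξ :=
  Quotient.exists_rep ξ

theorem IsRay.dist_eq {γ : GeodesicRay X} {o : X} {ξ : Boundary X} (h : IsRay γ o ξ) (t : ℝ≥0) :
    dist (γ t) o = t := by
  rw [← h.1, γ.dist_eq]; simp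

theorem gromovProduct_comm (o x y : X) : gromovProduct o x y = gromovProduct o y x := by
  simp only [gromovProduct, dist_comm x y]; ring

theorem IsRay.gromovProduct_eq {γ : GeodesicRay X} {o : X} {ξ : Boundary X} (h : IsRay γ o ξ)
    (s t : ℝ≥0) : gromovProduct o (γ s) (γ t) = min (s : ℝ) t := by
  rw [gromovProduct, h.dist_eq, h.dist_eq, γ.dist_eq]
  rcases le_total (s : ℝ) t with hst | hst
  · rw [abs_of_nonpos (by linarith), min_eq_left hst]; ring
  · rw [abs_of_nonneg (by linarith), min_eq_right hst]; ring

theorem GeodesicRay.tendsto_nhdsInfty (γ : GeodesicRay X) :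
    Tendsto γ.1 atTop (nhdsInfty γ.endpoint) := by
  simp only [nhdsInfty, tendsto_iInf, tendsto_principal]
  intro γ' h R
  obtain ⟨C, hC⟩ := (endpoint_eq_iff _ _).1 h
  obtain ⟨n, hn⟩ := exists_nat_ge (R + C)
  filter_upwards [eventually_ge_atTop (n : ℝ≥0)] with s hs
  filter_upwards [eventually_ge_atTop s] with t ht
  have hs' : (n : ℝ) ≤ s := by exact_mod_cast hs
  have ht' : (s : ℝ) ≤ t := by exact_mod_cast ht
  have h1 : dist (γ.1 s) (γ'.1 t) ≤ C + (t - s) := by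
    refine (dist_triangle _ (γ'.1 s) _).trans (add_le_add (by rw [dist_comm]; exact hC s) ?_)
    have := γ'.dist_eq s t
    rw [this, abs_of_nonpos (by linarith)]; linarith
  have h2 : (s : ℝ) ≤ dist (γ.1 s) (γ'.1 0) + C := by
    have h3 := γ'.dist_eq s 0
    have h4 := dist_triangle (γ'.1 s) (γ.1 s) (γ'.1 0)
    have h5 := hC s
    rw [h3, NNReal.coe_zero, sub_zero, abs_of_nonneg s.coe_nonneg] at h4
    linarith
  have h3 : dist (γ'.1 t) (γ'.1 0) = t := by
    have := γ'.dist_eq t 0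
    rw [this]; simp
  rw [gromovProduct, h3]
  linarith

instance nhdsInfty_neBot (ξ : Boundary X) : (nhdsInfty ξ).NeBot := by
  obtain ⟨γ, rfl⟩ := exists_endpoint_eq ξ
  exact γ.tendsto_nhdsInfty.neBot

/-- The Gromov product of a point and a boundary point, seen from `o`. -/
noncomputable def bgp (o x : X) (ξ : Boundary X) : ℝ := (dist x o - busemann ξ x o) / 2

/-- The points of the boundary whose Gromov product with `ξ` exceeds `t`. -/
def visualBall (o : X) (ξ : Boundary X) (t : ℝ) : Set (Boundary X) :=
  {η | ∃ z, t < bgp o z ξ ∧ t < bgp o z η}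

variable (X) in
/-- The four-point condition with constant `α`. -/
def FourPoint (α : ℝ) : Prop :=
  ∀ o x y z : X, min (gromovProduct o x z) (gromovProduct o z y) - α ≤ gromovProduct o x y

theorem FourPoint.nonneg [Nonempty X] {α : ℝ} (h : FourPoint X α) : 0 ≤ α := by
  obtain ⟨x⟩ := ‹Nonempty X›
  have := h x x x x
  simp [gromovProduct] at this
  exact this

variable (hX : IsBusemannRegularHyperbolic X)
include hX

theorem tendsto_busemann (ξ : Boundary X) (x y : X) :
    Tendsto (fun z => dist x z - dist y z) (nhdsInfty ξ) (𝓝 (busemann ξ x y)) := by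
  obtain ⟨F, -, hF⟩ := hX.busemann_extends x y
  exact tendsto_nhds_limUnder ⟨_, hF ξ⟩

theorem continuous_busemann (x y : X) : Continuous fun ξ : Boundary X => busemann ξ x y := by
  obtain ⟨F, hc, hF⟩ := hX.busemann_extends x y
  have : (fun ξ : Boundary X => busemann ξ x y) = F :=
    funext fun ξ => tendsto_nhds_unique (tendsto_busemann hX ξ x y) (hF ξ)
  rwa [this]

theorem tendsto_busemann_ray (γ : GeodesicRay X) (x y : X) :
    Tendsto (fun t => dist x (γ t) - dist y (γ t)) atTop (𝓝 (busemann γ.endpoint x y)) :=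
  (tendsto_busemann hX _ x y).comp γ.tendsto_nhdsInfty

theorem busemann_self (ξ : Boundary X) (x : X) : busemann ξ x x = 0 :=
  tendsto_nhds_unique (tendsto_busemann hX ξ x x) (by simp)

theorem busemann_add (ξ : Boundary X) (x y z : X) :
    busemann ξ x y + busemann ξ y z = busemann ξ x z :=
  tendsto_nhds_unique ((tendsto_busemann hX ξ x y).add (tendsto_busemann hX ξ y z))
    (by simpa using tendsto_busemann hX ξ x z)

theorem busemann_neg (ξ : Boundary X) (x y : X) : busemann ξ x y = -busemann ξ y x := by
  have := busemann_add hX ξ x y x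
  rw [busemann_self hX] at this
  linarith

theorem busemann_le_dist (ξ : Boundary X) (x y : X) : busemann ξ x y ≤ dist x y :=
  le_of_tendsto (tendsto_busemann hX ξ x y) (Eventually.of_forall fun z => by
    linarith [dist_triangle x y z])

theorem neg_dist_le_busemann (ξ : Boundary X) (x y : X) : -dist x y ≤ busemann ξ x y := by
  have := busemann_le_dist hX ξ y x
  rw [busemann_neg hX, dist_comm] at this
  linarith

theorem busemann_ray (γ : GeodesicRay X) (t : ℝ≥0) :
    busemann γ.endpoint (γ t) (γ 0) = -t := by
  refine tendsto_nhds_unique (tendsto_busemann_ray hX γ _ _) (tendsto_const_nhds.congr' ?_)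
  filter_upwards [eventually_ge_atTop t] with s hs
  have hs' : (t : ℝ) ≤ s := by exact_mod_cast hs
  rw [γ.dist_eq, γ.dist_eq, abs_of_nonpos (by linarith)]
  simp

theorem IsRay.busemann_eq {γ : GeodesicRay X} {o : X} {ξ : Boundary X} (h : IsRay γ o ξ)
    (t : ℝ≥0) : busemann ξ (γ t) o = -t := by
  rw [← h.1, ← h.2, busemann_ray hX]

theorem IsRay.bgp_eq {γ : GeodesicRay X} {o : X} {ξ : Boundary X} (h : IsRay γ o ξ)
    (t : ℝ≥0) : bgp o (γ t) ξ = t := by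
  rw [bgp, h.dist_eq, h.busemann_eq hX]; ring

omit hX in
theorem busemann_eq_bgp (o x : X) (ξ : Boundary X) :
    busemann ξ x o = dist x o - 2 * bgp o x ξ := by
  rw [bgp]; ring

theorem bgp_nonneg (o x : X) (ξ : Boundary X) : 0 ≤ bgp o x ξ := by
  have := busemann_le_dist hX ξ x o
  rw [bgp]; linarith

theorem bgp_le_dist (o x : X) (ξ : Boundary X) : bgp o x ξ ≤ dist x o := by
  have := neg_dist_le_busemann hX ξ x o
  rw [bgp]; linarith

theorem bgp_le_add_right (o x y : X) (ξ : Boundary X) : bgp o x ξ ≤ bgp o y ξ + dist x y := by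
  have h1 := busemann_add hX ξ x y o
  have h2 := neg_dist_le_busemann hX ξ x y
  have h3 := dist_triangle x y o
  rw [bgp, bgp]; linarith

theorem bgp_le_add_left (o o' x : X) (ξ : Boundary X) : bgp o x ξ ≤ bgp o' x ξ + dist o o' := by
  have h1 := busemann_add hX ξ x o' o
  have h2 := neg_dist_le_busemann hX ξ o' o
  have h3 := dist_triangle x o' o
  rw [dist_comm o' o] at h2 h3
  rw [bgp, bgp]; linarith

theorem bgp_add_swap (x y : X) (ξ : Boundary X) : bgp x y ξ + bgp y x ξ = dist x y := by
  rw [bgp, bgp, busemann_neg hX ξ y x, dist_comm y x]; ring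

theorem continuous_bgp (o x : X) : Continuous fun ξ : Boundary X => bgp o x ξ := by
  unfold bgp
  exact (continuous_const.sub (continuous_busemann hX x o)).div_const 2

theorem tendsto_bgp (o x : X) (ξ : Boundary X) :
    Tendsto (fun z => gromovProduct o x z) (nhdsInfty ξ) (𝓝 (bgp o x ξ)) := by
  refine (((tendsto_const_nhds (x := dist x o)).sub (tendsto_busemann hX ξ x o)).div_const
    2).congr fun z => ?_
  rw [gromovProduct, dist_comm o z]; ring

theorem min_bgp_le_gromovProduct {α : ℝ} (hα : FourPoint X α) (o x y : X) (ξ : Boundary X) :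
    min (bgp o x ξ) (bgp o y ξ) - α ≤ gromovProduct o x y := by
  refine le_of_tendsto (((tendsto_bgp hX o x ξ).min (tendsto_bgp hX o y ξ)).sub_const α)
    (Eventually.of_forall fun z => ?_)
  have := hα o x y z
  rwa [gromovProduct_comm o z y] at this

theorem min_gromovProduct_le_bgp {α : ℝ} (hα : FourPoint X α) (o x y : X) (ξ : Boundary X) :
    min (gromovProduct o x y) (bgp o y ξ) - α ≤ bgp o x ξ :=
  le_of_tendsto_of_tendsto' ((tendsto_const_nhds.min (tendsto_bgp hX o y ξ)).sub_const α)
    (tendsto_bgp hX o x ξ) fun z => hα o x z y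

/-- Two boundary points are close if they are close to a common point. -/
theorem min_bgp_le_bgp {α : ℝ} (hα : FourPoint X α) (o x z : X) (ξ η : Boundary X) :
    min (bgp o x ξ) (min (bgp o z ξ) (bgp o z η)) - 2 * α ≤ bgp o x η := by
  have : Nonempty X := ⟨o⟩
  have h0 := hα.nonneg
  have h1 := min_bgp_le_gromovProduct hX hα o x z ξ
  have h2 := min_gromovProduct_le_bgp hX hα o x z η
  rw [← min_assoc]
  rcases min_choice (gromovProduct o x z) (bgp o z η) with h | h <;> rw [h] at h2
  · linarith [min_le_left (min (bgp o x ξ) (bgp o z ξ)) (bgp o z η)]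
  · linarith [min_le_right (min (bgp o x ξ) (bgp o z ξ)) (bgp o z η)]

/-- Arzelà–Ascoli in ultrafilter form: by properness the segments from `o` to `x i` converge
pointwise along `U`, and the limit is a ray. -/
theorem exists_limit_ray (o : X) {ι : Type*} (U : Ultrafilter ι) (x : ι → X)
    (hx : Tendsto (fun i => dist (x i) o) U atTop) :
    ∃ γ : GeodesicRay X, γ 0 = o ∧
      ∀ t : ℝ≥0, ∀ᶠ i in (U : Filter ι), (t : ℝ) - 1 ≤ gromovProduct o (x i) (γ t) := by
  have := hX.proper
  choose f hf using fun i => (hX.uniquelyGeodesic o (x i)).exists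
  -- The segment is frozen at `x i` after its length; for fixed `t` this no longer matters once `x
  -- i` is far away.
  let F : ι → ℝ≥0 → X := fun i t =>
    f i ⟨min (t : ℝ) (dist o (x i)), le_min t.2 dist_nonneg, min_le_right _ _⟩
  have hF : ∀ i s t, dist (F i s) (F i t) =
      |min (s : ℝ) (dist o (x i)) - min (t : ℝ) (dist o (x i))| := fun i s t => by
    rw [(hf i).1.dist_eq]; rfl
  have hF0 : ∀ i, F i 0 = o := fun i =>
    (congrArg (f i) (Subtype.ext (min_eq_left dist_nonneg))).trans (hf i).2.1
  have hFe : ∀ i t, dist (x i) (F i t) = dist o (x i) - min (t : ℝ) (dist o (x i)) := fun i t => by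
    have h := (hf i).1.dist_eq ⟨dist o (x i), Set.right_mem_Icc.2 dist_nonneg⟩
      ⟨min (t : ℝ) (dist o (x i)), le_min t.2 dist_nonneg, min_le_right _ _⟩
    rw [(hf i).2.2] at h
    refine h.trans ?_
    rw [Subtype.dist_eq, Real.dist_eq]
    exact abs_of_nonneg (sub_nonneg.2 (min_le_right _ _))
  have hball : ∀ i (t : ℝ≥0), F i t ∈ Metric.closedBall o (t : ℝ) := fun i t => by
    rw [Metric.mem_closedBall, ← hF0 i, hF, NNReal.coe_zero, min_eq_left (a := (0 : ℝ)) dist_nonneg,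
      sub_zero, abs_of_nonneg (le_min t.coe_nonneg dist_nonneg)]
    exact min_le_left _ _
  have hlim : ∀ t, ∃ y, Tendsto (fun i => F i t) U (𝓝 y) := fun t => by
    obtain ⟨y, -, hy⟩ := (isCompact_closedBall o (t : ℝ)).ultrafilter_le_nhds
      (U.map fun i => F i t) (le_principal_iff.2 (mem_map.2 (univ_mem' fun i => hball i t)))
    exact ⟨y, hy⟩
  choose γ hγ using hlim
  have hlarge : ∀ t : ℝ≥0, ∀ᶠ i in (U : Filter ι), (t : ℝ) ≤ dist o (x i) := fun t => by
    filter_upwards [hx.eventually_ge_atTop (t : ℝ)] with i hi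
    rwa [dist_comm]
  refine ⟨⟨γ, Isometry.of_dist_eq fun s t => ?_⟩, ?_, fun t => ?_⟩
  · refine tendsto_nhds_unique ((hγ s).dist (hγ t)) (tendsto_const_nhds.congr' ?_)
    filter_upwards [hlarge s, hlarge t] with i hs ht
    rw [hF, min_eq_left hs, min_eq_left ht, NNReal.dist_eq]
  · exact tendsto_nhds_unique (hγ 0) (by simp [hF0])
  · have h1 : ∀ᶠ i in (U : Filter ι), dist (F i t) (γ t) < 1 :=
      (hγ t).eventually (Metric.ball_mem_nhds _ one_pos)
    have h2 : dist (γ t) o ≥ t - 1 / 2 := by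
      have : Tendsto (fun i => dist (F i t) o) U (𝓝 (dist (γ t) o)) := (hγ t).dist tendsto_const_nhds
      refine ge_of_tendsto this ?_
      filter_upwards [hlarge t] with i hi
      rw [← hF0 i, hF, min_eq_left hi, NNReal.coe_zero, min_eq_left (a := (0 : ℝ)) dist_nonneg,
        sub_zero, abs_of_nonneg t.coe_nonneg]
      linarith
    filter_upwards [h1, hlarge t] with i hi hi'
    have h3 := hFe i t
    rw [min_eq_left hi'] at h3
    have h4 := dist_triangle (x i) (F i t) (γ t)
    change _ ≤ gromovProduct o (x i) (γ t)
    rw [gromovProduct, dist_comm (x i) o]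
    linarith

/-- If the common Gromov product is infinite, points at equal times on representing rays have Gromov
product about `t` and distance about `t` from `o`, so they stay a bounded distance apart. -/
theorem eq_of_forall_exists_le_bgp (o : X) {ξ η : Boundary X}
    (h : ∀ R : ℝ, ∃ z, R ≤ bgp o z ξ ∧ R ≤ bgp o z η) : ξ = η := by
  obtain ⟨α, hα⟩ := hX.hyperbolic
  obtain ⟨γ, rfl⟩ := exists_endpoint_eq ξ
  obtain ⟨γ', rfl⟩ := exists_endpoint_eq η
  have key : ∀ (γ : GeodesicRay X) (t : ℝ≥0), (t : ℝ) - dist (γ 0) o ≤ bgp o (γ t) γ.endpoint := by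
    intro γ t
    have h1 := bgp_le_add_left hX (γ 0) o (γ t) γ.endpoint
    rw [IsRay.bgp_eq hX ⟨rfl, rfl⟩] at h1
    linarith
  have key2 : ∀ (γ : GeodesicRay X) (t : ℝ≥0), dist (γ t) o ≤ t + dist (γ 0) o := by
    intro γ t
    have h1 := dist_triangle (γ t) (γ 0) o
    rw [IsRay.dist_eq (o := γ 0) ⟨rfl, rfl⟩] at h1
    exact h1
  rw [endpoint_eq_iff]
  refine ⟨4 * (dist (γ 0) o + dist (γ' 0) o) + 6 * |α|, fun t => ?_⟩
  obtain ⟨z, hz, hz'⟩ := h t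
  have h1 := min_bgp_le_bgp hX hα o (γ t) z γ.endpoint γ'.endpoint
  have h2 := min_bgp_le_gromovProduct hX hα o (γ t) (γ' t) γ'.endpoint
  have h3 := key γ t
  have h4 := key γ' t
  have h5 := key2 γ t
  have h6 := key2 γ' t
  have h7 : (t : ℝ) - dist (γ 0) o ≤
      min (bgp o (γ t) γ.endpoint) (min (bgp o z γ.endpoint) (bgp o z γ'.endpoint)) :=
    le_min h3 (le_min (by linarith [dist_nonneg (x := γ 0) (y := o)])
      (by linarith [dist_nonneg (x := γ 0) (y := o)]))
  have h8 : (t : ℝ) - dist (γ 0) o - dist (γ' 0) o - 2 * |α| ≤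
      min (bgp o (γ t) γ'.endpoint) (bgp o (γ' t) γ'.endpoint) := by
    refine le_min ?_ ?_ <;>
    linarith [dist_nonneg (x := γ 0) (y := o), dist_nonneg (x := γ' 0) (y := o), le_abs_self α,
      abs_nonneg α]
  rw [gromovProduct] at h2
  linarith [le_abs_self α, dist_nonneg (x := γ 0) (y := o), dist_nonneg (x := γ' 0) (y := o)]

theorem exists_limit_point (o : X) {ι : Type*} (U : Ultrafilter ι) (x : ι → X)
    (hx : Tendsto (fun i => dist (x i) o) U atTop) :
    ∃ ξ : Boundary X, (∃ γ, IsRay γ o ξ) ∧ ∀ R : ℝ, ∀ᶠ i in (U : Filter ι), R ≤ bgp o (x i) ξ := by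
  obtain ⟨α, hα⟩ := hX.hyperbolic
  have : Nonempty X := ⟨o⟩
  have h0 := FourPoint.nonneg hα
  obtain ⟨γ, hγ, h⟩ := exists_limit_ray hX o U x hx
  have hray : IsRay γ o γ.endpoint := ⟨hγ, rfl⟩
  refine ⟨γ.endpoint, ⟨γ, hray⟩, fun R => ?_⟩
  filter_upwards [h (Real.toNNReal (R + 1 + α))] with i hi
  have h1 := min_gromovProduct_le_bgp hX hα o (x i) (γ (Real.toNNReal (R + 1 + α))) γ.endpoint
  rw [hray.bgp_eq hX] at h1
  have h2 := Real.le_coe_toNNReal (R + 1 + α)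
  have h3 : R + α ≤ min (gromovProduct o (x i) (γ (Real.toNNReal (R + 1 + α))))
    (Real.toNNReal (R + 1 + α) : ℝ) := le_min (by linarith) (by linarith)
  linarith

theorem exists_isRay (o : X) (ξ : Boundary X) : ∃ γ, IsRay γ o ξ := by
  obtain ⟨γ, rfl⟩ := exists_endpoint_eq ξ
  have hd : ∀ t : ℝ≥0, (t : ℝ) - dist (γ 0) o ≤ dist (γ t) o := fun t => by
    have h1 := dist_triangle (γ t) o (γ 0)
    rw [IsRay.dist_eq (o := γ 0) ⟨rfl, rfl⟩, dist_comm o] at h1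
    linarith
  have hlim : Tendsto (fun n : ℕ => dist (γ n) o) (hyperfilter ℕ : Filter ℕ) atTop := by
    refine Tendsto.mono_left (tendsto_atTop_mono (fun n : ℕ => hd n) ?_) Nat.hyperfilter_le_atTop
    simpa [sub_eq_add_neg] using tendsto_atTop_add_const_right atTop (-dist (γ 0) o)
      (tendsto_natCast_atTop_atTop (R := ℝ))
  obtain ⟨ξ, hray, hξ⟩ := exists_limit_point hX o (hyperfilter ℕ) (fun n => γ n) hlim
  have : γ.endpoint = ξ := by
    refine eq_of_forall_exists_le_bgp hX o fun R => ?_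
    obtain ⟨m, hm⟩ := exists_nat_ge (R + dist (γ 0) o)
    have hge : ∀ᶠ n in (hyperfilter ℕ : Filter ℕ), m ≤ n :=
      Nat.hyperfilter_le_atTop (eventually_ge_atTop m)
    obtain ⟨n, hn, hn'⟩ := ((hξ R).and hge).exists
    refine ⟨γ n, ?_, hn⟩
    have h1 := bgp_le_add_left hX (γ 0) o (γ n) γ.endpoint
    rw [IsRay.bgp_eq hX ⟨rfl, rfl⟩] at h1
    have : (m : ℝ) ≤ n := by exact_mod_cast hn'
    have h2 : ((n : ℝ≥0) : ℝ) = n := by simp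
    linarith
  rwa [this]

/-- Replaces the convergence filter, defined through all rays ending at `ξ`, by a single real
function; hyperbolicity makes the choice of ray and origin irrelevant. -/
theorem nhdsInfty_eq_comap (o : X) (ξ : Boundary X) :
    nhdsInfty ξ = comap (fun z => bgp o z ξ) atTop := by
  obtain ⟨α, hα⟩ := hX.hyperbolic
  refine le_antisymm ?_ ?_
  · rw [← tendsto_iff_comap, tendsto_atTop]
    intro R
    obtain ⟨γ, hγ⟩ := exists_isRay hX o ξ
    have hmem : {z | ∀ᶠ t in atTop, R ≤ gromovProduct (γ 0) z (γ t)} ∈ nhdsInfty ξ :=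
      mem_iInf_of_mem γ (mem_iInf_of_mem hγ.2 (mem_iInf_of_mem R (mem_principal_self _)))
    filter_upwards [hmem] with z hz
    rw [hγ.1] at hz
    have := (tendsto_bgp hX o z γ.endpoint).comp γ.tendsto_nhdsInfty
    rw [hγ.2] at this
    exact ge_of_tendsto this hz
  · simp only [nhdsInfty, le_iInf_iff, le_principal_iff]
    intro γ hγ R
    refine mem_comap.2 ⟨Set.Ici (R + α + dist (γ 0) o), Ici_mem_atTop _, fun z hz => ?_⟩
    have hz' : R + α + dist (γ 0) o ≤ bgp o z ξ := hz
    have h1 := bgp_le_add_left hX o (γ 0) z ξ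
    filter_upwards [eventually_ge_atTop (Real.toNNReal (R + α))] with t ht
    have h2 := min_bgp_le_gromovProduct hX hα (γ 0) z (γ t) ξ
    rw [← hγ, IsRay.bgp_eq hX ⟨rfl, rfl⟩, hγ] at h2
    have h3 : R + α ≤ t := (Real.le_coe_toNNReal _).trans (by exact_mod_cast ht)
    have h4 : R + α ≤ min (bgp (γ 0) z ξ) t :=
      le_min (by rw [dist_comm o] at h1; linarith) h3
    linarith

omit hX in
theorem visualBall_anti (o : X) (ξ : Boundary X) {s t : ℝ} (h : s ≤ t) :
    visualBall o ξ t ⊆ visualBall o ξ s :=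
  fun _ ⟨z, h1, h2⟩ => ⟨z, h.trans_lt h1, h.trans_lt h2⟩

omit hX in
theorem visualBall_symm {o : X} {ξ η : Boundary X} {t : ℝ} (h : η ∈ visualBall o ξ t) :
    ξ ∈ visualBall o η t :=
  let ⟨z, h1, h2⟩ := h
  ⟨z, h2, h1⟩

theorem mem_visualBall_self (o : X) (ξ : Boundary X) (t : ℝ) : ξ ∈ visualBall o ξ t := by
  obtain ⟨γ, hγ⟩ := exists_isRay hX o ξ
  have h : t < bgp o (γ (Real.toNNReal (t + 1))) ξ := by
    rw [hγ.bgp_eq hX]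
    linarith [Real.le_coe_toNNReal (t + 1)]
  exact ⟨_, h, h⟩

theorem visualBall_trans {α : ℝ} (hα : FourPoint X α) {o : X} {ξ η ζ : Boundary X} {t : ℝ}
    (h : η ∈ visualBall o ξ t) (h' : ζ ∈ visualBall o η t) : ζ ∈ visualBall o ξ (t - 2 * α) := by
  obtain ⟨z, h1, h2⟩ := h
  obtain ⟨w, h3, h4⟩ := h'
  have : Nonempty X := ⟨o⟩
  have h0 := hα.nonneg
  refine ⟨z, by linarith, ?_⟩
  have := min_bgp_le_bgp hX hα o z w η ζ
  have h5 : t < min (bgp o z η) (min (bgp o w η) (bgp o w ζ)) := lt_min h2 (lt_min h3 h4)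
  linarith

theorem isOpen_visualBall (o : X) (ξ : Boundary X) (t : ℝ) : IsOpen (visualBall o ξ t) := by
  have : visualBall o ξ t = ⋃ z ∈ {z | t < bgp o z ξ}, {η | t < bgp o z η} := by
    ext η; simp [visualBall]
  rw [this]
  exact isOpen_biUnion fun z _ => isOpen_lt continuous_const (continuous_bgp hX o z)

theorem eq_of_forall_mem_visualBall (o : X) {ξ η : Boundary X}
    (h : ∀ t, η ∈ visualBall o ξ t) : ξ = η :=
  eq_of_forall_exists_le_bgp hX o fun R =>
    let ⟨z, h1, h2⟩ := h R
    ⟨z, h1.le, h2.le⟩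

theorem exists_notMem_visualBall (o : X) {ξ η : Boundary X} (h : ξ ≠ η) :
    ∃ t, η ∉ visualBall o ξ t := by
  by_contra! hc
  exact h (eq_of_forall_mem_visualBall hX o hc)

/-- Along a ray the Gromov product with a close boundary point is as large as possible. -/
theorem IsRay.le_bgp_of_mem_visualBall {α : ℝ} (hα : FourPoint X α) {γ : GeodesicRay X} {o : X}
    {ξ η : Boundary X} (h : IsRay γ o ξ) {t : ℝ} (hη : η ∈ visualBall o ξ t) (u : ℝ≥0) :
    min (u : ℝ) t - 2 * α ≤ bgp o (γ u) η := by
  obtain ⟨z, h1, h2⟩ := hη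
  have := min_bgp_le_bgp hX hα o (γ u) z ξ η
  rw [h.bgp_eq hX] at this
  have h3 : min (u : ℝ) t ≤ min (u : ℝ) (min (bgp o z ξ) (bgp o z η)) :=
    min_le_min_left _ (le_min h1.le h2.le)
  linarith

theorem shadow_subset_visualBall {α : ℝ} (hα : FourPoint X α) (o : X) (ξ : Boundary X) (t : ℝ≥0) :
    shadow o ξ t ⊆ visualBall o ξ (t - (4 * α + 1)) := by
  have : Nonempty X := ⟨o⟩
  have h0 := hα.nonneg
  rintro η (rfl | ⟨γ, hγ, s, hs, hmin⟩)
  · exact mem_visualBall_self hX _ _ _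
  have hb := hγ.bgp_eq hX t
  refine ⟨γ t, by rw [hb]; linarith, ?_⟩
  by_contra! hlt
  set m : ℝ := t - bgp o (γ t) η with hm
  have hm0 : bgp o (γ t) η = t - m := by rw [hm]; ring
  have hnn := bgp_nonneg hX o (γ t) η
  have hs' : (t : ℝ) < s := hs
  -- If `η` branched off the ray at time `t - m` with `m ≥ 4α + 1`, then `β_η` at that time would be
  -- below its value at every `s > t`, contradicting minimality at `s`.
  set u : ℝ≥0 := ⟨t - m, by linarith⟩ with hu
  have hu' : (u : ℝ) = t - m := rfl
  have h1 := min_gromovProduct_le_bgp hX hα o (γ u) (γ t) η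
  rw [hγ.gromovProduct_eq, hm0, hu', min_eq_left (a := (t : ℝ) - m) (b := (t : ℝ)) (by linarith),
    min_self] at h1
  have h2 := min_gromovProduct_le_bgp hX hα o (γ t) (γ s) η
  rw [hγ.gromovProduct_eq, min_eq_left hs'.le, hm0] at h2
  have h3 : bgp o (γ s) η ≤ t - m + α := by
    rcases min_choice (t : ℝ) (bgp o (γ s) η) with h | h <;> rw [h] at h2 <;> linarith
  have h4 := hmin u
  rw [busemann_eq_bgp, busemann_eq_bgp, hγ.dist_eq, hγ.dist_eq, hu'] at h4
  linarith

theorem visualBall_subset_shadow {α : ℝ} (hα : FourPoint X α) (o : X) (ξ : Boundary X) (t : ℝ≥0) :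
    visualBall o ξ (t + (4 * α + 1)) ⊆ shadow o ξ t := by
  have : Nonempty X := ⟨o⟩
  have h0 := hα.nonneg
  intro η hη
  by_cases hne : η = ξ
  · exact Or.inl hne
  right
  obtain ⟨γ, hγ⟩ := exists_isRay hX o ξ
  obtain ⟨R, hR⟩ := exists_notMem_visualBall hX o (Ne.symm hne)
  have hbd : ∀ s : ℝ≥0, R < s → bgp o (γ s) η ≤ R := by
    intro s hs
    by_contra! hlt
    exact hR ⟨γ s, by rwa [hγ.bgp_eq hX], hlt⟩
  let f : ℝ≥0 → ℝ := fun s => busemann η (γ s) o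
  have hcont : Continuous f := by
    refine (LipschitzWith.of_dist_le_mul (K := 1) fun s s' => ?_).continuous
    have h1 := busemann_add hX η (γ s) (γ s') o
    have h2 := busemann_le_dist hX η (γ s) (γ s')
    have h3 := neg_dist_le_busemann hX η (γ s) (γ s')
    rw [γ.2.dist_eq] at h2 h3
    rw [NNReal.coe_one, one_mul, Real.dist_eq, abs_le]
    constructor <;> linarith
  -- A minimum of `β_η` on the ray exists because `η ≠ ξ` bounds the Gromov products along the ray,
  -- so the function grows like `s`.
  have htop : Tendsto f (cocompact ℝ≥0) atTop := by
    have hle : cocompact ℝ≥0 ≤ atTop := by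
      rw [atTop_basis.ge_iff]
      intro a _
      refine mem_cocompact.2 ⟨Set.Icc 0 a, isCompact_Icc, fun s hs => ?_⟩
      by_contra h
      exact hs ⟨zero_le, (not_le.1 h).le⟩
    refine Tendsto.mono_left ?_ hle
    have h1 : Tendsto (fun s : ℝ≥0 => (s : ℝ) - 2 * R) atTop atTop := by
      simpa [sub_eq_add_neg] using tendsto_atTop_add_const_right atTop (-(2 * R))
        (NNReal.tendsto_coe_atTop.2 tendsto_id)
    refine tendsto_atTop_mono' _ ?_ h1
    filter_upwards [eventually_gt_atTop (Real.toNNReal R)] with s hs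
    have := hbd s ((Real.le_coe_toNNReal R).trans_lt (by exact_mod_cast hs))
    change _ ≤ busemann η (γ s) o
    rw [busemann_eq_bgp, hγ.dist_eq]; linarith
  obtain ⟨s, hs⟩ := hcont.exists_forall_le htop
  refine ⟨γ, hγ, s, ?_, hs⟩
  by_contra! hle
  -- At time `u` the value of `β_η` is at most `-t - 1`, whereas at a time `s ≤ t` it is at least
  -- `-t`.
  set u : ℝ≥0 := t + ⟨4 * α + 1, by linarith⟩ with hu
  have hu' : (u : ℝ) = t + (4 * α + 1) := rfl
  have h1 := hs u
  have h2 := hγ.le_bgp_of_mem_visualBall hX hα hη u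
  rw [hu', min_self] at h2
  have h3 : f s ≥ -s := by
    have := neg_dist_le_busemann hX η (γ s) o
    rwa [hγ.dist_eq] at this
  have h4 : f u = u - 2 * bgp o (γ u) η := by
    change busemann η (γ u) o = _
    rw [busemann_eq_bgp, hγ.dist_eq]
  linarith

theorem shadowOf_horoball_subset (o : X) (p : Boundary X) {s T : ℝ} (h : Real.log s ≤ -T) :
    shadowOf o (horoball o p s) ⊆ visualBall o p (T - 1) := by
  rintro η ⟨γ, hγ, t, ht⟩
  have h1 : busemann p (γ t) o ≤ Real.log s := ht
  rw [busemann_eq_bgp, hγ.dist_eq] at h1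
  have h2 := bgp_le_dist hX o (γ t) p
  rw [hγ.dist_eq] at h2
  refine ⟨γ t, by linarith, ?_⟩
  rw [hγ.bgp_eq hX]
  linarith

theorem visualBall_subset_shadowOf {α : ℝ} (hα : FourPoint X α) (o : X) (p : Boundary X) {s T : ℝ}
    (hT : 0 ≤ T) (h : -T ≤ Real.log s) :
    visualBall o p (T + 4 * α) ⊆ shadowOf o (horoball o p s) := by
  have : Nonempty X := ⟨o⟩
  have h0 := hα.nonneg
  intro η hη
  obtain ⟨γ, hγ⟩ := exists_isRay hX o η
  set u : ℝ≥0 := ⟨T + 4 * α, by linarith⟩ with hu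
  have hu' : (u : ℝ) = T + 4 * α := rfl
  have h2 := hγ.le_bgp_of_mem_visualBall hX hα (visualBall_symm hη) u
  rw [hu', min_self] at h2
  refine ⟨γ, hγ, u, ?_⟩
  change busemann p (γ u) o ≤ _
  rw [busemann_eq_bgp, hγ.dist_eq]
  linarith

end Hyperbolic

end HypBoundary

namespace HypBoundary

/-! ### Equivariance under the group; limit points and parabolic points. -/

section Isometries

variable {Γ : Type*} [Group Γ] {X : Type*} [MetricSpace X] [MulAction Γ X] [IsIsometricSMul Γ X]

theorem IsRay.translate {γ : GeodesicRay X} {o : X} {ξ : Boundary X} (h : IsRay γ o ξ) (g : Γ) :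
    IsRay (γ.translate g) (g • o) (g • ξ) :=
  ⟨congrArg (g • ·) h.1, by rw [← h.2]; rfl⟩

variable (hX : IsBusemannRegularHyperbolic X)
include hX

theorem busemann_smul (g : Γ) (ξ : Boundary X) (x y : X) :
    busemann (g • ξ) (g • x) (g • y) = busemann ξ x y := by
  obtain ⟨γ, rfl⟩ := exists_endpoint_eq ξ
  have h1 := tendsto_busemann_ray hX (γ.translate g) (g • x) (g • y)
  have h2 : (fun t => dist (g • x) (γ.translate g t) - dist (g • y) (γ.translate g t)) =
      fun t => dist x (γ t) - dist y (γ t) :=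
    funext fun t => congrArg₂ (· - ·) (dist_smul g x (γ t)) (dist_smul g y (γ t))
  rw [h2] at h1
  exact tendsto_nhds_unique h1 (tendsto_busemann_ray hX γ x y)

theorem bgp_smul (g : Γ) (o x : X) (ξ : Boundary X) :
    bgp (g • o) (g • x) (g • ξ) = bgp o x ξ := by
  rw [bgp, bgp, busemann_smul hX, dist_smul]

theorem smul_mem_visualBall (g : Γ) {o : X} {ξ η : Boundary X} {t : ℝ}
    (h : η ∈ visualBall o ξ t) : g • η ∈ visualBall (g • o) (g • ξ) t := by
  obtain ⟨z, h1, h2⟩ := h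
  exact ⟨g • z, by rwa [bgp_smul hX], by rwa [bgp_smul hX]⟩

theorem smul_mem_visualBall_iff (g : Γ) {o : X} {ξ η : Boundary X} {t : ℝ} :
    g • η ∈ visualBall (g • o) (g • ξ) t ↔ η ∈ visualBall o ξ t := by
  refine ⟨fun h => ?_, smul_mem_visualBall hX g⟩
  simpa using smul_mem_visualBall hX g⁻¹ h

theorem visualBall_subset_of_dist (o o' : X) (ξ : Boundary X) (t : ℝ) :
    visualBall o ξ t ⊆ visualBall o' ξ (t - dist o o') := by
  rintro η ⟨z, h1, h2⟩
  exact ⟨z, by linarith [bgp_le_add_left hX o o' z ξ],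
    by linarith [bgp_le_add_left hX o o' z η]⟩

theorem continuous_busemann_left (ξ : Boundary X) (y : X) :
    Continuous fun x => busemann ξ x y := by
  refine (LipschitzWith.of_dist_le_mul (K := 1) fun x x' => ?_).continuous
  have h1 := busemann_add hX ξ x x' y
  have h2 := busemann_le_dist hX ξ x x'
  have h3 := neg_dist_le_busemann hX ξ x x'
  rw [NNReal.coe_one, one_mul, Real.dist_eq, abs_le]
  constructor <;> linarith

/-- Negative values occur along a ray to `p`, positive ones along a ray to any other boundary point.
Surjectivity makes the level of a horoball recoverable from the set. -/
theorem exists_busemann_eq (o : X) {p ξ : Boundary X} (hne : p ≠ ξ) (c : ℝ) :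
    ∃ x, busemann p x o = c := by
  rcases le_total c 0 with hc | hc
  · obtain ⟨γ, hγ⟩ := exists_isRay hX o p
    obtain ⟨u, hu⟩ : ∃ u : ℝ≥0, (u : ℝ) = -c := ⟨⟨-c, by linarith⟩, rfl⟩
    exact ⟨γ u, by rw [hγ.busemann_eq hX, hu, neg_neg]⟩
  · obtain ⟨γ, hγ⟩ := exists_isRay hX o ξ
    obtain ⟨R, hR⟩ := exists_notMem_visualBall hX o hne
    have hcont : Continuous fun s : ℝ≥0 => busemann p (γ s) o :=
      (continuous_busemann_left hX p o).comp γ.2.continuous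
    set u : ℝ≥0 := ⟨|R| + |R| + 1 + c, by positivity⟩
    have hu : (u : ℝ) = |R| + |R| + 1 + c := rfl
    have h1 : c ≤ busemann p (γ u) o := by
      have : bgp o (γ u) p ≤ R := by
        by_contra! hlt
        refine hR ⟨γ u, hlt, ?_⟩
        rw [hγ.bgp_eq hX, hu]
        linarith [le_abs_self R, abs_nonneg R]
      rw [busemann_eq_bgp, hγ.dist_eq, hu]
      linarith [le_abs_self R]
    have h0 : busemann p (γ 0) o = 0 := by rw [hγ.1, busemann_self hX]
    obtain ⟨s, -, hs⟩ := intermediate_value_Icc (zero_le (a := u)) hcont.continuousOn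
      (show c ∈ Set.Icc _ _ from ⟨by rw [h0]; exact hc, h1⟩)
    exact ⟨γ s, hs⟩

omit [IsIsometricSMul Γ X] in
theorem mem_limitSet_iff (o : X) (ξ : Boundary X) :
    ξ ∈ limitSet Γ o ↔ ∀ R : ℝ, ∃ g : Γ, R ≤ bgp o (g • o) ξ := by
  change (∃ᶠ x in nhdsInfty ξ, x ∈ MulAction.orbit Γ o) ↔ _
  rw [nhdsInfty_eq_comap hX o, frequently_comap, frequently_atTop]
  refine forall_congr' fun R => ⟨?_, ?_⟩
  · rintro ⟨b, hb, _, h, g, rfl⟩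
    exact ⟨g, hb.trans_eq h.symm⟩
  · rintro ⟨g, hg⟩
    exact ⟨_, hg, _, rfl, MulAction.mem_orbit _ _⟩

theorem smul_mem_limitSet (o : X) (g : Γ) {ξ : Boundary X} (h : ξ ∈ limitSet Γ o) :
    g • ξ ∈ limitSet Γ o := by
  rw [mem_limitSet_iff hX] at h ⊢
  intro R
  obtain ⟨k, hk⟩ := h (R + dist (g • o) o)
  refine ⟨g * k, ?_⟩
  rw [← bgp_smul hX g] at hk
  rw [mul_smul]
  linarith [bgp_le_add_left hX (g • o) o (g • k • o) (g • ξ)]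

-- Translation length is a conjugacy invariant: a bounded error in the displacement of the `k`-th
-- power of `g ^ n` disappears after division by `k`.
omit hX in
theorem IsLoxodromic.of_conj {o : X} {g h : Γ} (hg : IsLoxodromic o (h * g * h⁻¹)) :
    IsLoxodromic o g := by
  obtain ⟨c, hc, H⟩ := hg
  refine ⟨c, hc, fun n => ?_⟩
  have hsub : ∀ k : ℕ, dist o ((g ^ n) ^ k • o) ≤ k * dist o (g ^ n • o) := by
    intro k
    induction k with
    | zero => simp
    | succ k ih =>
      have := dist_triangle o ((g ^ n) ^ k • o) ((g ^ n) ^ (k + 1) • o)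
      rw [pow_succ, mul_smul, dist_smul] at this
      rw [pow_succ, mul_smul]
      push_cast
      linarith
  have hconj : ∀ k : ℕ, c * (n * k : ℕ) ≤ dist o ((g ^ n) ^ k • o) + 2 * dist o (h⁻¹ • o) := by
    intro k
    have h1 := H (n * k)
    rw [conj_pow, pow_mul, mul_smul, mul_smul] at h1
    have h2 : dist o (h • (g ^ n) ^ k • h⁻¹ • o) = dist (h⁻¹ • o) ((g ^ n) ^ k • h⁻¹ • o) := by
      rw [← dist_smul h⁻¹ o]; simp
    rw [h2] at h1
    have h3 := dist_triangle4 (h⁻¹ • o) o ((g ^ n) ^ k • o) ((g ^ n) ^ k • h⁻¹ • o)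
    rw [dist_smul, dist_comm (h⁻¹ • o) o] at h3
    linarith
  by_contra! hlt
  obtain ⟨k, hk⟩ := exists_nat_gt (2 * dist o (h⁻¹ • o) / (c * n - dist o (g ^ n • o)))
  rw [div_lt_iff₀ (by linarith)] at hk
  have h1 := hsub k
  have h2 := hconj k
  push_cast at h2
  nlinarith

theorem smul_mem_parabolicPoints (o : X) (g : Γ) {p : Boundary X}
    (h : p ∈ parabolicPoints Γ o) : g • p ∈ parabolicPoints Γ o := by
  obtain ⟨h1, h2, h3⟩ := h
  refine ⟨smul_mem_limitSet hX o g h1, ?_, fun k hk hlox => ?_⟩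
  · have : (MulAction.stabilizer Γ (g • p) : Set Γ) =
        (MulAut.conj g) '' (MulAction.stabilizer Γ p : Set Γ) := by
      rw [MulAction.stabilizer_smul_eq_stabilizer_map_conj]; rfl
    rw [this]
    exact h2.image (MulAut.conj g).injective.injOn
  · refine h3 (g⁻¹ * k * g) ?_ (IsLoxodromic.of_conj (h := g) ?_)
    · rw [MulAction.mem_stabilizer_iff] at hk ⊢
      rw [mul_smul, mul_smul, hk, inv_smul_smul]
    · convert hlox using 1
      group

end Isometries

/-- The distance from the base point to a horoball of radius `r p`. -/
noncomputable def horoballDist {X : Type*} [MetricSpace X] (r : Boundary X → ℝ)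
    (p : Boundary X) : ℝ :=
  -Real.log (r p)

theorem mem_openHoroball_iff {X : Type*} [MetricSpace X] {o : X} {r : Boundary X → ℝ}
    {p : Boundary X} {x : X} :
    x ∈ openHoroball o p (r p) ↔ busemann p x o < -horoballDist r p := by
  rw [horoballDist, neg_neg]; rfl

/-! ### Levels of the horoballs and the consequences of disjointness. -/

section Packing

variable {Γ : Type*} [Group Γ] {X : Type*} [MetricSpace X] [MulAction Γ X] [IsIsometricSMul Γ X]
  {o : X} {r : Boundary X → ℝ}

variable (hX : IsBusemannRegularHyperbolic X) (hr : IsHoroballPacking Γ o r)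
  (hne : (limitSet Γ o).Nontrivial)
include hX hr hne

/-- Both sides are levels of the Busemann function at `g • p` with the same strict sublevel set, and
that function takes every real value because there is a second limit point. -/
theorem horoballDist_smul (g : Γ) {p : Boundary X} (hp : p ∈ parabolicPoints Γ o) :
    horoballDist r (g • p) = horoballDist r p - busemann (g • p) (g • o) o := by
  obtain ⟨ξ, -, hξ⟩ := hne.exists_ne (g • p)
  have hset : ∀ x, busemann (g • p) x o < -horoballDist r p + busemann (g • p) (g • o) o ↔
      busemann (g • p) x o < -horoballDist r (g • p) := by
    intro x
    have h2 := busemann_add hX (g • p) x (g • o) o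
    have h3 : busemann p (g⁻¹ • x) o = busemann (g • p) x (g • o) := by
      rw [← busemann_smul hX g, smul_inv_smul]
    rw [← mem_openHoroball_iff, ← hr.invariant g p hp, Set.mem_smul_set_iff_inv_smul_mem,
      mem_openHoroball_iff, h3]
    constructor <;> intro h <;> linarith
  have key : -horoballDist r p + busemann (g • p) (g • o) o = -horoballDist r (g • p) := by
    rcases lt_trichotomy (-horoballDist r p + busemann (g • p) (g • o) o)
      (-horoballDist r (g • p)) with h | h | h
    · obtain ⟨x, hx⟩ := exists_busemann_eq hX o hξ.symm
        (-horoballDist r p + busemann (g • p) (g • o) o)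
      have := (hset x).2 (by rw [hx]; exact h)
      exact absurd this (by rw [hx]; exact lt_irrefl _)
    · exact h
    · obtain ⟨x, hx⟩ := exists_busemann_eq hX o hξ.symm (-horoballDist r (g • p))
      have := (hset x).1 (by rw [hx]; exact h)
      exact absurd this (by rw [hx]; exact lt_irrefl _)
  linarith

theorem busemann_orbit (g : Γ) {p : Boundary X} (hp : p ∈ parabolicPoints Γ o) :
    busemann p (g • o) o = horoballDist r (g⁻¹ • p) - horoballDist r p := by
  have := horoballDist_smul hX hr hne g (smul_mem_parabolicPoints hX o g⁻¹ hp)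
  rw [smul_inv_smul] at this
  linarith

theorem busemann_stabilizer {g : Γ} {p : Boundary X} (hp : p ∈ parabolicPoints Γ o)
    (hg : g ∈ MulAction.stabilizer Γ p) : busemann p (g • o) o = 0 := by
  rw [busemann_orbit hX hr hne g hp, MulAction.mem_stabilizer_iff.1 (inv_mem hg), sub_self]

-- By disjointness the base point lies in at most one open horoball, so at most one level is
-- negative.
omit hne in
theorem exists_neg_le_horoballDist :
    ∃ a : ℝ, 0 ≤ a ∧ ∀ p ∈ parabolicPoints Γ o, -a ≤ horoballDist r p := by
  by_cases h : ∃ p ∈ parabolicPoints Γ o, horoballDist r p < 0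
  · obtain ⟨p, hp, hlt⟩ := h
    refine ⟨-horoballDist r p, by linarith, fun q hq => ?_⟩
    by_cases hpq : p = q
    · rw [hpq, neg_neg]
    · have hlt' : 0 ≤ horoballDist r q := by
        by_contra! hlt'
        refine Set.disjoint_left.1 (hr.disjoint p hp q hq hpq)
          (show o ∈ _ from ?_) ?_ <;>
        rw [mem_openHoroball_iff, busemann_self hX] <;> linarith
      linarith
  · push Not at h
    exact ⟨0, le_rfl, fun p hp => by simpa using h p hp⟩

omit hne in
/-- The Gromov product of two parabolic points is controlled by the radii of their (disjoint)
horoballs. -/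
theorem le_of_mem_visualBall_parabolic {α a : ℝ} (hα : FourPoint X α)
    (ha : ∀ p ∈ parabolicPoints Γ o, -a ≤ horoballDist r p) {p q : Boundary X}
    (hp : p ∈ parabolicPoints Γ o) (hq : q ∈ parabolicPoints Γ o) (hpq : p ≠ q) {t : ℝ}
    (h : q ∈ visualBall o p t) :
    t ≤ (horoballDist r p + horoballDist r q) / 2 + (4 * α + 1 + |a|) := by
  wlog hle : horoballDist r q ≤ horoballDist r p generalizing p q with H
  · rw [add_comm (horoballDist r p)]
    exact H hq hp hpq.symm (visualBall_symm h) (le_of_not_ge hle)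
  have : Nonempty X := ⟨o⟩
  have hα0 := hα.nonneg
  obtain ⟨γ, hγ⟩ := exists_isRay hX o p
  by_contra! hlt
  -- The point at time `m` of the ray to `p` is inside the horoball of `p`; were `q` too close to
  -- `p`, it would also be inside that of `q`.
  set m : ℝ≥0 := ⟨max (max (horoballDist r p + 1 / 2) t) 0, le_max_right _ _⟩ with hm
  have hm' : (m : ℝ) = max (max (horoballDist r p + 1 / 2) t) 0 := rfl
  have h1 : horoballDist r p + 1 / 2 ≤ m := by rw [hm']; simp
  have h2 : t ≤ m := by rw [hm']; simp
  have h3 := hγ.le_bgp_of_mem_visualBall hX hα h m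
  rw [min_eq_right h2] at h3
  refine Set.disjoint_left.1 (hr.disjoint p hp q hq hpq) (show γ m ∈ _ from ?_) ?_ <;>
    rw [mem_openHoroball_iff]
  · rw [hγ.busemann_eq hX]; linarith
  · rw [busemann_eq_bgp, hγ.dist_eq]
    have ha1 := ha p hp
    have ha2 := ha q hq
    have ha3 := le_abs_self a
    have ha4 := abs_nonneg a
    have h4 : (m : ℝ) ≤ 2 * t - 4 * α - horoballDist r q - 1 / 2 := by
      rw [hm']
      refine max_le (max_le ?_ ?_) ?_ <;> linarith
    linarith

end Packing

/-! ### Coboundedness of the thick part of the rays to limit points. -/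

section Cocompact

variable {Γ : Type*} [Group Γ] {X : Type*} [MetricSpace X] [MulAction Γ X] [IsIsometricSMul Γ X]
  {o : X} {r : Boundary X → ℝ}

omit [IsIsometricSMul Γ X] in
theorem IsDiscreteAction.exists_nearest (h : IsDiscreteAction Γ X) (o x : X) :
    ∃ g : Γ, ∀ k : Γ, dist x (g • o) ≤ dist x (k • o) := by
  have hfin : {g : Γ | dist x (g • o) ≤ dist x o}.Finite := by
    refine (h o (dist x o + dist x o)).subset fun g hg => ?_
    have : dist x (g • o) ≤ dist x o := hg
    have h1 := dist_triangle o x (g • o)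
    rw [dist_comm o x] at h1
    exact h1.trans (by linarith)
  obtain ⟨g, hg, hmin⟩ := Set.exists_min_image _ (fun g : Γ => dist x (g • o)) hfin
    ⟨1, by simp⟩
  refine ⟨g, fun k => ?_⟩
  by_cases hk : dist x (k • o) ≤ dist x o
  · exact hmin k hk
  · exact (show dist x (g • o) ≤ dist x o from hg).trans (not_le.1 hk).le

variable (hX : IsBusemannRegularHyperbolic X)
include hX

-- A point of a ray separates its origin from its endpoint, so no direction `w` can be close to
-- both.
omit [IsIsometricSMul Γ X] in
theorem IsRay.min_le {α : ℝ} (hα : FourPoint X α) {γ : GeodesicRay X} {a : X} {ξ : Boundary X}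
    (h : IsRay γ a ξ) (t : ℝ≥0) (w : X) :
    gromovProduct (γ t) a w ≤ α ∨ bgp (γ t) w ξ ≤ α := by
  have h1 := min_gromovProduct_le_bgp hX hα (γ t) a w ξ
  have h2 := bgp_add_swap hX (γ t) a ξ
  rw [h.bgp_eq hX, h.dist_eq] at h2
  rw [show bgp (γ t) a ξ = 0 by linarith] at h1
  exact min_le_iff.1 (by linarith)

omit hX in
theorem gromovProduct_add_swap (x y z : X) :
    gromovProduct x y z + gromovProduct y x z = dist x y := by
  rw [gromovProduct, gromovProduct, dist_comm y x, dist_comm z x, dist_comm z y]; ring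

/-- Uniform form of bounded parabolicity. -/
theorem IsBoundedParabolic.exists_notMem_visualBall {p : Boundary X}
    (hp : IsBoundedParabolic Γ o p) :
    ∃ C : ℝ, ∀ η ∈ limitSet Γ o, η ≠ p → ∃ g ∈ MulAction.stabilizer Γ p,
      g • η ∉ visualBall o p C := by
  obtain ⟨α, hα⟩ := hX.hyperbolic
  have : Nonempty X := ⟨o⟩
  have hα0 := FourPoint.nonneg hα
  obtain ⟨-, K, hKsub, hK, hcov⟩ := hp
  obtain ⟨γ, hγ⟩ := exists_isRay hX o p
  let u : ℕ → ℝ≥0 := fun M => ⟨M + 2 * α, by positivity⟩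
  have hu : ∀ M, (u M : ℝ) = M + 2 * α := fun M => rfl
  -- The compact set `K` misses `p`, hence a whole visual ball about `p`. The shift `2α` in `u` is
  -- the loss when passing from visual balls to Gromov products with points of the ray.
  obtain ⟨F, hF⟩ := hK.elim_finite_subcover (fun M : ℕ => {η | bgp o (γ (u M)) η < M})
    (fun M => isOpen_lt (continuous_bgp hX o _) continuous_const) (by
      intro η hη
      by_contra hcon
      simp only [Set.mem_iUnion, Set.mem_ofPred_eq, not_exists, not_lt] at hcon
      refine (hKsub hη).2 (eq_of_forall_exists_le_bgp hX o fun R => ?_)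
      obtain ⟨M, hM⟩ := exists_nat_ge R
      refine ⟨γ (u M), hM.trans (hcon M), ?_⟩
      rw [hγ.bgp_eq hX, hu]
      linarith)
  obtain ⟨B, hB⟩ := F.exists_le
  refine ⟨B + 2 * α, fun η hη hne => ?_⟩
  have := hcov ⟨hη, hne⟩
  simp only [Set.mem_iUnion] at this
  obtain ⟨g, hg, k, hk, rfl⟩ := this
  refine ⟨g⁻¹, inv_mem hg, ?_⟩
  simp only [inv_smul_smul]
  intro hmem
  have := hF hk
  simp only [Set.mem_iUnion, Set.mem_ofPred_eq] at this
  obtain ⟨M, hM, hlt⟩ := this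
  have hMB : (M : ℝ) ≤ B := by exact_mod_cast hB M hM
  have h1 := hγ.le_bgp_of_mem_visualBall hX hα hmem (u M)
  rw [hu, min_eq_left (by linarith)] at h1
  linarith

/-- The part of the union of the rays to limit points which does not go deep into the horoballs is
cobounded under the group. -/
theorem exists_forall_exists_dist_le (hΓ : IsGeometricallyFinite Γ o)
    (hr : IsHoroballPacking Γ o r) (hne : (limitSet Γ o).Nontrivial) (h : ℝ) :
    ∃ D : ℝ, ∀ ξ ∈ limitSet Γ o, ∀ γ : GeodesicRay X, IsRay γ o ξ → ∀ t : ℝ≥0,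
      (∀ p ∈ parabolicPoints Γ o, -horoballDist r p - h ≤ busemann p (γ t) o) →
      ∃ g : Γ, dist (γ t) (g • o) ≤ D := by
  obtain ⟨α, hα⟩ := hX.hyperbolic
  have : Nonempty X := ⟨o⟩
  have hα0 := FourPoint.nonneg hα
  by_contra! hcon
  choose ξ hξ γ hγ t hdepth hfar using fun n : ℕ => hcon n
  -- Translate so that `o` is a nearest orbit point of `y n`. The points `y n` leave every bounded
  -- set and accumulate at a boundary point `ζ`, which must be a limit point; both possible types of
  -- `ζ` contradict nearness of `o`.
  choose g hg using fun n => hΓ.discrete.exists_nearest o (γ n (t n))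
  set y : ℕ → X := fun n => (g n)⁻¹ • γ n (t n) with hy
  have hray : ∀ n, IsRay ((γ n).translate (g n)⁻¹) ((g n)⁻¹ • o) ((g n)⁻¹ • ξ n) :=
    fun n => (hγ n).translate _
  have hb : ∀ n, (g n)⁻¹ • ξ n ∈ limitSet Γ o := fun n => smul_mem_limitSet hX o _ (hξ n)
  have hdist : ∀ n (k : Γ), dist (y n) (k • o) = dist (γ n (t n)) ((g n * k) • o) := by
    intro n k
    rw [← dist_smul (g n), mul_smul]
    simp [hy]
  have hnear : ∀ n (k : Γ), dist (y n) o ≤ dist (y n) (k • o) := by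
    intro n k
    have h1 := hdist n 1
    rw [one_smul, mul_one] at h1
    rw [h1, hdist]
    exact hg n _
  have hlarge : ∀ n : ℕ, (n : ℝ) < dist (y n) o := by
    intro n
    have h1 := hdist n 1
    rw [one_smul, mul_one] at h1
    rw [h1]
    exact hfar n _
  obtain ⟨ζ, -, hζ⟩ := exists_limit_point hX o (hyperfilter ℕ) y
    (Tendsto.mono_left (tendsto_atTop_mono (fun n => (hlarge n).le)
      tendsto_natCast_atTop_atTop) Nat.hyperfilter_le_atTop)
  have hmin : ∀ n w, gromovProduct (y n) ((g n)⁻¹ • o) w ≤ α ∨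
      bgp (y n) w ((g n)⁻¹ • ξ n) ≤ α := fun n w => (hray n).min_le hX hα (t n) w
  -- The limit point of the translated points is a limit point of the group.
  have hζΛ : ζ ∈ limitSet Γ o := by
    rw [mem_limitSet_iff hX]
    intro R
    obtain ⟨n, hn⟩ := (hζ (R + 3 * α)).exists
    have hd := bgp_le_dist hX o (y n) ζ
    rcases hmin n o with h1 | h1
    · refine ⟨(g n)⁻¹, ?_⟩
      have h2 := gromovProduct_add_swap (y n) o ((g n)⁻¹ • o)
      rw [gromovProduct_comm (y n)] at h2
      have h3 := min_gromovProduct_le_bgp hX hα o ((g n)⁻¹ • o) (y n) ζ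
      rw [gromovProduct_comm o] at h3
      have h4 : R + 2 * α ≤ min (gromovProduct o (y n) ((g n)⁻¹ • o)) (bgp o (y n) ζ) :=
        le_min (by linarith) (by linarith)
      linarith
    · obtain ⟨k, hk⟩ := (mem_limitSet_iff hX o _).1 (hb n) (R + 2 * α)
      refine ⟨k, ?_⟩
      have h2 := bgp_add_swap hX o (y n) ((g n)⁻¹ • ξ n)
      rw [dist_comm] at h2
      have h3 := min_bgp_le_bgp hX hα o (k • o) (y n) ((g n)⁻¹ • ξ n) ζ
      have h4 : R + 2 * α ≤ min (bgp o (k • o) ((g n)⁻¹ • ξ n))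
          (min (bgp o (y n) ((g n)⁻¹ • ξ n)) (bgp o (y n) ζ)) :=
        le_min hk (le_min (by linarith) (by linarith))
      linarith
  -- If `ζ` is conical, an orbit point far out along a ray to `ζ` is closer to `y n` than `o` is.
  rcases hΓ.conical_or_parabolic ζ hζΛ with ⟨c, hc, R, u, hu, hcR⟩ | hpar
  · rw [nhdsInfty_eq_comap hX o, tendsto_comap_iff] at hu
    obtain ⟨k, hk⟩ := (hu.eventually_ge_atTop (2 * α + R + R + 1)).exists
    simp only [Function.comp_apply] at hk
    obtain ⟨s, hs⟩ := hcR k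
    have h1 := bgp_le_add_right hX o (u k • o) (c s) ζ
    rw [hc.bgp_eq hX] at h1
    obtain ⟨n, hn⟩ := (hζ s).exists
    have h2 := min_bgp_le_gromovProduct hX hα o (y n) (c s) ζ
    rw [hc.bgp_eq hX, min_eq_right hn, gromovProduct, hc.dist_eq] at h2
    have h3 := hnear n (u k)
    have h4 := dist_triangle (y n) (c s) (u k • o)
    rw [dist_comm (c s)] at h4
    linarith
  · have hζP := hpar.1
    obtain ⟨C, hC⟩ := hpar.exists_notMem_visualBall hX
    obtain ⟨ξ₁, hξ₁, ξ₂, hξ₂, hξ₁₂⟩ := hne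
    obtain ⟨R₀, hR₀⟩ := exists_notMem_visualBall hX o hξ₁₂
    set C₁ : ℝ := |R₀| + 2 * α with hC₁
    have hC₁0 : 0 ≤ C₁ := by positivity
    have hsep : ∀ q : Boundary X, ∃ η ∈ limitSet Γ o, η ∉ visualBall o q C₁ := by
      intro q
      by_contra! hq
      refine hR₀ (visualBall_anti o ξ₁ ?_ (visualBall_trans hX hα
        (visualBall_symm (hq ξ₁ hξ₁)) (hq ξ₂ hξ₂)))
      linarith [le_abs_self R₀]
    set C₂ : ℝ := 2 * C₁ + 4 * α + 2 with hC₂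
    obtain ⟨c, hc⟩ := exists_isRay hX o ζ
    -- Seen from `y n`, some limit point is not in the direction of `ζ`: either the endpoint of the
    -- translated ray, or, if `ζ` lies on that side, a limit point behind the origin of the ray
    -- supplied by `hsep`.
    have hline : ∀ n, ∃ η ∈ limitSet Γ o, η ∉ visualBall (y n) ζ C₂ := by
      intro n
      obtain ⟨w, hw⟩ : ∃ w, C₂ ≤ bgp (y n) w ζ := by
        obtain ⟨u, hu⟩ : ∃ u : ℝ≥0, (u : ℝ) = dist (y n) o + C₂ :=
          ⟨⟨dist (y n) o + C₂, by positivity⟩, rfl⟩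
        refine ⟨c u, ?_⟩
        have h1 := bgp_le_add_left hX o (y n) (c u) ζ
        rw [hc.bgp_eq hX, dist_comm, hu] at h1
        linarith
      rcases hmin n w with h1 | h1
      · obtain ⟨η, hη, hη'⟩ := hsep (g n • ζ)
        refine ⟨(g n)⁻¹ • η, smul_mem_limitSet hX o _ hη, fun hmem => ?_⟩
        rw [← smul_mem_visualBall_iff hX (g n)⁻¹, inv_smul_smul] at hη'
        set a : X := (g n)⁻¹ • o
        set η' := (g n)⁻¹ • η
        have h2 : C₂ - 2 * α ≤ bgp (y n) w η' := by
          obtain ⟨z, hz1, hz2⟩ := hmem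
          have h3 := min_bgp_le_bgp hX hα (y n) w z ζ η'
          have h4 : C₂ ≤ min (bgp (y n) w ζ) (min (bgp (y n) z ζ) (bgp (y n) z η')) :=
            le_min hw (le_min hz1.le hz2.le)
          linarith
        have h3 : bgp (y n) a η' ≤ 2 * α := by
          have h4 := min_bgp_le_gromovProduct hX hα (y n) a w η'
          rcases min_le_iff.1 (show min (bgp (y n) a η') (bgp (y n) w η') ≤ 2 * α by linarith)
            with h5 | h5 <;> linarith
        have h4 : bgp (y n) a ζ ≤ 2 * α := by
          have h4 := min_bgp_le_gromovProduct hX hα (y n) a w ζ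
          rcases min_le_iff.1 (show min (bgp (y n) a ζ) (bgp (y n) w ζ) ≤ 2 * α by linarith)
            with h5 | h5 <;> linarith
        have h5 := bgp_add_swap hX (y n) a η'
        have h6 := bgp_add_swap hX (y n) a ζ
        have h7 : dist (y n) a ≤ C₁ + 2 * α := by
          by_contra! hlt
          exact hη' ⟨y n, by linarith, by linarith⟩
        refine hη' (visualBall_anti _ _ ?_ (visualBall_subset_of_dist hX (y n) a ζ C₂ hmem))
        linarith
      · refine ⟨_, hb n, ?_⟩
        rintro ⟨z, hz1, hz2⟩
        have h3 := min_bgp_le_bgp hX hα (y n) w z ζ ((g n)⁻¹ • ξ n)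
        have h4 : C₂ ≤ min (bgp (y n) w ζ) (min (bgp (y n) z ζ) (bgp (y n) z ((g n)⁻¹ • ξ n))) :=
          le_min hw (le_min hz1.le hz2.le)
        linarith
    obtain ⟨n, hn⟩ := (hζ (|C| + 2 * C₂ + |horoballDist r ζ + h| + 1)).exists
    obtain ⟨η, hη, hη'⟩ := hline n
    obtain ⟨k, hk, hk'⟩ := hC η hη (by
      rintro rfl
      exact hη' (mem_visualBall_self hX _ _ _))
    have hkinv := inv_mem hk
    rw [← smul_mem_visualBall_iff hX k⁻¹, inv_smul_smul,
      MulAction.mem_stabilizer_iff.1 hkinv] at hk'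
    have hb0 := busemann_stabilizer hX hr ⟨ξ₁, hξ₁, ξ₂, hξ₂, hξ₁₂⟩ hζP hkinv
    -- Bounded parabolicity places `η` at bounded Gromov product with `ζ` from `o'`. If `ζ` and `y
    -- n` had a large Gromov product from `o'`, then `y n` would be near the geodesic from `η` to
    -- `ζ` and deep in the horoball, against `hdeep`. Since `o` is nearest and `k` preserves
    -- horospheres at `ζ`, the product from `o` is no larger than that from `o'`.
    set o' := k⁻¹ • o
    have hbus : busemann ζ (y n) o' = busemann ζ (y n) o := by
      have := busemann_add hX ζ (y n) o' o
      linarith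
    have hdeep : -horoballDist r ζ - h ≤ busemann ζ (y n) o := by
      have hne' : (limitSet Γ o).Nontrivial := ⟨ξ₁, hξ₁, ξ₂, hξ₂, hξ₁₂⟩
      have h1 := hdepth n (g n • ζ) (smul_mem_parabolicPoints hX o _ hζP)
      have h2 := horoballDist_smul hX hr hne' (g n) hζP
      have h3 := busemann_add hX (g n • ζ) (γ n (t n)) (g n • o) o
      have h4 := busemann_smul hX (g n) ζ (y n) o
      simp only [hy, smul_inv_smul] at h4
      simp only [hy]
      linarith
    have h1 : bgp o (y n) ζ ≤ bgp o' (y n) ζ := by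
      have := hnear n k⁻¹
      rw [bgp, bgp, hbus]
      linarith
    have hsum := bgp_add_swap hX (y n) o' ζ
    have hsum' := bgp_add_swap hX (y n) o' η
    have hle := bgp_nonneg hX (y n) o' ζ
    have hC0 := le_abs_self C
    have hD0 := le_abs_self (horoballDist r ζ + h)
    have hCn := abs_nonneg C
    have hDn := abs_nonneg (horoballDist r ζ + h)
    have hkey : bgp o' (y n) ζ ≤ |C| + 2 * C₂ + |horoballDist r ζ + h| := by
      by_contra! hlt
      have h2 : bgp o' (y n) η ≤ C := by
        by_contra! h3
        exact hk' ⟨y n, by linarith, h3⟩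
      have h3 : bgp (y n) o' ζ ≤ C₂ := by
        by_contra! h3
        refine hη' ⟨o', h3, ?_⟩
        linarith
      have h4 : bgp o' (y n) ζ = (dist (y n) o' - busemann ζ (y n) o') / 2 := rfl
      linarith
    linarith

end Cocompact

end HypBoundary

namespace HypBoundary

/-! ### Critical exponents and their conjugation invariance. -/

section CriticalExponent

variable {Γ : Type*} [Group Γ] {X : Type*} [MetricSpace X] [MulAction Γ X] {o : X}

theorem criticalExponent_nonneg (Q : Subgroup Γ) : 0 ≤ criticalExponent o Q := by
  rw [criticalExponent, limsup_eq]
  refine Real.sInf_nonneg fun a ha => ?_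
  obtain ⟨t, h1, h2⟩ := (ha.and (eventually_gt_atTop 0)).exists
  exact (div_nonneg (Real.log_natCast_nonneg _) h2.le).trans h1

theorem criticalExponent_bot : criticalExponent o (⊥ : Subgroup Γ) = 0 := by
  have : (fun t : ℝ => Real.log ({g : Γ | g ∈ (⊥ : Subgroup Γ) ∧ dist o (g • o) ≤ t}.ncard : ℝ) / t)
      = fun _ => 0 := by
    funext t
    have h1 : {g : Γ | g ∈ (⊥ : Subgroup Γ) ∧ dist o (g • o) ≤ t}.ncard ≤ 1 := by
      rw [← Set.ncard_singleton (1 : Γ)]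
      exact Set.ncard_le_ncard (fun g hg => Subgroup.mem_bot.1 hg.1) (Set.finite_singleton _)
    interval_cases h : {g : Γ | g ∈ (⊥ : Subgroup Γ) ∧ dist o (g • o) ≤ t}.ncard <;> simp
  rw [criticalExponent, this, limsup_const]

variable [IsIsometricSMul Γ X]

/-- Conjugation by `h` changes displacements of `o` by at most `2 d(o, h o)`, a shift of `t` that is
invisible after division by `t`. -/
theorem criticalExponent_le_conj (hΓ : IsDiscreteAction Γ X) (Q : Subgroup Γ) (h : Γ) :
    ∀ a, (∀ᶠ t : ℝ in atTop,
      Real.log ({g : Γ | g ∈ Q.map (MulAut.conj h).toMonoidHom ∧ dist o (g • o) ≤ t}.ncard : ℝ) / t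
        ≤ a) → ∀ ε > 0, ∀ᶠ t : ℝ in atTop,
      Real.log ({g : Γ | g ∈ Q ∧ dist o (g • o) ≤ t}.ncard : ℝ) / t ≤ a + ε := by
  intro a ha ε hε
  set c : ℝ := 2 * dist o (h • o) with hc
  have hc0 : 0 ≤ c := by positivity
  have hshift : Tendsto (fun t : ℝ => t + c) atTop atTop := tendsto_atTop_add_const_right _ _ tendsto_id
  have hbig := eventually_gt_atTop (max 0 (|a| * c / ε))
  filter_upwards [hshift.eventually ha, hbig] with t h1 h2
  have ht : 0 < t := (le_max_left _ _).trans_lt h2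
  have hta : |a| * c / ε < t := (le_max_right _ _).trans_lt h2
  rw [div_lt_iff₀ hε] at hta
  rw [div_le_iff₀ (by linarith)] at h1
  have hcard : {g : Γ | g ∈ Q ∧ dist o (g • o) ≤ t}.ncard ≤
      {g : Γ | g ∈ Q.map (MulAut.conj h).toMonoidHom ∧ dist o (g • o) ≤ t + c}.ncard := by
    rw [← Set.ncard_image_of_injective _ (MulAut.conj h).injective]
    refine Set.ncard_le_ncard ?_ ((hΓ o (t + c)).subset fun g hg => hg.2)
    rintro _ ⟨g, ⟨hg, hd⟩, rfl⟩
    refine ⟨Subgroup.mem_map_of_mem (MulAut.conj h).toMonoidHom hg, ?_⟩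
    rw [MulAut.conj_apply, mul_smul, mul_smul]
    have h3 := dist_triangle4 o (h • o) (h • g • o) (h • g • h⁻¹ • o)
    rw [dist_smul, dist_smul, dist_smul, ← dist_smul h o (h⁻¹ • o), smul_inv_smul,
      dist_comm (h • o)] at h3
    linarith
  have hpos : 0 < {g : Γ | g ∈ Q ∧ dist o (g • o) ≤ t}.ncard :=
    (Set.ncard_pos ((hΓ o t).subset fun g hg => hg.2)).2 ⟨1, Q.one_mem, by simpa using ht.le⟩
  have hlog : Real.log ({g : Γ | g ∈ Q ∧ dist o (g • o) ≤ t}.ncard : ℝ) ≤ a * (t + c) :=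
    (Real.log_le_log (by exact_mod_cast hpos) (by exact_mod_cast hcard)).trans h1
  rw [div_le_iff₀ ht]
  nlinarith [le_abs_self a]

/-- A real `limsup` is the infimum of the eventual upper bounds, with value 0 if there are none. The
reverse comparison `hBA` ensures that both sets are empty together. -/
theorem sInf_le_sInf_of_forall_add {A B : Set ℝ} (hA : ∀ a ∈ A, 0 ≤ a)
    (hAB : ∀ a ∈ A, ∀ ε > 0, a + ε ∈ B) (hBA : ∀ a ∈ B, ∀ ε > 0, a + ε ∈ A)
    (hB : ∀ a ∈ B, 0 ≤ a) : sInf B ≤ sInf A := by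
  rcases A.eq_empty_or_nonempty with rfl | hne
  · rcases B.eq_empty_or_nonempty with rfl | ⟨b, hb⟩
    · exact le_rfl
    · exact absurd (hBA b hb 1 one_pos) (Set.notMem_empty _)
  · refine le_csInf hne fun a ha => le_of_forall_pos_le_add fun ε hε => ?_
    exact csInf_le ⟨0, hB⟩ (hAB a ha ε hε)

theorem criticalExponent_conj (hΓ : IsDiscreteAction Γ X) (Q : Subgroup Γ) (h : Γ) :
    criticalExponent o (Q.map (MulAut.conj h).toMonoidHom) = criticalExponent o Q := by
  have hnn : ∀ (Q : Subgroup Γ), ∀ a ∈ {a : ℝ | ∀ᶠ t : ℝ in atTop,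
      Real.log ({g : Γ | g ∈ Q ∧ dist o (g • o) ≤ t}.ncard : ℝ) / t ≤ a}, 0 ≤ a := by
    intro Q a ha
    obtain ⟨t, h1, h2⟩ := (ha.and (eventually_gt_atTop 0)).exists
    exact (div_nonneg (Real.log_natCast_nonneg _) h2.le).trans h1
  have hback : (Q.map (MulAut.conj h).toMonoidHom).map (MulAut.conj h⁻¹).toMonoidHom = Q := by
    rw [Subgroup.map_map]
    convert Subgroup.map_id Q
    ext g
    simp
    group
  have h1 := criticalExponent_le_conj (o := o) hΓ Q h
  have h2 := criticalExponent_le_conj (o := o) hΓ (Q.map (MulAut.conj h).toMonoidHom) h⁻¹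
  rw [hback] at h2
  rw [criticalExponent, criticalExponent, limsup_eq, limsup_eq]
  exact le_antisymm (sInf_le_sInf_of_forall_add (hnn _) h2 h1 (hnn _))
    (sInf_le_sInf_of_forall_add (hnn _) h1 h2 (hnn _))

theorem rank_smul (hΓ : IsDiscreteAction Γ X) (g : Γ) (p : Boundary X) :
    rank Γ o (g • p) = rank Γ o p := by
  rw [rank, rank, MulAction.stabilizer_smul_eq_stabilizer_map_conj, criticalExponent_conj hΓ]

end CriticalExponent

/-! ### Excursions of rays into horoballs. -/

section CuspShadows

variable {Γ : Type*} [Group Γ] {X : Type*} [MetricSpace X] [MulAction Γ X] [IsIsometricSMul Γ X]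
  {o : X} {r : Boundary X → ℝ}

variable (hX : IsBusemannRegularHyperbolic X) (hr : IsHoroballPacking Γ o r)
  (hne : (limitSet Γ o).Nontrivial)
include hX hr hne

/-- Orbit points are at depth at most `a` in any horoball and Busemann functions are 1-Lipschitz, so
depth bounds the distance to the orbit from below. -/
theorem le_infDist_orbit {a : ℝ} (ha : ∀ p ∈ parabolicPoints Γ o, -a ≤ horoballDist r p)
    {p : Boundary X} (hp : p ∈ parabolicPoints Γ o) (x : X) :
    -busemann p x o - horoballDist r p - a ≤ Metric.infDist x (MulAction.orbit Γ o) := by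
  rw [Metric.le_infDist ⟨o, MulAction.mem_orbit_self o⟩]
  rintro _ ⟨g, rfl⟩
  change _ ≤ dist x (g • o)
  have h1 := busemann_orbit hX hr hne g hp
  have h2 := ha _ (smul_mem_parabolicPoints hX o g⁻¹ hp)
  have h3 := busemann_add hX p (g • o) x o
  have h4 := busemann_le_dist hX p (g • o) x
  rw [dist_comm] at h4
  linarith

theorem exists_infDist_orbit_bounds (hΓ : IsGeometricallyFinite Γ o) :
    ∃ D : ℝ, 0 ≤ D ∧ ∀ p ∈ parabolicPoints Γ o, ∀ γ : GeodesicRay X, IsRay γ o p →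
      ∀ t : ℝ≥0, |Metric.infDist (γ t) (MulAction.orbit Γ o) - abs ((t : ℝ) - horoballDist r p)| ≤
        D + 2 * max (horoballDist r p - t) 0 := by
  obtain ⟨a, ha0, ha⟩ := exists_neg_le_horoballDist (Γ := Γ) hX hr
  -- Depth `a + 1` works at the entry point: one step further the ray is in the open horoball of
  -- `p`, hence not in any other, and for `p` itself truncating the entry time at 0 costs at most
  -- `a`.
  obtain ⟨D, hD⟩ := exists_forall_exists_dist_le hX hΓ hr hne (a + 1)
  refine ⟨|D| + a, by positivity, fun p hp γ hγ t => ?_⟩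
  obtain ⟨m, hm⟩ : ∃ m : ℝ≥0, (m : ℝ) = max (horoballDist r p) 0 := ⟨⟨_, le_max_right _ _⟩, rfl⟩
  have hap := ha p hp
  have hmT : horoballDist r p ≤ m := hm ▸ le_max_left _ _
  have hmT' : (m : ℝ) ≤ horoballDist r p + a := hm ▸ max_le (by linarith) (by linarith)
  obtain ⟨g, hg⟩ := hD p hp.1 γ hγ m fun q hq => by
    by_cases hpq : p = q
    · rw [← hpq, hγ.busemann_eq hX]; linarith
    · by_contra! hlt
      refine Set.disjoint_left.1 (hr.disjoint p hp q hq hpq) (show γ (m + 1) ∈ _ from ?_) ?_ <;>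
        rw [mem_openHoroball_iff]
      · rw [hγ.busemann_eq hX]
        push_cast
        linarith
      · have h1 := busemann_add hX q (γ (m + 1)) (γ m) o
        have h2 := busemann_le_dist hX q (γ (m + 1)) (γ m)
        rw [γ.dist_eq] at h2
        push_cast at h2
        rw [add_sub_cancel_left, abs_one] at h2
        linarith
  have hup : Metric.infDist (γ t) (MulAction.orbit Γ o) ≤ |(t : ℝ) - m| + |D| := by
    have h1 := Metric.infDist_le_dist_of_mem (x := γ t) (MulAction.mem_orbit o g)
    have h2 := dist_triangle (γ t) (γ m) (g • o)
    rw [γ.dist_eq] at h2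
    linarith [le_abs_self D]
  have hlow := le_infDist_orbit hX hr hne ha hp (γ t)
  rw [hγ.busemann_eq hX] at hlow
  have h0 : 0 ≤ Metric.infDist (γ t) (MulAction.orbit Γ o) := Metric.infDist_nonneg
  have h3 := abs_nonneg D
  have h4 : |(t : ℝ) - m| ≤ |t - horoballDist r p| + a := by
    have := abs_sub_le (t : ℝ) (horoballDist r p) m
    have h5 : |horoballDist r p - m| ≤ a := by rw [abs_le]; constructor <;> linarith
    linarith
  rcases le_total (horoballDist r p) (t : ℝ) with h | h
  · rw [abs_of_nonneg (a := (t : ℝ) - horoballDist r p) (by linarith)] at h4 ⊢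
    rw [max_eq_right (a := horoballDist r p - t) (by linarith), abs_le]
    constructor <;> linarith
  · rw [abs_of_nonpos (a := (t : ℝ) - horoballDist r p) (by linarith)] at h4 ⊢
    rw [max_eq_left (a := horoballDist r p - t) (by linarith), abs_le]
    constructor <;> linarith

/-- An element `g` of the infinite stabilizer moves `o` far along a horosphere, so `g • o` is close
to `p`, and `g` carries any other limit point towards `g • o`. -/
theorem exists_ne_mem_visualBall (hΓ : IsDiscreteAction Γ X) {p : Boundary X}
    (hp : p ∈ parabolicPoints Γ o) (R : ℝ) :
    ∃ ξ ∈ limitSet Γ o, ξ ≠ p ∧ ξ ∈ visualBall o p R := by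
  obtain ⟨ξ, hξ, hξp⟩ := hne.exists_ne p
  obtain ⟨R₁, hR₁⟩ := exists_notMem_visualBall hX o hξp.symm
  have : ∃ g ∈ MulAction.stabilizer Γ p, 2 * (|R| + |R₁| + 1) < dist o (g • o) := by
    by_contra! hcon
    exact hp.2.1 ((hΓ o (2 * (|R| + |R₁| + 1))).subset fun g hg => hcon g hg)
  obtain ⟨g, hg, hd⟩ := this
  have hginv := inv_mem hg
  have h1 := busemann_stabilizer hX hr hne hp hg
  have h2 := busemann_stabilizer hX hr hne hp hginv
  have h3 : dist (g⁻¹ • o) o = dist o (g • o) := by rw [← dist_smul g]; simp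
  have h4 := le_abs_self R
  have h5 := le_abs_self R₁
  have h6 := abs_nonneg R
  have h7 := abs_nonneg R₁
  refine ⟨g • ξ, smul_mem_limitSet hX o g hξ, fun h => hξp ?_, g • o, ?_, ?_⟩
  · rw [← MulAction.mem_stabilizer_iff.1 hg] at h
    exact smul_left_cancel g h
  · rw [bgp, h1, dist_comm]; linarith
  · have h8 := bgp_add_swap hX o (g • o) (g • ξ)
    have h9 := bgp_smul hX g⁻¹ (g • o) o (g • ξ)
    rw [inv_smul_smul, inv_smul_smul] at h9
    have h10 : bgp o (g⁻¹ • o) ξ ≤ R₁ := by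
      by_contra! hlt
      refine hR₁ ⟨g⁻¹ • o, ?_, hlt⟩
      rw [bgp, h2, h3]; linarith
    linarith

/-- If `p` were fixed by the group, the orbit of `o` would lie on a horosphere and could accumulate
only at `p`. -/
theorem exists_smul_ne {p : Boundary X} (hp : p ∈ parabolicPoints Γ o) : ∃ g : Γ, g • p ≠ p := by
  by_contra! hfix
  obtain ⟨α, hα⟩ := hX.hyperbolic
  obtain ⟨ξ, hξ, hξp⟩ := hne.exists_ne p
  refine hξp.symm (eq_of_forall_exists_le_bgp hX o fun R => ?_)
  obtain ⟨g, hg⟩ := (mem_limitSet_iff hX o ξ).1 hξ (2 * |R|)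
  have h1 := busemann_stabilizer hX hr hne hp (MulAction.mem_stabilizer_iff.2 (hfix g))
  have h2 := bgp_le_dist hX o (g • o) ξ
  have h3 := le_abs_self R
  have h4 := abs_nonneg R
  refine ⟨g • o, ?_, by linarith⟩
  rw [bgp, h1]; linarith

/-- Either a point of a ray to a limit point is deep in a horoball, or there is a translate of `p`
whose horoball has about the right size and whose shadow contains the limit point. -/
theorem exists_cusp_dichotomy (hΓ : IsGeometricallyFinite Γ o) {p : Boundary X}
    (hp : p ∈ parabolicPoints Γ o) (h : ℝ) :
    ∃ C : ℝ, ∀ ξ ∈ limitSet Γ o, ∀ t : ℝ, 0 ≤ t →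
      (∃ q ∈ parabolicPoints Γ o, horoballDist r q + h ≤ t ∧
        ξ ∈ visualBall o q ((t + horoballDist r q + h) / 2)) ∨
      ∃ q ∈ MulAction.orbit Γ p, |horoballDist r q - t| ≤ C ∧ ξ ∈ visualBall o q (t - C) := by
  obtain ⟨D, hD⟩ := exists_forall_exists_dist_le hX hΓ hr hne h
  obtain ⟨k, hk⟩ := exists_smul_ne hX hr hne hp
  obtain ⟨C, hC⟩ := exists_notMem_visualBall hX o hk
  set M := |horoballDist r p| + |horoballDist r (k • p)| with hM
  refine ⟨|D| + 2 * |C| + M + 1, fun ξ hξ t ht => ?_⟩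
  obtain ⟨u, rfl⟩ : ∃ u : ℝ≥0, (u : ℝ) = t := ⟨⟨t, ht⟩, rfl⟩
  obtain ⟨γ, hγ⟩ := exists_isRay hX o ξ
  by_cases hdeep : ∀ q ∈ parabolicPoints Γ o, -horoballDist r q - h ≤ busemann q (γ u) o
  · right
    obtain ⟨g, hg⟩ := hD ξ hξ γ hγ u hdeep
    -- Of the two distinct points `p` and `k • p`, at least one is not in the direction of `g⁻¹ •
    -- o`; its image under `g` is then seen from `o` beyond `g • o`, with level about the distance
    -- of `g • o`.
    have hq : ∃ q ∈ MulAction.orbit Γ p, q ∈ parabolicPoints Γ o ∧ |horoballDist r q| ≤ M ∧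
        bgp o (g⁻¹ • o) q ≤ C := by
      by_contra! hcon
      refine hC ⟨g⁻¹ • o, ?_, ?_⟩
      · exact hcon _ (MulAction.mem_orbit _ _) (smul_mem_parabolicPoints hX o k hp)
          (by rw [hM]; linarith [abs_nonneg (horoballDist r p)])
      · exact hcon _ (MulAction.mem_orbit_self _) hp
          (by rw [hM]; linarith [abs_nonneg (horoballDist r (k • p))])
    obtain ⟨q, hqo, hqP, hqM, hqC⟩ := hq
    have h1 := horoballDist_smul hX hr hne g hqP
    have h2 := bgp_smul hX g o (g⁻¹ • o) q
    rw [smul_inv_smul] at h2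
    have h3 := bgp_add_swap hX o (g • o) (g • q)
    have h4 : bgp o (g • o) (g • q) = (dist (g • o) o - busemann (g • q) (g • o) o) / 2 := rfl
    have h5 := bgp_nonneg hX (g • o) o (g • q)
    have h6 : |dist (g • o) o - u| ≤ |D| := by
      have h7 := dist_triangle (g • o) (γ u) o
      have h8 := dist_triangle (γ u) (g • o) o
      rw [hγ.dist_eq] at h7 h8
      rw [dist_comm (g • o) (γ u)] at h7
      rw [abs_le]
      constructor <;> linarith [le_abs_self D]
    have h9 := abs_le.1 h6
    have h10 := abs_le.1 hqM
    have h11 := le_abs_self C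
    have h12 := bgp_le_add_right hX o (γ u) (g • o) ξ
    rw [hγ.bgp_eq hX] at h12
    rw [dist_comm o (g • o)] at h3
    have h13 := abs_nonneg C
    have h14 : 0 ≤ M := by positivity
    have h15 := le_abs_self D
    refine ⟨g • q, ?_, ?_, g • o, ?_, ?_⟩
    · obtain ⟨k', rfl⟩ := hqo
      exact ⟨g * k', mul_smul _ _ _⟩
    · rw [abs_le]; constructor <;> linarith
    · linarith
    · linarith
  · left
    push Not at hdeep
    obtain ⟨q, hq, hlt⟩ := hdeep
    have h1 := bgp_le_dist hX o (γ u) q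
    rw [hγ.dist_eq] at h1
    rw [busemann_eq_bgp, hγ.dist_eq] at hlt
    refine ⟨q, hq, by linarith, γ u, by linarith, ?_⟩
    rw [hγ.bgp_eq hX]
    linarith

end CuspShadows

end HypBoundary

namespace HypBoundary

/-! ### Measure of visual balls at parabolic points. -/

section ShadowMeasure

variable {Γ : Type*} [Group Γ] {X : Type*} [MetricSpace X] [MulAction Γ X] [IsIsometricSMul Γ X]
  {o : X} {r : Boundary X → ℝ} {δ : ℝ} {ν : Measure (Boundary X)} [IsFiniteMeasure ν]

theorem exp_le_mul_exp_of_le {C x y e : ℝ} (hC : 0 ≤ C) (h : x ≤ y + e) :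
    C * Real.exp x ≤ C * Real.exp e * Real.exp y := by
  rw [mul_assoc, ← Real.exp_add]
  exact mul_le_mul_of_nonneg_left (Real.exp_le_exp.2 (by linarith)) hC

variable (hX : IsBusemannRegularHyperbolic X) (hr : IsHoroballPacking Γ o r)
  (hne : (limitSet Γ o).Nontrivial) (hΓ : IsGeometricallyFinite Γ o) (hδ : 0 < δ)
  (hs : SatisfiesShadowLemma Γ o r δ ν)
include hX hr hne hΓ hδ hs

/-- Along the ray to `p` the lower bound of the shadow lemma grows like `exp (2 (δ_Π - δ) t)`, while
the total mass is finite. -/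
theorem criticalExponent_stabilizer_le {p : Boundary X} (hp : p ∈ parabolicPoints Γ o) :
    criticalExponent o (MulAction.stabilizer Γ p) ≤ δ := by
  by_contra! hlt
  obtain ⟨D, hD0, hD⟩ := exists_infDist_orbit_bounds hX hr hne hΓ
  obtain ⟨C, hC, H⟩ := hs
  obtain ⟨γ, hγ⟩ := exists_isRay hX o p
  set c := criticalExponent o (MulAction.stabilizer Γ p)
  set T := horoballDist r p with hT
  set B := C * ν.real Set.univ + δ * |T| + (2 * c - δ) * D with hB
  have hB0 : 0 ≤ B := by
    have : 0 ≤ 2 * c - δ := by linarith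
    positivity
  obtain ⟨t, ht⟩ : ∃ t : ℝ≥0, (t : ℝ) = |T| + T + 1 + B / (2 * (c - δ)) :=
    ⟨⟨|T| + T + 1 + B / (2 * (c - δ)), by
      have : 0 ≤ B / (2 * (c - δ)) := div_nonneg hB0 (by linarith)
      linarith [neg_abs_le T]⟩, rfl⟩
  have hdiv : 0 ≤ B / (2 * (c - δ)) := div_nonneg hB0 (by linarith)
  have htT : T < t := by rw [ht]; linarith [abs_nonneg T]
  have h1 := (H p hp.1 γ hγ t (MulAction.stabilizer Γ p) (Or.inr ⟨p, hp, by
    rw [mem_openHoroball_iff, hγ.busemann_eq hX]; linarith, rfl⟩)).1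
  have h2 := hD p hp γ hγ t
  rw [max_eq_right (by linarith), abs_of_nonneg (a := (t : ℝ) - horoballDist r p) (by linarith),
    abs_le] at h2
  set d := Metric.infDist (γ t) (MulAction.orbit Γ o)
  have h3 : ν.real (shadow o p t) ≤ ν.real Set.univ := measureReal_mono (Set.subset_univ _)
  have h4 : B ≤ 2 * (c - δ) * (t - T) := by
    have : B = 2 * (c - δ) * (B / (2 * (c - δ))) := by field_simp [(by linarith : c - δ ≠ 0)]
    rw [this]
    exact mul_le_mul_of_nonneg_left (by rw [ht]; linarith [abs_nonneg T]) (by linarith)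
  have h5 : C * ν.real Set.univ ≤ -δ * t + (2 * c - δ) * d := by
    have h6 : (2 * c - δ) * (t - T - D) ≤ (2 * c - δ) * d :=
      mul_le_mul_of_nonneg_left (by linarith) (by linarith)
    have h7 : δ * T ≤ δ * |T| := mul_le_mul_of_nonneg_left (le_abs_self T) hδ.le
    nlinarith
  have h6 := Real.add_one_le_exp (-δ * t + (2 * c - δ) * d)
  have h7 : C * ν.real Set.univ < Real.exp (-δ * t + (2 * c - δ) * d) := by linarith
  have h8 : ν.real Set.univ < C⁻¹ * Real.exp (-δ * t + (2 * c - δ) * d) := by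
    rw [inv_mul_eq_div, lt_div_iff₀ hC]; linarith
  linarith

theorem IsCuspSubgroup.abs_le {x : X} {Q : Subgroup Γ} (hQ : IsCuspSubgroup Γ o r x Q) :
    |2 * criticalExponent o Q - δ| ≤ δ := by
  rcases hQ with ⟨-, rfl⟩ | ⟨p, hp, -, rfl⟩
  · rw [criticalExponent_bot]; simp [abs_of_pos hδ]
  · have h1 := criticalExponent_stabilizer_le hX hr hne hΓ hδ hs hp
    have h2 := criticalExponent_nonneg (o := o) (MulAction.stabilizer Γ p)
    rw [_root_.abs_le]
    constructor <;> linarith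

theorem rank_le {p : Boundary X} (hp : p ∈ parabolicPoints Γ o) : rank Γ o p ≤ 2 * δ := by
  rw [rank]
  linarith [criticalExponent_stabilizer_le hX hr hne hΓ hδ hs hp]

omit [IsIsometricSMul Γ X] hX hr hne hΓ hδ hs [IsFiniteMeasure ν] in
theorem rank_nonneg [IsIsometricSMul Γ X] (p : Boundary X) : 0 ≤ rank Γ o p := by
  rw [rank]
  linarith [criticalExponent_nonneg (o := o) (MulAction.stabilizer Γ p)]

/-- The shadow lemma along the ray to a parabolic point. -/
theorem exists_shadow_parabolic_bounds :
    ∃ C : ℝ, 0 < C ∧ ∀ p ∈ parabolicPoints Γ o, ∀ t : ℝ≥0, horoballDist r p < t →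
      C⁻¹ * Real.exp (-δ * horoballDist r p - (2 * δ - rank Γ o p) * (t - horoballDist r p)) ≤
        ν.real (shadow o p t) ∧
      ν.real (shadow o p t) ≤
        C * Real.exp (-δ * horoballDist r p - (2 * δ - rank Γ o p) * (t - horoballDist r p)) := by
  obtain ⟨D, hD0, hD⟩ := exists_infDist_orbit_bounds hX hr hne hΓ
  obtain ⟨C, hC, H⟩ := id hs
  refine ⟨C * Real.exp (δ * D), by positivity, fun p hp t ht => ?_⟩
  obtain ⟨γ, hγ⟩ := exists_isRay hX o p
  have h1 := H p hp.1 γ hγ t (MulAction.stabilizer Γ p) (Or.inr ⟨p, hp, by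
    rw [mem_openHoroball_iff, hγ.busemann_eq hX]; linarith, rfl⟩)
  have h2 := hD p hp γ hγ t
  rw [max_eq_right (by linarith), abs_of_nonneg (a := (t : ℝ) - horoballDist r p) (by linarith),
    mul_zero, add_zero] at h2
  have h3 : |rank Γ o p - δ| ≤ δ := by
    have h4 := rank_le hX hr hne hΓ hδ hs hp
    have h5 := rank_nonneg (Γ := Γ) (o := o) p
    rw [_root_.abs_le]
    constructor <;> linarith
  set d := Metric.infDist (γ t) (MulAction.orbit Γ o)
  have h4 : |(rank Γ o p - δ) * (d - (t - horoballDist r p))| ≤ δ * D := by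
    rw [abs_mul]
    exact mul_le_mul h3 h2 (abs_nonneg _) hδ.le
  have h5 := _root_.abs_le.1 h4
  change C⁻¹ * Real.exp (-δ * t + (rank Γ o p - δ) * d) ≤ _ ∧
    _ ≤ C * Real.exp (-δ * t + (rank Γ o p - δ) * d) at h1
  constructor
  · refine le_trans ?_ h1.1
    rw [mul_inv, ← Real.exp_neg, mul_assoc, ← Real.exp_add]
    exact mul_le_mul_of_nonneg_left (Real.exp_le_exp.2 (by linarith)) (by positivity)
  · exact h1.2.trans (exp_le_mul_exp_of_le hC.le (by linarith))

/-- A bounded time before entering the horoball, the ray to `p` is within bounded distance of the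
orbit, so only the factor `exp (-δ t)` of the shadow lemma counts. -/
theorem exists_visualBall_parabolic_le (b : ℝ) :
    ∃ A : ℝ, 0 < A ∧ ∀ p ∈ parabolicPoints Γ o,
      ν.real (visualBall o p (horoballDist r p - b)) ≤ A * Real.exp (-δ * horoballDist r p) := by
  obtain ⟨α, hα⟩ := hX.hyperbolic
  obtain ⟨D, hD0, hD⟩ := exists_infDist_orbit_bounds hX hr hne hΓ
  obtain ⟨C, hC, H⟩ := id hs
  have : Nonempty X := ⟨o⟩
  have hα0 := FourPoint.nonneg hα
  set c := |b| + (4 * α + 1) with hc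
  have hc0 : 0 ≤ c := by positivity
  refine ⟨C * Real.exp (δ * c + δ * (D + 3 * c)) + ν.real Set.univ * Real.exp (δ * c),
    by positivity, fun p hp => ?_⟩
  rw [add_mul]
  rcases le_total c (horoballDist r p) with h | h
  · obtain ⟨γ, hγ⟩ := exists_isRay hX o p
    obtain ⟨t, ht⟩ : ∃ t : ℝ≥0, (t : ℝ) = horoballDist r p - c :=
      ⟨⟨horoballDist r p - c, by linarith⟩, rfl⟩
    -- The point may lie in some other horoball; its subgroup is irrelevant, since `|2 δ_Q - δ| ≤ δ`
    -- in all cases.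
    have hQ : ∃ Q : Subgroup Γ, IsCuspSubgroup Γ o r (γ t) Q := by
      by_cases hq : ∀ q ∈ parabolicPoints Γ o, γ t ∉ openHoroball o q (r q)
      · exact ⟨⊥, Or.inl ⟨hq, rfl⟩⟩
      · push Not at hq
        obtain ⟨q, hq, hmem⟩ := hq
        exact ⟨_, Or.inr ⟨q, hq, hmem, rfl⟩⟩
    obtain ⟨Q, hQ⟩ := hQ
    have h1 := (H p hp.1 γ hγ t Q hQ).2
    have h2 := hQ.abs_le hX hr hne hΓ hδ hs
    have h3 := hD p hp γ hγ t
    rw [max_eq_left (by linarith), abs_of_nonpos (a := (t : ℝ) - horoballDist r p) (by linarith),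
      _root_.abs_le] at h3
    set d := Metric.infDist (γ t) (MulAction.orbit Γ o)
    have hd : 0 ≤ d := Metric.infDist_nonneg
    have h4 : (2 * criticalExponent o Q - δ) * d ≤ δ * (D + 3 * c) :=
      mul_le_mul ((le_abs_self _).trans h2) (by linarith) hd hδ.le
    have h5 : visualBall o p (horoballDist r p - b) ⊆ shadow o p t := by
      refine (visualBall_anti o p ?_).trans (visualBall_subset_shadow hX hα o p t)
      rw [ht, hc]; linarith [le_abs_self b]
    have h6 : ν.real (visualBall o p (horoballDist r p - b)) ≤ ν.real (shadow o p t) :=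
      measureReal_mono h5
    have h7 : C * Real.exp (-δ * t + (2 * criticalExponent o Q - δ) * d) ≤
        C * Real.exp (δ * c + δ * (D + 3 * c)) * Real.exp (-δ * horoballDist r p) :=
      exp_le_mul_exp_of_le hC.le (by rw [ht]; linarith)
    have h8 : 0 ≤ ν.real Set.univ * Real.exp (δ * c) * Real.exp (-δ * horoballDist r p) := by
      positivity
    linarith
  · have h1 : ν.real (visualBall o p (horoballDist r p - b)) ≤ ν.real Set.univ :=
      measureReal_mono (Set.subset_univ _)
    have h2 : ν.real Set.univ ≤
        ν.real Set.univ * Real.exp (δ * c) * Real.exp (-δ * horoballDist r p) := by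
      rw [mul_assoc, ← Real.exp_add]
      refine le_mul_of_one_le_right measureReal_nonneg (Real.one_le_exp ?_)
      nlinarith
    have h3 : 0 ≤ C * Real.exp (δ * c + δ * (D + 3 * c)) * Real.exp (-δ * horoballDist r p) := by
      positivity
    linarith

theorem exists_visualBall_parabolic_bounds :
    ∃ A : ℝ, 0 < A ∧ ∀ p ∈ parabolicPoints Γ o, ∀ s : ℝ, 0 ≤ s →
      A⁻¹ * Real.exp (-δ * horoballDist r p - (2 * δ - rank Γ o p) * s) ≤
        ν.real (visualBall o p (horoballDist r p + s)) ∧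
      ν.real (visualBall o p (horoballDist r p + s)) ≤
        A * Real.exp (-δ * horoballDist r p - (2 * δ - rank Γ o p) * s) := by
  obtain ⟨α, hα⟩ := hX.hyperbolic
  obtain ⟨C, hC, H⟩ := exists_shadow_parabolic_bounds hX hr hne hΓ hδ hs
  obtain ⟨A, hA, hA'⟩ := exists_visualBall_parabolic_le hX hr hne hΓ hδ hs 0
  obtain ⟨a, ha0, ha⟩ := exists_neg_le_horoballDist (Γ := Γ) hX hr
  have : Nonempty X := ⟨o⟩
  have hα0 := FourPoint.nonneg hα
  set c := a + (4 * α + 1) with hc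
  have hc0 : 0 < c := by positivity
  set E := Real.exp (2 * δ * c) with hE
  have hE1 : 0 < E := Real.exp_pos _
  refine ⟨C * E + A * E, by positivity, fun p hp s hs0 => ?_⟩
  have hap := ha p hp
  have hk0 := rank_nonneg (Γ := Γ) (o := o) p
  have hk1 := rank_le hX hr hne hΓ hδ hs hp
  set T := horoballDist r p
  set k := rank Γ o p
  constructor
  · obtain ⟨t, ht⟩ : ∃ t : ℝ≥0, (t : ℝ) = T + s + c := ⟨⟨T + s + c, by linarith⟩, rfl⟩
    have h1 := (H p hp t (by linarith)).1
    have h2 : ν.real (shadow o p t) ≤ ν.real (visualBall o p (T + s)) :=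
      measureReal_mono ((shadow_subset_visualBall hX hα o p t).trans
        (visualBall_anti o p (by linarith)))
    refine le_trans ?_ (h1.trans h2)
    have h3 : (C * E + A * E)⁻¹ ≤ C⁻¹ * Real.exp (-(2 * δ * c)) := by
      rw [Real.exp_neg, ← mul_inv]
      exact inv_anti₀ (by positivity) (by linarith [mul_pos hA hE1])
    refine (mul_le_mul_of_nonneg_right h3 (Real.exp_pos _).le).trans ?_
    rw [mul_assoc, ← Real.exp_add]
    refine mul_le_mul_of_nonneg_left (Real.exp_le_exp.2 ?_) (by positivity)
    rw [ht]
    nlinarith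
  · rcases le_or_gt s c with h | h
    · have h1 : ν.real (visualBall o p (T + s)) ≤ ν.real (visualBall o p (T - 0)) :=
        measureReal_mono (visualBall_anti o p (by linarith))
      refine (h1.trans (hA' p hp)).trans ?_
      have h2 : A * Real.exp (-δ * T) ≤ A * E * Real.exp (-δ * T - (2 * δ - k) * s) :=
        exp_le_mul_exp_of_le hA.le (by nlinarith)
      have h3 : 0 ≤ C * E * Real.exp (-δ * T - (2 * δ - k) * s) := by positivity
      linarith
    · obtain ⟨t, ht⟩ : ∃ t : ℝ≥0, (t : ℝ) = T + s - (4 * α + 1) :=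
        ⟨⟨T + s - (4 * α + 1), by linarith⟩, rfl⟩
      have h1 := (H p hp t (by linarith)).2
      have h2 : ν.real (visualBall o p (T + s)) ≤ ν.real (shadow o p t) :=
        measureReal_mono ((visualBall_anti o p (by linarith)).trans
          (visualBall_subset_shadow hX hα o p t))
      refine (h2.trans h1).trans ?_
      have h3 : C * Real.exp (-δ * T - (2 * δ - k) * (t - T)) ≤
          C * E * Real.exp (-δ * T - (2 * δ - k) * s) := by
        refine exp_le_mul_exp_of_le hC.le ?_
        rw [ht]
        nlinarith
      have h4 : 0 ≤ A * E * Real.exp (-δ * T - (2 * δ - k) * s) := by positivity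
      linarith

/-- The dimension of a conformal density satisfying the global shadow lemma is larger than the
critical exponents of the parabolic subgroups. -/
theorem rank_lt {p : Boundary X} (hp : p ∈ parabolicPoints Γ o) : rank Γ o p < 2 * δ := by
  refine lt_of_le_of_ne (rank_le hX hr hne hΓ hδ hs hp) fun heq => ?_
  obtain ⟨α, hα⟩ := hX.hyperbolic
  obtain ⟨C, hC, H⟩ := id hs
  obtain ⟨a, ha0, ha⟩ := exists_neg_le_horoballDist (Γ := Γ) hX hr
  have : Nonempty X := ⟨o⟩
  have hα0 := FourPoint.nonneg hα
  set T := horoballDist r p with hT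
  set f : ℝ → ℝ := fun R => ν.real (visualBall o p R) with hf
  have hanti : Antitone f := fun R R' h => measureReal_mono (visualBall_anti o p h)
  set ε : ℝ := C⁻¹ * Real.exp (-δ * (8 * α + 2 + (8 * α + 2) + T + a)) with hε
  have hε0 : 0 < ε := by positivity
  have hbdd : BddBelow (Set.range f) := ⟨0, by rintro _ ⟨R, rfl⟩; exact measureReal_nonneg⟩
  have hlim := tendsto_atTop_ciInf hanti hbdd
  set L := ⨅ R, f R
  -- Beyond `R₀` every annulus between visual balls at `p` has mass below `ε`. If the rank were
  -- `2δ`, the shadow of a limit point in such an annulus, taken deep in the horoball, would have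
  -- mass at least `ε`, because there the orbit distance cancels the decay in `t`.
  obtain ⟨R₀, hR₀⟩ := (((tendsto_order.1 hlim).2 (L + ε) (by linarith)).and
    (eventually_gt_atTop (T + 8 * α + 2 + |T|))).exists
  obtain ⟨hR₀f, hR₀T⟩ := hR₀
  obtain ⟨ξ, hξ, hξp, hmem⟩ := exists_ne_mem_visualBall hX hr hne hΓ.discrete hp (R₀ + 2 * α)
  have hex : ∃ n : ℕ, ξ ∉ visualBall o p (R₀ + 2 * α + n) := by
    obtain ⟨R, hR⟩ := exists_notMem_visualBall hX o hξp.symm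
    obtain ⟨n, hn⟩ := exists_nat_ge (R - (R₀ + 2 * α))
    exact ⟨n, fun h => hR (visualBall_anti o p (by linarith) h)⟩
  classical
  obtain ⟨R, hRR₀, hin, hout⟩ : ∃ R, R₀ + 2 * α ≤ R ∧ ξ ∈ visualBall o p R ∧
      ξ ∉ visualBall o p (R + 1) := by
    have h1 := Nat.find_spec hex
    have h2 : Nat.find hex ≠ 0 := fun h => by
      rw [h, Nat.cast_zero, add_zero] at h1
      exact h1 hmem
    obtain ⟨m, hm⟩ := Nat.exists_eq_succ_of_ne_zero h2
    refine ⟨R₀ + 2 * α + m, by linarith [Nat.cast_nonneg (α := ℝ) m], ?_, ?_⟩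
    · exact not_not.1 (Nat.find_min hex (by rw [hm]; exact Nat.lt_succ_self m))
    · rw [hm] at h1
      push_cast at h1
      rwa [← add_assoc] at h1
  have hTabs := neg_abs_le T
  -- Large enough for the shadow of `ξ` to stay in the annulus; the ray to `ξ` is then still at
  -- depth `R` up to a constant.
  obtain ⟨t, ht⟩ : ∃ t : ℝ≥0, (t : ℝ) = R + 6 * α + 2 :=
    ⟨⟨R + 6 * α + 2, by linarith⟩, rfl⟩
  obtain ⟨γ, hγ⟩ := exists_isRay hX o ξ
  have h1 := hγ.le_bgp_of_mem_visualBall hX hα (visualBall_symm hin) t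
  rw [min_eq_right (by linarith)] at h1
  have hbus : busemann p (γ t) o ≤ -R + 10 * α + 2 := by
    rw [busemann_eq_bgp, hγ.dist_eq, ht]; linarith
  have h2 := (H ξ hξ γ hγ t (MulAction.stabilizer Γ p) (Or.inr ⟨p, hp, by
    rw [mem_openHoroball_iff]; linarith [le_abs_self T], rfl⟩)).1
  have h3 : 2 * criticalExponent o (MulAction.stabilizer Γ p) = 2 * δ := heq
  rw [h3] at h2
  have h4 := le_infDist_orbit hX hr hne ha hp (γ t)
  set d := Metric.infDist (γ t) (MulAction.orbit Γ o)
  have h5 : ε ≤ ν.real (shadow o ξ t) := by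
    refine le_trans ?_ h2
    refine mul_le_mul_of_nonneg_left (Real.exp_le_exp.2 ?_) (by positivity)
    have : δ * (R - 10 * α - 2 - T - a) ≤ δ * d :=
      mul_le_mul_of_nonneg_left (by linarith) hδ.le
    rw [ht]
    nlinarith
  have hsub : shadow o ξ t ⊆ visualBall o ξ (R + 1 + 2 * α) :=
    (shadow_subset_visualBall hX hα o ξ t).trans (visualBall_anti o ξ (by rw [ht]; linarith))
  have hsub' : shadow o ξ t ⊆
      visualBall o p (R - 2 * α) \ visualBall o p (R + 1 + 2 * α) := fun η hη => by
    have h6 := hsub hη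
    refine ⟨visualBall_trans hX hα hin (visualBall_anti o ξ (by linarith) h6), fun h7 => hout ?_⟩
    have := visualBall_trans hX hα h7 (visualBall_symm h6)
    rwa [add_sub_cancel_right] at this
  have h6 : ν.real (shadow o ξ t) ≤
      ν.real (visualBall o p (R - 2 * α) \ visualBall o p (R + 1 + 2 * α)) :=
    measureReal_mono hsub'
  rw [measureReal_sdiff (visualBall_anti o p (by linarith))
    (isOpen_visualBall hX o p _).measurableSet] at h6
  have h7 : f (R - 2 * α) ≤ f R₀ := hanti (by linarith)
  have h8 : L ≤ f (R + 1 + 2 * α) := ciInf_le hbdd _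
  change ν.real (shadow o ξ t) ≤ f (R - 2 * α) - f (R + 1 + 2 * α) at h6
  linarith

end ShadowMeasure

end HypBoundary

namespace HypBoundary

/-! ### Second moment method. -/

section SecondMoment

variable {Y ι : Type*} [MeasurableSpace Y] {ν : Measure Y} [IsFiniteMeasure ν]

/-- Integrate `2 c N ≤ N² + c²` over the union, where `N` counts the sets containing a point. -/
theorem sum_le_sum_measure_inter (I : Finset ι) (A : ι → Set Y) (hA : ∀ i ∈ I, MeasurableSet (A i))
    (c : ℝ) :
    2 * c * ∑ i ∈ I, ν.real (A i) ≤
      ∑ i ∈ I, ∑ j ∈ I, ν.real (A i ∩ A j) + c ^ 2 * ν.real (⋃ i ∈ I, A i) := by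
  classical

  set U := ⋃ i ∈ I, A i with hU
  have hUm : MeasurableSet U := I.measurableSet_biUnion hA
  have hint : ∀ B : Set Y, MeasurableSet B → Integrable (B.indicator (1 : Y → ℝ)) ν :=
    fun B hB => (integrable_const (1 : ℝ)).indicator hB
  have h1 : ∫ y, 2 * c * ∑ i ∈ I, (A i).indicator (1 : Y → ℝ) y ∂ν =
      2 * c * ∑ i ∈ I, ν.real (A i) := by
    rw [integral_const_mul, integral_finsetSum _ fun i hi => hint _ (hA i hi)]
    congr 1
    exact Finset.sum_congr rfl fun i hi => integral_indicator_one (hA i hi)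
  have hint2 : ∀ i ∈ I, Integrable (fun y => ∑ j ∈ I, (A i ∩ A j).indicator (1 : Y → ℝ) y) ν :=
    fun i hi => integrable_finsetSum _ fun j hj => hint _ ((hA i hi).inter (hA j hj))
  have h2 : ∫ y, (∑ i ∈ I, ∑ j ∈ I, (A i ∩ A j).indicator (1 : Y → ℝ) y) +
      c ^ 2 * U.indicator (1 : Y → ℝ) y ∂ν =
      ∑ i ∈ I, ∑ j ∈ I, ν.real (A i ∩ A j) + c ^ 2 * ν.real U := by
    rw [integral_add (integrable_finsetSum _ hint2) ((hint U hUm).const_mul _),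
      integral_const_mul, integral_indicator_one hUm, integral_finsetSum _ hint2]
    congr 1
    refine Finset.sum_congr rfl fun i hi => ?_
    rw [integral_finsetSum _ fun j hj => hint _ ((hA i hi).inter (hA j hj))]
    exact Finset.sum_congr rfl fun j hj => integral_indicator_one ((hA i hi).inter (hA j hj))
  rw [← h1, ← h2]
  refine integral_mono ((integrable_finsetSum _ fun i hi => hint _ (hA i hi)).const_mul _)
    ((integrable_finsetSum _ hint2).add ((hint U hUm).const_mul _)) fun y => ?_
  change 2 * c * ∑ i ∈ I, (A i).indicator (1 : Y → ℝ) y ≤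
    (∑ i ∈ I, ∑ j ∈ I, (A i ∩ A j).indicator (1 : Y → ℝ) y) + c ^ 2 * U.indicator (1 : Y → ℝ) y
  have h3 : ∑ i ∈ I, ∑ j ∈ I, (A i ∩ A j).indicator (1 : Y → ℝ) y =
      (∑ i ∈ I, (A i).indicator (1 : Y → ℝ) y) ^ 2 := by
    rw [sq, Finset.sum_mul_sum]
    refine Finset.sum_congr rfl fun i _ => Finset.sum_congr rfl fun j _ => ?_
    rw [Set.inter_indicator_one]; rfl
  rw [h3]
  by_cases hy : y ∈ U
  · rw [Set.indicator_of_mem hy, Pi.one_apply]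
    nlinarith [sq_nonneg (∑ i ∈ I, (A i).indicator (1 : Y → ℝ) y - c)]
  · have h4 : ∑ i ∈ I, (A i).indicator (1 : Y → ℝ) y = 0 :=
      Finset.sum_eq_zero fun i hi => Set.indicator_of_notMem
        (fun h => hy (Set.mem_biUnion (Finset.mem_coe.2 hi) h)) _
    rw [h4, Set.indicator_of_notMem hy]
    simp

/-- A quantitative second moment Borel-Cantelli lemma for quasi-independent events. -/
theorem le_measure_biUnion_of_quasi_independent (I : Finset ι) (A : ι → Set Y)
    (hA : ∀ i ∈ I, MeasurableSet (A i)) (x : ι → ℝ) (hx : ∀ i ∈ I, 0 ≤ x i)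
    {c K M : ℝ} (hc : 0 < c) (hK : 0 < K) (hM : 0 ≤ M)
    (hlow : ∀ i ∈ I, c * M * x i ≤ ν.real (A i)) (hup : ∀ i ∈ I, ν.real (A i) ≤ K * M * x i)
    (hpair : ∀ i ∈ I, ∀ j ∈ I, i ≠ j → ν.real (A i ∩ A j) ≤ K * M * (x i * x j))
    (hsum : 1 ≤ ∑ i ∈ I, x i) : c ^ 2 / (2 * K) * M ≤ ν.real (⋃ i ∈ I, A i) := by
  classical
  set σ := ∑ i ∈ I, x i with hσ
  have h1 : ∑ i ∈ I, ∑ j ∈ I, ν.real (A i ∩ A j) ≤ 2 * K * M * σ ^ 2 := by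
    have h2 : ∀ i ∈ I, ∑ j ∈ I, ν.real (A i ∩ A j) ≤ K * M * x i + K * M * (x i * σ) := by
      intro i hi
      rw [← Finset.add_sum_erase I _ hi, Set.inter_self]
      refine add_le_add (hup i hi) ?_
      rw [hσ, Finset.mul_sum, Finset.mul_sum]
      refine (Finset.sum_le_sum fun j hj => hpair i hi j (Finset.mem_of_mem_erase hj)
        (Finset.ne_of_mem_erase hj).symm).trans ?_
      exact Finset.sum_le_sum_of_subset_of_nonneg (Finset.erase_subset _ _) fun j hj _ =>
        mul_nonneg (mul_nonneg hK.le hM) (mul_nonneg (hx i hi) (hx j hj))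
    refine (Finset.sum_le_sum h2).trans ?_
    rw [Finset.sum_add_distrib, ← Finset.mul_sum, ← Finset.mul_sum, ← Finset.sum_mul, ← hσ]
    -- The diagonal terms are absorbed here, thanks to `1 ≤ σ`.
    have h3 : K * M * σ ≤ K * M * σ ^ 2 :=
      mul_le_mul_of_nonneg_left (by nlinarith) (mul_nonneg hK.le hM)
    linarith
  have h2 : c * M * σ ≤ ∑ i ∈ I, ν.real (A i) := by
    rw [hσ, Finset.mul_sum]
    exact Finset.sum_le_sum hlow
  have h3 := sum_le_sum_measure_inter (ν := ν) I A hA (2 * K / c * σ)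
  set V := ν.real (⋃ i ∈ I, A i)
  have h4 : 2 * (2 * K / c * σ) * (c * M * σ) ≤
      2 * (2 * K / c * σ) * ∑ i ∈ I, ν.real (A i) := by
    refine mul_le_mul_of_nonneg_left h2 ?_
    have : 0 ≤ σ := by linarith
    positivity
  have h5 : 2 * (2 * K / c * σ) * (c * M * σ) = 4 * K * M * σ ^ 2 := by
    field_simp; ring
  have h6 : 2 * K * M * σ ^ 2 ≤ (2 * K / c * σ) ^ 2 * V := by linarith
  have h7 : (2 * K / c * σ) ^ 2 * V = 2 * K * σ ^ 2 * (2 * K / c ^ 2 * V) := by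
    field_simp
  rw [h7, show 2 * K * M * σ ^ 2 = 2 * K * σ ^ 2 * M by ring] at h6
  have h8 : M ≤ 2 * K / c ^ 2 * V := le_of_mul_le_mul_left h6 (by positivity)
  calc c ^ 2 / (2 * K) * M ≤ c ^ 2 / (2 * K) * (2 * K / c ^ 2 * V) :=
        mul_le_mul_of_nonneg_left h8 (by positivity)
    _ = V := by field_simp

end SecondMoment

/-! ### Divergence does not depend on step size and offset. -/

section Series

theorem Antitone.summable_of_summable_mul {F : ℕ → ℝ} (hF : Antitone F) (h0 : ∀ n, 0 ≤ F n)
    {M : ℕ} (hM : 0 < M) (h : Summable fun j => F (j * M)) : Summable F := by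
  have hblock : ∀ N, ∑ n ∈ Finset.range (N * M), F n ≤ M * ∑ j ∈ Finset.range N, F (j * M) := by
    intro N
    induction N with
    | zero => simp
    | succ N ih =>
      rw [add_mul, one_mul, Finset.sum_range_add, Finset.sum_range_succ, mul_add]
      refine add_le_add ih ?_
      refine (Finset.sum_le_sum fun i _ => hF (Nat.le_add_right (N * M) i)).trans ?_
      simp
  refine summable_of_sum_range_le h0 (c := M * ∑' j, F (j * M)) fun N => ?_
  have h1 : ∑ n ∈ Finset.range N, F n ≤ ∑ n ∈ Finset.range (N * M), F n :=
    Finset.sum_le_sum_of_subset_of_nonneg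
      (Finset.range_mono (Nat.le_mul_of_pos_right N hM)) fun i _ _ => h0 i
  refine (h1.trans (hblock N)).trans ?_
  exact mul_le_mul_of_nonneg_left (h.sum_le_tsum _ fun j _ => h0 _) (by positivity)

theorem Antitone.not_summable_add_mul {f : ℝ → ℝ} (hf : Antitone f) (h0 : ∀ t, 0 ≤ f t) {w τ : ℝ}
    (hw : 0 < w) (hτ : 0 < τ) (b : ℝ) (h : ¬ Summable fun n : ℕ => f (n * w)) :
    ¬ Summable fun j : ℕ => f (b + j * τ) := by
  intro hs
  apply h
  obtain ⟨K, hK⟩ := exists_nat_ge (b / w)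
  obtain ⟨M, hM⟩ := exists_nat_ge (τ / w)
  rw [div_le_iff₀ hw] at hK hM
  have hM0 : 0 < M := by
    rcases Nat.eq_zero_or_pos M with rfl | hM0
    · simp at hM; linarith
    · exact hM0
  rw [← summable_nat_add_iff K]
  refine Antitone.summable_of_summable_mul (M := M) (fun m n hmn => hf ?_) (fun n => h0 _) hM0 ?_
  · exact mul_le_mul_of_nonneg_right (by exact_mod_cast Nat.add_le_add_right hmn K) hw.le
  · refine hs.of_nonneg_of_le (fun j => h0 _) fun j => hf ?_
    push_cast
    have : (j : ℝ) * τ ≤ j * (M * w) := mul_le_mul_of_nonneg_left hM (Nat.cast_nonneg j)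
    linarith

end Series

/-- Neighbourhoods `S ξ t` of the points of a space, shrinking as `t` grows, with a family of
points `p ∈ P` at levels `T p` which are separated from each other and whose neighbourhoods are not
too small. -/
structure SeparatedShadows {Y : Type*} [TopologicalSpace Y] [MeasurableSpace Y] (ν : Measure Y)
    (P : Set Y) (T : Y → ℝ) (S : Y → ℝ → Set Y) (a δ : ℝ) : Prop where
  nonneg : 0 ≤ a
  dim_pos : 0 < δ
  isOpen : ∀ ξ t, IsOpen (S ξ t)
  anti : ∀ ξ s t, s ≤ t → S ξ t ⊆ S ξ s
  symm : ∀ ξ η t, η ∈ S ξ t → ξ ∈ S η t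
  trans : ∀ ξ η ζ t, η ∈ S ξ t → ζ ∈ S η t → ζ ∈ S ξ (t - a)
  self_mem : ∀ ξ t, ξ ∈ S ξ t
  separated : ∀ p ∈ P, ∀ q ∈ P, p ≠ q → ∀ t, q ∈ S p t → t ≤ (T p + T q) / 2 + a
  neg_le : ∀ p ∈ P, -a ≤ T p
  lower : ∃ c > 0, ∀ p ∈ P, ∀ s, 0 ≤ s →
    c * Real.exp (-δ * T p - 2 * δ * s) ≤ ν.real (S p (T p + s))

/-- Separated shadows with measure estimates of exponent `κ`, optimal for the points in `P₀`, and
such that almost all points are well approximated by points of `P₀` at all levels at which they are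
not too well approximated by a point of `P`. -/
structure CuspShadows {Y : Type*} [TopologicalSpace Y] [MeasurableSpace Y] (ν : Measure Y)
    (P P₀ : Set Y) (T : Y → ℝ) (S : Y → ℝ → Set Y) (a δ κ : ℝ) : Prop
    extends SeparatedShadows ν P T S a δ where
  exponent_pos : 0 < κ
  subset : P₀ ⊆ P
  upper : ∀ b : ℝ, ∃ A > 0, ∀ p ∈ P, ∀ s, -b ≤ s →
    ν.real (S p (T p + s)) ≤ A * Real.exp (-δ * T p - κ * s)
  lower_sharp : ∃ c > 0, ∀ p ∈ P₀, ∀ s, 0 ≤ s →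
    c * Real.exp (-δ * T p - κ * s) ≤ ν.real (S p (T p + s))
  dichotomy : ∀ h : ℝ, ∃ C : ℝ, ∀ᵐ ξ ∂ν, ∀ t : ℝ, 0 ≤ t →
    (∃ q ∈ P, T q + h ≤ t ∧ ξ ∈ S q ((t + T q + h) / 2)) ∨
      ∃ q ∈ P₀, |T q - t| ≤ C ∧ ξ ∈ S q (t - C)

/-! ### Combinatorics of separated shadows. -/

namespace SeparatedShadows

variable {Y : Type*} [TopologicalSpace Y] [MeasurableSpace Y] [OpensMeasurableSpace Y]
  {ν : Measure Y} [IsFiniteMeasure ν] {P : Set Y} {T : Y → ℝ} {S : Y → ℝ → Set Y} {a δ : ℝ}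
  (H : SeparatedShadows ν P T S a δ)
include H

omit [OpensMeasurableSpace Y] [IsFiniteMeasure ν] in
theorem mem_of_common {p q ξ : Y} {s t v : ℝ} (hp : ξ ∈ S p s) (hq : ξ ∈ S q t) (hs : v ≤ s)
    (ht : v ≤ t) : q ∈ S p (v - a) :=
  H.trans _ _ _ _ (H.anti _ _ _ hs hp) (H.symm _ _ _ (H.anti _ _ _ ht hq))

omit [OpensMeasurableSpace Y] [IsFiniteMeasure ν] in
theorem subset_of_common {p q ξ : Y} {s t u v : ℝ} (hp : ξ ∈ S p s) (hq : ξ ∈ S q t) (hs : v ≤ s)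
    (ht : v ≤ t) (hu : v ≤ u) : S q u ⊆ S p (v - 2 * a) := fun ζ hζ => by
  have h1 := H.mem_of_common hp hq hs ht
  have h2 := H.trans _ _ _ _ h1 (H.anti _ (v - a) u (by linarith [H.nonneg]) hζ)
  rwa [sub_sub, ← two_mul] at h2

-- A common point of two neighbourhoods puts `q` near `p` at the smaller of the two levels, which
-- separation bounds.
omit [OpensMeasurableSpace Y] [IsFiniteMeasure ν] in
theorem min_le_of_common {p q ξ : Y} {s t : ℝ} (hp : p ∈ P) (hq : q ∈ P) (hpq : p ≠ q)
    (h : ξ ∈ S p s) (h' : ξ ∈ S q t) : s ≤ (T p + T q) / 2 + 2 * a ∨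
      t ≤ (T p + T q) / 2 + 2 * a := by
  have h1 := H.separated p hp q hq hpq _ (H.mem_of_common h h' (min_le_left s t) (min_le_right s t))
  exact min_le_iff.1 (by linarith)

omit [OpensMeasurableSpace Y] [IsFiniteMeasure ν] in
theorem disjoint {p q : Y} (hp : p ∈ P) (hq : q ∈ P) (hpq : p ≠ q) {W s s' : ℝ}
    (hW : |T p - T q| ≤ W) (hs : W / 2 + 2 * a < s) (hs' : W / 2 + 2 * a < s') :
    Disjoint (S p (T p + s)) (S q (T q + s')) := by
  rw [Set.disjoint_left]
  intro ξ h h'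
  have h1 := abs_le.1 hW
  rcases H.min_le_of_common hp hq hpq h h' with h2 | h2 <;> linarith

/-- The points of `P` in a window of levels have disjoint shadows, so the total measure of these
shadows is controlled by that of any set containing them. -/
theorem exists_sum_exp_le (W : ℝ) : ∃ A > 0, ∀ (m : ℝ) (F : Finset Y) (B : Set Y),
    (∀ p ∈ F, p ∈ P ∧ m ≤ T p ∧ T p ≤ m + W ∧ ∃ s ≤ W / 2 + 2 * a + 1, S p (T p + s) ⊆ B) →
      ∑ p ∈ F, Real.exp (-δ * T p) ≤ A * ν.real B := by
  obtain ⟨c, hc, hlow⟩ := H.lower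
  set s₀ := |W| / 2 + 2 * a + 1 with hs₀
  have hs₀0 : 0 ≤ s₀ := by have := H.nonneg; positivity
  refine ⟨(c * Real.exp (-(2 * δ * s₀)))⁻¹, by positivity, fun m F B hF => ?_⟩
  rw [inv_mul_eq_div, le_div_iff₀ (by positivity), Finset.sum_mul]
  have h1 : ∑ p ∈ F, ν.real (S p (T p + s₀)) = ν.real (⋃ p ∈ F, S p (T p + s₀)) := by
    refine (measureReal_biUnion_finset (fun p hp q hq hpq => ?_) fun p _ =>
      (H.isOpen _ _).measurableSet).symm
    obtain ⟨hp1, hp2, hp3, -⟩ := hF p hp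
    obtain ⟨hq1, hq2, hq3, -⟩ := hF q hq
    refine H.disjoint hp1 hq1 hpq (W := |W|) ?_ (by linarith) (by linarith)
    rw [abs_le]
    constructor <;> linarith [le_abs_self W]
  have h2 : ν.real (⋃ p ∈ F, S p (T p + s₀)) ≤ ν.real B := by
    refine measureReal_mono (Set.iUnion₂_subset fun p hp => ?_)
    obtain ⟨-, -, -, s, hs, hsub⟩ := hF p hp
    exact (H.anti _ _ _ (by linarith [le_abs_self W])).trans hsub
  refine le_trans (Finset.sum_le_sum fun p hp => ?_) (h1.trans_le h2)
  refine le_trans (le_of_eq ?_) (hlow p (hF p hp).1 s₀ hs₀0)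
  rw [sub_eq_add_neg, Real.exp_add]
  ring

theorem finite_level (m : ℝ) : {p ∈ P | T p ≤ m}.Finite := by
  by_contra hinf
  obtain ⟨A, hA, hsum⟩ := H.exists_sum_exp_le (m + a)
  obtain ⟨N, hN⟩ := exists_nat_gt (A * ν.real Set.univ / Real.exp (-δ * m))
  rw [div_lt_iff₀ (Real.exp_pos _)] at hN
  obtain ⟨F, hF, hcard⟩ := Set.Infinite.exists_subset_card_eq hinf N
  -- All levels up to `m` form the single window `[-a, m]`; its sum is bounded and each term is at
  -- least `exp (-δ m)`.
  have h1 := hsum (-a) F Set.univ fun p hp => by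
    obtain ⟨h1, h2⟩ := hF hp
    exact ⟨h1, H.neg_le p h1, by linarith, (m + a) / 2 + 2 * a + 1, le_rfl, Set.subset_univ _⟩
  have h2 : (N : ℝ) * Real.exp (-δ * m) ≤ ∑ p ∈ F, Real.exp (-δ * T p) := by
    rw [← hcard, ← nsmul_eq_mul]
    refine Finset.card_nsmul_le_sum _ _ _ fun p hp => Real.exp_le_exp.2 ?_
    have := (hF hp).2
    nlinarith [H.dim_pos]
  linarith

theorem countable : P.Countable := by
  have : P = ⋃ n : ℕ, {p ∈ P | T p ≤ n} := by
    ext p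
    simp only [Set.mem_iUnion]
    exact ⟨fun hp => let ⟨n, hn⟩ := exists_nat_ge (T p); ⟨n, hp, hn⟩, fun ⟨n, hn⟩ => hn.1⟩
  rw [this]
  exact Set.countable_iUnion fun n => (H.finite_level n).countable

end SeparatedShadows

end HypBoundary

namespace HypBoundary

/-! ### The convergence part and the local count of horoballs. -/

namespace CuspShadows

variable {Y : Type*} [TopologicalSpace Y] [MeasurableSpace Y] [OpensMeasurableSpace Y]
  {ν : Measure Y} [IsFiniteMeasure ν] {P P₀ : Set Y} {T : Y → ℝ} {S : Y → ℝ → Set Y} {a δ κ : ℝ}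
  (H : CuspShadows ν P P₀ T S a δ κ)
include H

/-- The convergence part: if the shrunken shadows have summable measure, almost no point is in
infinitely many of them. -/
theorem measure_limsup_eq_zero {w : ℝ} (s : Y → ℝ) (b : ℝ) (g : ℕ → ℝ) (hg : Summable g) (hg0 : ∀ n, 0 ≤ g n) (n₀ : ℕ)
    (hs : ∀ n ≥ n₀, ∀ p ∈ P, n * w ≤ T p → T p ≤ (n + 1) * w →
      -b ≤ s p ∧ Real.exp (-κ * s p) ≤ g n) :
    ν (⋂ n : ℕ, ⋃ m ≥ n, ⋃ p ∈ {p ∈ P | m * w ≤ T p ∧ T p ≤ (m + 1) * w}, S p (T p + s p)) = 0 := by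
  obtain ⟨A, hA, hup⟩ := H.upper b
  obtain ⟨A', hA', hsum⟩ := H.exists_sum_exp_le w
  set E : ℕ → Set Y := fun m => ⋃ p ∈ {p ∈ P | m * w ≤ T p ∧ T p ≤ (m + 1) * w}, S p (T p + s p)
  have hE : ∀ m ≥ n₀, ν.real (E m) ≤ A * A' * ν.real Set.univ * g m := by
    intro m hm
    have hfin : {p ∈ P | m * w ≤ T p ∧ T p ≤ (m + 1) * w}.Finite :=
      (H.finite_level ((m + 1) * w)).subset fun p hp => ⟨hp.1, hp.2.2⟩
    have h1 : E m = ⋃ p ∈ hfin.toFinset, S p (T p + s p) := by simp [E]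
    rw [h1]
    refine (measureReal_biUnion_finset_le _ _).trans ?_
    have h2 : ∀ p ∈ hfin.toFinset, ν.real (S p (T p + s p)) ≤
        A * g m * Real.exp (-δ * T p) := by
      intro p hp
      obtain ⟨hpP, hp1, hp2⟩ := hfin.mem_toFinset.1 hp
      obtain ⟨h3, h4⟩ := hs m hm p hpP hp1 hp2
      refine (hup p hpP _ h3).trans ?_
      rw [sub_eq_add_neg, Real.exp_add, ← neg_mul]
      have := mul_le_mul_of_nonneg_left h4 (mul_pos hA (Real.exp_pos (-δ * T p))).le
      linarith
    refine (Finset.sum_le_sum h2).trans ?_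
    rw [← Finset.mul_sum]
    have h3 := hsum (m * w) hfin.toFinset Set.univ fun p hp => by
      obtain ⟨hpP, hp1, hp2⟩ := hfin.mem_toFinset.1 hp
      exact ⟨hpP, hp1, by linarith, _, le_rfl, Set.subset_univ _⟩
    have := mul_le_mul_of_nonneg_left h3 (mul_nonneg hA.le (hg0 m))
    linarith
  have htail : ν (limsup (fun m => E (m + n₀)) atTop) = 0 := by
    refine measure_limsup_atTop_eq_zero (ne_top_of_le_ne_top ?_
      (ENNReal.tsum_le_tsum fun m => ?_) (b := ∑' m, ENNReal.ofReal (A * A' * ν.real Set.univ * g (m + n₀))))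
    · exact Summable.tsum_ofReal_ne_top
        (((summable_nat_add_iff n₀).2 hg).mul_left _)
    · rw [← ofReal_measureReal (measure_ne_top _ _)]
      exact ENNReal.ofReal_le_ofReal (hE _ (Nat.le_add_left _ _))
  rw [limsup_nat_add, limsup_eq_iInf_iSup_of_nat] at htail
  exact htail


/-- By the dichotomy at time `t`, almost all of `S p (T p)` is covered by shadows of `P₀` of level
about `t` and by the set `Bad` of points deep in a horoball. A deep horoball `q` contributes `exp
(-δ T q) exp (-κ (t - T q + h) / 2)`. The sum of `exp (-δ T q)` over each unit window is at most
const · `exp (-δ T p)`, so the windows form a geometric series, and a large depth `h` leaves at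
least half of the mass to `P₀`. -/
theorem exists_local_count :
    ∃ C > 0, ∃ c > 0, ∀ p ∈ P, ∀ t, 0 ≤ t → T p ≤ t → ∃ F : Finset Y,
      (∀ q ∈ F, q ∈ P₀ ∧ |T q - t| ≤ C ∧ (S q (T q - C) ∩ S p (T p)).Nonempty) ∧
      c * Real.exp (-δ * T p) ≤ ∑ q ∈ F, Real.exp (-δ * T q) := by
  have ha := H.nonneg
  have hκ := H.exponent_pos
  obtain ⟨c₀, hc₀, hlow⟩ := H.lower
  obtain ⟨A₀, hA₀, hup₀⟩ := H.upper 0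
  obtain ⟨A₁, hA₁, hup₁⟩ := H.upper (6 * a)
  obtain ⟨A₂, hA₂, hsum⟩ := H.exists_sum_exp_le 1
  set ρ := Real.exp (-κ / 2) with hρ
  have hρ0 : 0 < ρ := Real.exp_pos _
  have hρ1 : ρ < 1 := by
    rw [hρ, ← Real.exp_zero]
    exact Real.exp_lt_exp.2 (by linarith)
  set K := A₀ + A₀ * (A₂ * (A₁ * Real.exp (κ * (6 * a)))) * (1 - ρ)⁻¹ with hK
  have hK0 : 0 < K := by
    have : 0 < 1 - ρ := by linarith
    positivity
  -- The depth at which the horoballs are removed.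
  obtain ⟨h, hh4, hhK⟩ : ∃ h : ℝ, 4 * a < h ∧ K * Real.exp (-κ * (h / 2)) ≤ c₀ / 2 := by
    have hlim : Tendsto (fun h : ℝ => K * Real.exp (-κ * (h / 2))) atTop (𝓝 (K * 0)) := by
      refine (Real.tendsto_exp_atBot.comp ?_).const_mul K
      exact (tendsto_id.atTop_div_const two_pos).const_mul_atTop_of_neg (by linarith)
    rw [mul_zero] at hlim
    obtain ⟨h, h1, h2⟩ := ((eventually_gt_atTop (4 * a)).and
      (hlim.eventually_le_const (by linarith : (0 : ℝ) < c₀ / 2))).exists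
    exact ⟨h, h1, h2⟩
  obtain ⟨C, hC⟩ := H.dichotomy h
  obtain ⟨A₃, hA₃, hup₃⟩ := H.upper (2 * |C|)
  refine ⟨2 * |C| + 1, by positivity, c₀ / 2 / (A₃ * Real.exp (κ * (2 * |C|))), by positivity,
    fun p hp t ht hpt => ?_⟩
  have hCabs := le_abs_self C
  have hCnn := abs_nonneg C
  set Bad := ⋃ q ∈ {q ∈ P | T q + h ≤ t}, (S q ((t + T q + h) / 2) ∩ S p (T p)) with hBad
  have hfin : {q ∈ P | T q + h ≤ t ∧ q ≠ p ∧ (S q ((t + T q + h) / 2) ∩ S p (T p)).Nonempty}.Finite :=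
    (H.finite_level t).subset fun q hq => ⟨hq.1, by linarith [hq.2.1]⟩
  set G := hfin.toFinset
  have hG : ∀ q ∈ G, q ∈ P ∧ T q + h ≤ t ∧ q ≠ p ∧
      (S q ((t + T q + h) / 2) ∩ S p (T p)).Nonempty := fun q hq => hfin.mem_toFinset.1 hq
  have hsub : ∀ q ∈ G, S q (T q + (1 / 2 + 2 * a + 1)) ⊆ S p (T p + -(6 * a)) := by
    intro q hq
    obtain ⟨hqP, hqt, hqp, ξ, hξq, hξp⟩ := hG q hq
    -- The other alternative would give `t + h ≤ T p + 4 a`, excluded by `T p ≤ t` and `4 a < h`.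
    have hle : T p - 4 * a ≤ T q := by
      rcases H.min_le_of_common hqP hp hqp hξq hξp with h1 | h1 <;> linarith
    have := H.subset_of_common hξp hξq (u := T q + (1 / 2 + 2 * a + 1)) (v := T p - 4 * a)
      (by linarith) (by linarith) (by linarith)
    rwa [show T p - 4 * a - 2 * a = T p + -(6 * a) by ring] at this
  have hGsum : ∑ q ∈ G, ν.real (S q ((t + T q + h) / 2)) ≤
      A₀ * (A₂ * (A₁ * Real.exp (κ * (6 * a)))) * (1 - ρ)⁻¹ * Real.exp (-κ * (h / 2)) *
        Real.exp (-δ * T p) := by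
    obtain ⟨N, hN⟩ : ∃ N : ℕ, ∀ q ∈ G, ⌊t - h - T q⌋₊ ∈ Finset.range N := by
      obtain ⟨N, hN⟩ := (G.image fun q => ⌊t - h - T q⌋₊).exists_le
      exact ⟨N + 1, fun q hq => Finset.mem_range_succ_iff.2
        (hN _ (Finset.mem_image_of_mem _ hq))⟩
    rw [← Finset.sum_fiberwise_of_maps_to hN]
    have hlevel : ∀ n ∈ Finset.range N,
        ∑ q ∈ G with ⌊t - h - T q⌋₊ = n, ν.real (S q ((t + T q + h) / 2)) ≤
          A₀ * (A₂ * (A₁ * Real.exp (κ * (6 * a)))) * Real.exp (-κ * (h / 2)) *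
            Real.exp (-δ * T p) * ρ ^ n := by
      intro n _
      have h1 : ∀ q ∈ G.filter fun q => ⌊t - h - T q⌋₊ = n,
          ν.real (S q ((t + T q + h) / 2)) ≤
            A₀ * (Real.exp (-κ * (h / 2)) * ρ ^ n) * Real.exp (-δ * T q) := by
        intro q hq
        obtain ⟨hqG, hqn⟩ := Finset.mem_filter.1 hq
        obtain ⟨hqP, hqt, -, -⟩ := hG q hqG
        have h2 : (n : ℝ) ≤ t - h - T q := by
          rw [← hqn]; exact Nat.floor_le (by linarith)
        have h3 := hup₀ q hqP ((t - T q + h) / 2) (by linarith [Nat.cast_nonneg (α := ℝ) n])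
        rw [show T q + (t - T q + h) / 2 = (t + T q + h) / 2 by ring] at h3
        refine h3.trans ?_
        rw [hρ, ← Real.exp_nat_mul, mul_assoc, ← Real.exp_add, ← Real.exp_add]
        refine mul_le_mul_of_nonneg_left (Real.exp_le_exp.2 ?_) hA₀.le
        nlinarith
      refine (Finset.sum_le_sum h1).trans ?_
      rw [← Finset.mul_sum]
      have h2 := hsum (t - h - n - 1) (G.filter fun q => ⌊t - h - T q⌋₊ = n)
        (S p (T p + -(6 * a))) fun q hq => by
          obtain ⟨hqG, hqn⟩ := Finset.mem_filter.1 hq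
          obtain ⟨hqP, hqt, -, -⟩ := hG q hqG
          have h2 : (n : ℝ) ≤ t - h - T q := by
            rw [← hqn]; exact Nat.floor_le (by linarith)
          have h3 : t - h - T q < n + 1 := by
            rw [← hqn]; exact Nat.lt_floor_add_one _
          exact ⟨hqP, by linarith, by linarith, _, le_rfl, hsub q hqG⟩
      have h3 := hup₁ p hp (-(6 * a)) le_rfl
      have h4 : Real.exp (-δ * T p - κ * -(6 * a)) =
          Real.exp (κ * (6 * a)) * Real.exp (-δ * T p) := by
        rw [← Real.exp_add]; ring_nf
      rw [h4] at h3
      have h5 := h2.trans (mul_le_mul_of_nonneg_left h3 hA₂.le)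
      refine (mul_le_mul_of_nonneg_left h5 (by positivity)).trans (le_of_eq ?_)
      ring
    refine (Finset.sum_le_sum hlevel).trans ?_
    rw [← Finset.mul_sum]
    have h6 : ∑ n ∈ Finset.range N, ρ ^ n ≤ (1 - ρ)⁻¹ := by
      rw [← tsum_geometric_of_lt_one hρ0.le hρ1]
      exact (summable_geometric_of_lt_one hρ0.le hρ1).sum_le_tsum _ fun n _ => by positivity
    refine (mul_le_mul_of_nonneg_left h6 (by positivity)).trans (le_of_eq ?_)
    ring
  have hBadle : ν.real Bad ≤ c₀ / 2 * Real.exp (-δ * T p) := by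
    have h1 : Bad ⊆ (⋃ q ∈ G, S q ((t + T q + h) / 2)) ∪ S p ((t + T p + h) / 2) := by
      intro ξ hξ
      simp only [hBad, Set.mem_iUnion] at hξ
      obtain ⟨q, hq, hξq, hξp⟩ := hξ
      by_cases hqp : q = p
      · right; rwa [hqp] at hξq
      · left
        exact Set.mem_biUnion (Finset.mem_coe.2 (hfin.mem_toFinset.2
          ⟨hq.1, hq.2, hqp, ξ, hξq, hξp⟩)) hξq
    have h2 := hup₀ p hp ((t - T p + h) / 2) (by linarith)
    rw [show T p + (t - T p + h) / 2 = (t + T p + h) / 2 by ring] at h2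
    have h3 : A₀ * Real.exp (-δ * T p - κ * ((t - T p + h) / 2)) ≤
        A₀ * (Real.exp (-κ * (h / 2)) * Real.exp (-δ * T p)) := by
      rw [← Real.exp_add]
      refine mul_le_mul_of_nonneg_left (Real.exp_le_exp.2 ?_) hA₀.le
      nlinarith
    calc ν.real Bad ≤ ν.real (⋃ q ∈ G, S q ((t + T q + h) / 2)) + ν.real (S p ((t + T p + h) / 2)) :=
          (measureReal_mono h1).trans (measureReal_union_le _ _)
      _ ≤ K * Real.exp (-κ * (h / 2)) * Real.exp (-δ * T p) := by
          have h4 := (measureReal_biUnion_finset_le (μ := ν) G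
            (fun q => S q ((t + T q + h) / 2))).trans hGsum
          rw [hK]
          linarith
      _ ≤ _ := mul_le_mul_of_nonneg_right hhK (Real.exp_pos _).le
  have hfin₀ : {q ∈ P₀ | |T q - t| ≤ C ∧ (S q (T q - 2 * |C|) ∩ S p (T p)).Nonempty}.Finite :=
    (H.finite_level (t + C)).subset fun q hq => ⟨H.subset hq.1, by linarith [(abs_le.1 hq.2.1).2]⟩
  set F := hfin₀.toFinset
  have hF : ∀ q ∈ F, q ∈ P₀ ∧ |T q - t| ≤ C ∧ (S q (T q - 2 * |C|) ∩ S p (T p)).Nonempty :=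
    fun q hq => hfin₀.mem_toFinset.1 hq
  refine ⟨F, fun q hq => ?_, ?_⟩
  · obtain ⟨h1, h2, ξ, h3, h4⟩ := hF q hq
    exact ⟨h1, by linarith, ξ, H.anti _ _ _ (by linarith) h3, h4⟩
  · have h1 : S p (T p) ≤ᵐ[ν] (Bad ∪ ⋃ q ∈ F, S q (T q + -(2 * |C|)) : Set Y) := by
      filter_upwards [hC] with ξ hξ hξp
      rcases hξ t ht with ⟨q, hq, hqt, hξq⟩ | ⟨q, hq, hqt, hξq⟩
      · left
        exact Set.mem_biUnion (show q ∈ {q ∈ P | T q + h ≤ t} from ⟨hq, hqt⟩) ⟨hξq, hξp⟩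
      · right
        have h2 : ξ ∈ S q (T q - 2 * |C|) := by
          refine H.anti _ _ _ ?_ hξq
          linarith [(abs_le.1 hqt).2]
        exact Set.mem_biUnion (Finset.mem_coe.2 (hfin₀.mem_toFinset.2
          ⟨hq, hqt, ξ, h2, hξp⟩)) h2
    have h2 : ν.real (S p (T p)) ≤ ν.real Bad + ∑ q ∈ F, ν.real (S q (T q + -(2 * |C|))) := by
      have h3 : ν.real (S p (T p)) ≤ ν.real (Bad ∪ ⋃ q ∈ F, S q (T q + -(2 * |C|))) :=
        ENNReal.toReal_mono (measure_ne_top _ _) (measure_mono_ae h1)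
      exact h3.trans ((measureReal_union_le _ _).trans
        (add_le_add_right (measureReal_biUnion_finset_le _ _) _))
    have h3 := hlow p hp 0 le_rfl
    rw [mul_zero, sub_zero, add_zero] at h3
    have h4 : ∑ q ∈ F, ν.real (S q (T q + -(2 * |C|))) ≤
        A₃ * Real.exp (κ * (2 * |C|)) * ∑ q ∈ F, Real.exp (-δ * T q) := by
      rw [Finset.mul_sum]
      refine Finset.sum_le_sum fun q hq => ?_
      refine (hup₃ q (H.subset (hF q hq).1) _ le_rfl).trans (le_of_eq ?_)
      rw [mul_assoc, ← Real.exp_add]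
      ring_nf
    rw [div_mul_eq_mul_div, div_le_iff₀ (by positivity)]
    linarith

end CuspShadows

end HypBoundary

namespace HypBoundary

/-! ### The divergence part. -/

namespace CuspShadows

variable {Y : Type*} [TopologicalSpace Y] [MeasurableSpace Y] [OpensMeasurableSpace Y]
  {ν : Measure Y} [IsFiniteMeasure ν] {P P₀ : Set Y} {T : Y → ℝ} {S : Y → ℝ → Set Y} {a δ κ : ℝ}
  (H : CuspShadows ν P P₀ T S a δ κ)
include H

/-- In the divergence case the shrunken shadows cover a definite proportion of each shadow. -/
theorem exists_le_measure_inter {ψ : ℝ → ℝ} (hψ : Monotone ψ) (hψ0 : ∀ t, 0 ≤ ψ t) {w : ℝ}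
    (hw : 0 < w) (hdiv : ¬ Summable fun n : ℕ => Real.exp (-κ * ψ (n * w))) :
    ∃ c > 0, ∀ m : ℝ, ∀ p ∈ P, c * Real.exp (-δ * T p) ≤
      ν.real ((⋃ q ∈ {q ∈ P₀ | m ≤ T q}, S q (T q + ψ (T q))) ∩ S p (T p - 2 * a)) := by
  have ha := H.nonneg
  have hκ := H.exponent_pos
  obtain ⟨C, hC, c, hc, hcount⟩ := H.exists_local_count
  obtain ⟨c₁, hc₁, hlow⟩ := H.lower_sharp
  obtain ⟨A₀, hA₀, hup₀⟩ := H.upper 0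
  obtain ⟨A₁, hA₁, hup₁⟩ := H.upper (2 * a)
  obtain ⟨A₂, hA₂, hsum⟩ := H.exists_sum_exp_le (2 * C)
  -- The extra shrinking makes the shadows within one window of width `2 C` disjoint and handles the
  -- losses `4 a` in comparing two windows.
  set s₀ := C + 4 * a + 1 with hs₀
  set B := A₂ * (A₁ * Real.exp (κ * (2 * a))) with hB
  have hB0 : 0 < B := by positivity
  -- The spacing exceeds the window width `2 C`, so the points of a later window have strictly
  -- larger levels.
  set τ := 2 * C + 4 * a + 1 with hτ
  have hτ0 : 0 < τ := by positivity
  set c' := c₁ * c * Real.exp (-κ * s₀) with hc'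
  set K := A₀ * B * (1 + B) with hK
  refine ⟨c' ^ 2 / (2 * K), by positivity, fun m p hp => ?_⟩
  set b := |m| + |T p| + 2 * C with hb
  have hbm : m + C ≤ b := by linarith [le_abs_self m, abs_nonneg (T p)]
  have hbp : T p + 2 * C ≤ b := by linarith [le_abs_self (T p), abs_nonneg m]
  have hb0 : 0 ≤ b := by positivity
  set t : ℕ → ℝ := fun j => b + j * τ with ht
  have htb : ∀ j, b ≤ t j := fun j => by
    have : 0 ≤ (j : ℝ) * τ := by positivity
    simp only [ht]; linarith
  have htlt : ∀ i j, i < j → t i + τ ≤ t j := fun i j hij => by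
    have : ((i : ℝ) + 1) * τ ≤ j * τ :=
      mul_le_mul_of_nonneg_right (by exact_mod_cast hij) hτ0.le
    simp only [ht]; linarith
  choose F hF hFsum using fun j => hcount p hp (t j) (hb0.trans (htb j))
    (by linarith [htb j])
  -- `ψ` is evaluated at the top of the window, so that the resulting shadow lies in the one shrunk
  -- by `ψ (T q)` for every `q` of the window.
  set x : ℕ → ℝ := fun j => Real.exp (-κ * ψ (t j + C)) with hx
  have hx0 : ∀ j, 0 < x j := fun j => Real.exp_pos _
  set s : ℕ → ℝ := fun j => ψ (t j + C) + s₀ with hs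
  have hs₀s : ∀ j, s₀ ≤ s j := fun j => by simp only [hs]; linarith [hψ0 (t j + C)]
  have hs₀0 : 0 < s₀ := by positivity
  have hexps : ∀ j, Real.exp (-κ * s j) = Real.exp (-κ * s₀) * x j := fun j => by
    rw [hx, ← Real.exp_add]; simp only [hs]; ring_nf
  have hexps_le : ∀ j, Real.exp (-κ * s j) ≤ x j := fun j => Real.exp_le_exp.2 (by
    simp only [hs]; nlinarith)
  have hFP : ∀ j, ∀ q ∈ F j, q ∈ P := fun j q hq => H.subset (hF j q hq).1
  have hFT : ∀ j, ∀ q ∈ F j, t j - C ≤ T q ∧ T q ≤ t j + C := fun j q hq => by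
    have := abs_le.1 (hF j q hq).2.1
    constructor <;> linarith
  have hFsub : ∀ j, ∀ q ∈ F j, ∀ u, 0 ≤ u → S q (T q + u) ⊆ S p (T p - 2 * a) := by
    intro j q hq u hu
    obtain ⟨ξ, hξq, hξp⟩ := (hF j q hq).2.2
    have h1 := (hFT j q hq).1
    have h2 := htb j
    exact H.subset_of_common hξp hξq le_rfl (by linarith) (by linarith)
  have hexp_up : ∀ q : Y, ∀ u, Real.exp (-δ * T q - κ * (u - 2 * a)) =
      Real.exp (κ * (2 * a)) * (Real.exp (-δ * T q) * Real.exp (-κ * u)) := fun q u => by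
    rw [← Real.exp_add, ← Real.exp_add]; ring_nf
  have hFsum_le : ∀ j, ∑ q ∈ F j, Real.exp (-δ * T q) ≤ B * Real.exp (-δ * T p) := by
    intro j
    have h1 := hsum (t j - C) (F j) (S p (T p - 2 * a)) fun q hq =>
      ⟨hFP j q hq, (hFT j q hq).1, by linarith [(hFT j q hq).2], 2 * C / 2 + 2 * a + 1, le_rfl,
        hFsub j q hq _ (by positivity)⟩
    have h2 := hup₁ p hp (0 - 2 * a) (by linarith)
    rw [hexp_up, show T p + (0 - 2 * a) = T p - 2 * a by ring, mul_zero, Real.exp_zero,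
      mul_one] at h2
    refine (h1.trans (mul_le_mul_of_nonneg_left h2 hA₂.le)).trans (le_of_eq ?_)
    rw [hB]; ring
  have hball : ∀ j, ∀ q ∈ F j, ν.real (S q (T q + s j)) ≤ A₀ * x j * Real.exp (-δ * T q) := by
    intro j q hq
    refine (hup₀ q (hFP j q hq) (s j) (by linarith [hs₀s j])).trans ?_
    rw [sub_eq_add_neg, Real.exp_add, ← neg_mul]
    have := mul_le_mul_of_nonneg_left (hexps_le j) (mul_pos hA₀ (Real.exp_pos (-δ * T q))).le
    linarith
  set A : ℕ → Set Y := fun j => ⋃ q ∈ F j, S q (T q + s j) with hA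
  have hAm : ∀ j, MeasurableSet (A j) := fun j =>
    (F j).measurableSet_biUnion fun q _ => (H.isOpen _ _).measurableSet
  have hAlow : ∀ j, c' * Real.exp (-δ * T p) * x j ≤ ν.real (A j) := by
    intro j
    have h1 : ν.real (A j) = ∑ q ∈ F j, ν.real (S q (T q + s j)) :=
      measureReal_biUnion_finset (fun q hq q' hq' hne => H.disjoint (hFP j q hq) (hFP j q' hq') hne
        (W := 2 * C) (by
          have h1 := hFT j q hq
          have h2 := hFT j q' hq'
          rw [abs_le]; constructor <;> linarith) (by linarith [hs₀s j]) (by linarith [hs₀s j]))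
        fun q _ => (H.isOpen _ _).measurableSet
    rw [h1]
    have h2 : ∀ q ∈ F j, c₁ * Real.exp (-κ * s₀) * x j * Real.exp (-δ * T q) ≤
        ν.real (S q (T q + s j)) := by
      intro q hq
      refine le_trans (le_of_eq ?_) (hlow q (hF j q hq).1 (s j) (by linarith [hs₀s j]))
      rw [sub_eq_add_neg, Real.exp_add, ← neg_mul, hexps]
      ring
    refine le_trans ?_ (Finset.sum_le_sum h2)
    rw [← Finset.mul_sum]
    have h3 := mul_le_mul_of_nonneg_left (hFsum j)
      (by have := hx0 j; positivity : 0 ≤ c₁ * Real.exp (-κ * s₀) * x j)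
    refine le_trans (le_of_eq ?_) h3
    rw [hc']; ring
  have hAup : ∀ j, ν.real (A j) ≤ K * Real.exp (-δ * T p) * x j := by
    intro j
    refine (measureReal_biUnion_finset_le _ _).trans ((Finset.sum_le_sum (hball j)).trans ?_)
    rw [← Finset.mul_sum]
    have h1 := mul_le_mul_of_nonneg_left (hFsum_le j) (mul_pos hA₀ (hx0 j)).le
    have h2 : 0 ≤ A₀ * B * B * Real.exp (-δ * T p) * x j := by have := hx0 j; positivity
    rw [hK]
    linarith
  -- Quasi-independence: the points of window `j` whose shadows meet the shrunken shadow of `q` have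
  -- unshrunken weight at most that of a slight enlargement of it, about `x i * exp (-δ T q)`;
  -- shrinking them costs the factor `x j`.
  have hpair : ∀ i j, i < j → ν.real (A i ∩ A j) ≤ K * Real.exp (-δ * T p) * (x i * x j) := by
    classical
    intro i j hij
    set G : Y → Finset Y := fun q => (F j).filter fun q' =>
      (S q (T q + s i) ∩ S q' (T q' + s j)).Nonempty with hG
    have hsub : A i ∩ A j ⊆ ⋃ q ∈ F i, ⋃ q' ∈ G q, S q' (T q' + s j) := by
      rintro η ⟨hηi, hηj⟩
      simp only [hA, Set.mem_iUnion] at hηi hηj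
      obtain ⟨q, hq, hηq⟩ := hηi
      obtain ⟨q', hq', hηq'⟩ := hηj
      exact Set.mem_biUnion hq (Set.mem_biUnion
        (Finset.mem_coe.2 (Finset.mem_filter.2 ⟨hq', η, hηq, hηq'⟩)) hηq')
    have hinner : ∀ q ∈ F i, ν.real (⋃ q' ∈ G q, S q' (T q' + s j)) ≤
        A₀ * x j * (B * x i) * Real.exp (-δ * T q) := by
      intro q hq
      refine (measureReal_biUnion_finset_le _ _).trans
        ((Finset.sum_le_sum fun q' hq' => hball j q' (Finset.mem_filter.1 hq').1).trans ?_)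
      rw [← Finset.mul_sum]
      have h1 := hsum (t j - C) (G q) (S q (T q + s i - 2 * a)) fun q' hq' => by
        obtain ⟨hq'F, η, hη, hη'⟩ := Finset.mem_filter.1 hq'
        have hT := hFT i q hq
        have hT' := hFT j q' hq'F
        have h3 := htlt i j hij
        refine ⟨hFP j q' hq'F, hT'.1, by linarith, 2 * C / 2 + 2 * a + 1, le_rfl, ?_⟩
        have hne : q ≠ q' := by
          rintro rfl
          linarith
        have h4 : T q + s i ≤ T q' := by
          have h5 := hs₀s i
          have h6 := hs₀s j
          rcases H.min_le_of_common (hFP i q hq) (hFP j q' hq'F) hne hη hη' with h | h <;>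
            linarith
        exact H.subset_of_common hη hη' le_rfl (by linarith [hs₀s j]) (by linarith)
      have h2 := hup₁ q (hFP i q hq) (s i - 2 * a) (by linarith [hs₀s i])
      rw [hexp_up, ← add_sub_assoc] at h2
      have h3 : A₁ * (Real.exp (κ * (2 * a)) * (Real.exp (-δ * T q) * Real.exp (-κ * s i))) ≤
          A₁ * (Real.exp (κ * (2 * a)) * (Real.exp (-δ * T q) * x i)) :=
        mul_le_mul_of_nonneg_left (mul_le_mul_of_nonneg_left
          (mul_le_mul_of_nonneg_left (hexps_le i) (Real.exp_pos _).le) (Real.exp_pos _).le) hA₁.le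
      have h4 := h1.trans (mul_le_mul_of_nonneg_left (h2.trans h3) hA₂.le)
      refine (mul_le_mul_of_nonneg_left h4 (mul_pos hA₀ (hx0 j)).le).trans (le_of_eq ?_)
      rw [hB]; ring
    refine (measureReal_mono hsub (measure_ne_top _ _)).trans
      ((measureReal_biUnion_finset_le _ _).trans
      ((Finset.sum_le_sum hinner).trans ?_))
    rw [← Finset.mul_sum]
    have h0 : 0 ≤ A₀ * x j * (B * x i) := by have := hx0 i; have := hx0 j; positivity
    have h1 := mul_le_mul_of_nonneg_left (hFsum_le i) h0
    have h2 : 0 ≤ A₀ * B * Real.exp (-δ * T p) * (x i * x j) := by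
      have := hx0 i; have := hx0 j; positivity
    rw [hK]
    linarith
  have hdiv' : ¬ Summable x := by
    have := Antitone.not_summable_add_mul (f := fun t => Real.exp (-κ * ψ t))
      (fun u v huv => Real.exp_le_exp.2 (by nlinarith [hψ huv])) (fun _ => (Real.exp_pos _).le) hw
      hτ0 (b + C) hdiv
    convert this using 2 with j
    simp only [hx, ht, add_right_comm]
  obtain ⟨N, hN⟩ := (((not_summable_iff_tendsto_nat_atTop_of_nonneg fun j => (hx0 j).le).1
    hdiv').eventually_ge_atTop 1).exists
  refine (le_measure_biUnion_of_quasi_independent (Finset.range N) A (fun j _ => hAm j) x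
    (fun j _ => (hx0 j).le) (by positivity : 0 < c') (by positivity : 0 < K) (Real.exp_pos _).le
    (fun j _ => hAlow j) (fun j _ => hAup j) (fun i _ j _ hij => ?_) hN).trans ?_
  · rcases lt_or_gt_of_ne hij with h | h
    · exact hpair i j h
    · rw [Set.inter_comm, mul_comm (x i)]
      exact hpair j i h
  · refine measureReal_mono (Set.iUnion₂_subset fun j _ => Set.iUnion₂_subset fun q hq => ?_)
    refine Set.subset_inter ?_ (hFsub j q hq _ (by linarith [hs₀s j]))
    have h1 := hFT j q hq
    have h2 := htb j
    refine (H.anti _ _ _ ?_).trans (Set.subset_biUnion_of_mem (u := fun q => S q (T q + ψ (T q)))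
      (show q ∈ {q ∈ P₀ | m ≤ T q} from ⟨(hF j q hq).1, by linarith⟩))
    have := hψ h1.2
    simp only [hs]
    linarith

/-- Almost every point lies in the shadows of points of `P₀` at arbitrarily high levels. -/
theorem exists_ae_forall_exists_mem : ∃ C, ∀ᵐ ξ ∂ν, ∀ t₁ : ℝ, ∃ q ∈ P₀, t₁ ≤ T q ∧
    ξ ∈ S q (T q - C) := by
  have ha := H.nonneg
  obtain ⟨C, hC⟩ := H.dichotomy (2 * a + 1)
  refine ⟨2 * |C|, ?_⟩
  have hnull : ∀ p ∈ P, ∀ᵐ ξ ∂ν, ∃ t, ξ ∉ S p t := by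
    intro p hp
    rw [ae_iff]
    simp only [not_exists, not_not]
    obtain ⟨A, hA, hup⟩ := H.upper 0
    have hlim : Tendsto (fun s : ℝ => A * Real.exp (-δ * T p - κ * s)) atTop (𝓝 (A * 0)) := by
      refine (Real.tendsto_exp_atBot.comp ?_).const_mul A
      simp only [sub_eq_add_neg]
      refine tendsto_atBot_add_const_left _ _ (tendsto_neg_atTop_atBot.comp ?_)
      exact tendsto_id.const_mul_atTop H.exponent_pos
    have hle : ν.real {ξ | ∀ t, ξ ∈ S p t} ≤ A * 0 := by
      refine ge_of_tendsto hlim ?_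
      filter_upwards [eventually_ge_atTop 0] with s hs
      exact (measureReal_mono (Set.ofPred_subset.2 fun ξ hξ => hξ (T p + s))).trans (hup p hp s (by linarith))
    rw [mul_zero] at hle
    exact (measureReal_eq_zero_iff (measure_ne_top _ _)).1 (le_antisymm hle measureReal_nonneg)
  filter_upwards [hC, (ae_ball_iff H.countable).2 hnull] with ξ hξ hξP t₁
  by_contra! hcon
  set t₂ := |t₁| + |C| with ht₂
  have hCabs := le_abs_self C
  -- From time `t₂` on, `ξ` would be deep in a horoball at every step. Consecutive horoballs
  -- coincide by separation, so `ξ` would lie in all neighbourhoods of one point of `P`, a null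
  -- event.
  have hfirst : ∀ n : ℕ, ∃ q ∈ P, T q + (2 * a + 1) ≤ t₂ + n ∧
      ξ ∈ S q ((t₂ + n + T q + (2 * a + 1)) / 2) := by
    intro n
    have hn : (0 : ℝ) ≤ n := Nat.cast_nonneg n
    rcases hξ (t₂ + n) (by positivity) with h | ⟨q, hq, hqt, hmem⟩
    · exact h
    · have h1 := abs_le.1 hqt
      exact absurd (H.anti _ _ _ (by linarith) hmem) (hcon q hq (by linarith [le_abs_self t₁]))
  choose q hqP hqT hqmem using hfirst
  have hsucc : ∀ n, q (n + 1) = q n := by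
    intro n
    by_contra hne
    have h1 := hqT n
    have h2 := hqT (n + 1)
    push_cast at h2
    have h3 := hqmem (n + 1)
    push_cast at h3
    rcases H.min_le_of_common (hqP _) (hqP _) hne h3 (hqmem n) with h | h <;> linarith
  have hconst : ∀ n, q n = q 0 := fun n => by
    induction n with
    | zero => rfl
    | succ n ih => rw [hsucc, ih]
  obtain ⟨t, ht⟩ := hξP (q 0) (hqP 0)
  obtain ⟨n, hn⟩ := exists_nat_ge (2 * t - t₂ - T (q 0) - (2 * a + 1))
  have := hqmem n
  rw [hconst] at this
  exact ht (H.anti _ _ _ (by linarith) this)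

/-- The divergence part: almost every point lies in infinitely many shrunken shadows. -/
theorem ae_forall_exists_mem {ψ : ℝ → ℝ} (hψ : Monotone ψ) (hψ0 : ∀ t, 0 ≤ ψ t) {w : ℝ}
    (hw : 0 < w) (hdiv : ¬ Summable fun n : ℕ => Real.exp (-κ * ψ (n * w))) (m : ℝ) :
    ∀ᵐ ξ ∂ν, ∃ q ∈ P₀, m ≤ T q ∧ ξ ∈ S q (T q + ψ (T q)) := by
  have ha := H.nonneg
  have hκ := H.exponent_pos
  set U : Set Y := ⋃ q ∈ {q ∈ P₀ | m ≤ T q}, S q (T q + ψ (T q)) with hU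
  -- The additional `a` leaves room around `U'` inside `U`: a point of `U'` cannot have points of
  -- `Uᶜ` in arbitrarily small neighbourhoods.
  set U' : Set Y := ⋃ q ∈ {q ∈ P₀ | m ≤ T q}, S q (T q + (ψ (T q) + a)) with hU'
  have hU'm : MeasurableSet U' :=
    (isOpen_biUnion fun q _ => H.isOpen _ _).measurableSet
  have hψ' : Monotone fun t => ψ t + a := fun u v h => by simpa using hψ h
  have hdiv' : ¬ Summable fun n : ℕ => Real.exp (-κ * (ψ (n * w) + a)) := by
    intro hs
    apply hdiv
    refine (hs.mul_left (Real.exp (κ * a))).congr fun n => ?_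
    rw [← Real.exp_add]; ring_nf
  obtain ⟨c, hc, hlow⟩ := H.exists_le_measure_inter hψ' (fun t => add_nonneg (hψ0 t) ha) hw hdiv'
  obtain ⟨C, hC⟩ := H.exists_ae_forall_exists_mem
  set C' := |C| with hC'
  have hCC' : C ≤ C' := le_abs_self C
  have hC'0 : 0 ≤ C' := abs_nonneg C
  set C₄ := 1 + C' + 4 * a with hC₄
  obtain ⟨A, hA, hup⟩ := H.upper C₄
  set K := A * Real.exp (κ * C₄) / c with hK
  have hK0 : 0 < K := by positivity
  set N : ℕ → Set Y := fun n => ⋃ ξ ∈ Uᶜ, S ξ n with hN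
  have hNm : ∀ n, MeasurableSet (N n) := fun n =>
    (isOpen_biUnion fun q _ => H.isOpen _ _).measurableSet
  have hNanti : Antitone N := fun i j hij => Set.iUnion₂_mono fun ξ _ =>
    H.anti _ _ _ (by exact_mod_cast hij)
  -- The complement of `U` is covered by disjoint shadows, of which `U'` fills a part.
  have hclaim : ∀ n : ℕ, ν Uᶜ ≤ ENNReal.ofReal K * ν (N n ∩ U') := by
    intro n
    set I : Set Y := {q ∈ P₀ | (n : ℝ) + C' + 3 * a ≤ T q ∧ (S q (T q - C') ∩ Uᶜ).Nonempty} with hI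
    have hIP : ∀ q ∈ I, q ∈ P := fun q hq => H.subset hq.1
    -- Sizes are measured by `exp (-T q)`, so the enlargement factor `exp 1` means a loss of one
    -- level.
    obtain ⟨u, huI, hudisj, hucov⟩ := Vitali.exists_disjoint_subfamily_covering_enlargement
      (fun q => S q (T q - 2 * a)) I (fun q => Real.exp (-T q)) (Real.exp 1)
      (Real.one_lt_exp_iff.2 one_pos) (fun q _ => (Real.exp_pos _).le)
      (Real.exp a) (fun q hq => Real.exp_le_exp.2 (by linarith [H.neg_le q (hIP q hq)]))
      (fun q _ => ⟨q, H.self_mem _ _⟩)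
    have hcountable : u.Countable := H.countable.mono fun q hq => hIP q (huI hq)
    have h1 : ν Uᶜ ≤ ν (⋃ q ∈ u, S q (T q + -C₄)) := by
      refine measure_mono_ae ?_
      filter_upwards [hC] with ξ hξ hξU
      obtain ⟨q, hq, hqT, hξq⟩ := hξ (n + C' + 3 * a)
      have hξq' : ξ ∈ S q (T q - C') := H.anti _ _ _ (by linarith) hξq
      obtain ⟨q', hq', ⟨η, hη, hη'⟩, hle⟩ := hucov q ⟨hq, hqT, ξ, hξq', hξU⟩
      rw [← Real.exp_add, Real.exp_le_exp] at hle
      have h2 : S q (T q - C') ⊆ S q' (T q' - 1 - C' - 2 * a - 2 * a) :=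
        H.subset_of_common hη' hη (by linarith) (by linarith) (by linarith)
      refine Set.mem_biUnion hq' (H.anti _ _ _ ?_ (h2 hξq'))
      linarith
    have h2 : ∀ q ∈ u, ν (S q (T q + -C₄)) ≤
        ENNReal.ofReal K * ν (U' ∩ S q (T q - 2 * a)) := by
      intro q hq
      have hqP := hIP q (huI hq)
      rw [← ofReal_measureReal (measure_ne_top _ _), ← ofReal_measureReal (measure_ne_top _ _),
        ← ENNReal.ofReal_mul hK0.le]
      refine ENNReal.ofReal_le_ofReal ((hup q hqP _ le_rfl).trans ?_)
      have h3 := mul_le_mul_of_nonneg_left (hlow m q hqP) hK0.le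
      refine le_trans (le_of_eq ?_) h3
      rw [hK, mul_neg, sub_neg_eq_add, Real.exp_add]
      field_simp
    have h3 : ⋃ q ∈ u, (U' ∩ S q (T q - 2 * a)) ⊆ N n ∩ U' := by
      refine Set.iUnion₂_subset fun q hq η hη => ⟨?_, hη.1⟩
      obtain ⟨-, hqT, ξ, hξq, hξU⟩ := huI hq
      refine Set.mem_biUnion hξU ?_
      refine H.anti _ _ _ ?_ (H.mem_of_common (v := T q - C' - 2 * a) (H.symm _ _ _ ?_)
        (H.symm _ _ _ hη.2) le_rfl (by linarith))
      · linarith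
      · exact H.anti _ _ _ (by linarith) hξq
    calc ν Uᶜ ≤ ν (⋃ q ∈ u, S q (T q + -C₄)) := h1
      _ ≤ ∑' q : u, ν (S q (T q + -C₄)) := measure_biUnion_le _ hcountable _
      _ ≤ ∑' q : u, ENNReal.ofReal K * ν (U' ∩ S q (T q - 2 * a)) :=
          ENNReal.tsum_le_tsum fun q => h2 q q.2
      _ = ENNReal.ofReal K * ∑' q : u, ν (U' ∩ S q (T q - 2 * a)) := ENNReal.tsum_mul_left
      _ = ENNReal.ofReal K * ν (⋃ q ∈ u, (U' ∩ S q (T q - 2 * a))) := by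
          rw [measure_biUnion hcountable (fun q hq q' hq' hne => (hudisj hq hq' hne).mono
            Set.inter_subset_right Set.inter_subset_right)
            fun q _ => hU'm.inter (H.isOpen _ _).measurableSet]
      _ ≤ ENNReal.ofReal K * ν (N n ∩ U') := mul_le_mul_right (measure_mono h3) _
  have hempty : ⋂ n, (N n ∩ U') = ∅ := by
    refine Set.eq_empty_of_forall_notMem fun η hη => ?_
    rw [Set.mem_iInter] at hη
    have h1 := (hη 0).2
    simp only [hU', Set.mem_iUnion] at h1
    obtain ⟨q, hq, hηq⟩ := h1
    obtain ⟨n, hn⟩ := exists_nat_ge (T q + (ψ (T q) + a))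
    have h2 := (hη n).1
    simp only [hN, Set.mem_iUnion] at h2
    obtain ⟨ξ, hξU, hηξ⟩ := h2
    refine hξU (Set.mem_biUnion hq ?_)
    have := H.mem_of_common hηq hηξ le_rfl hn
    refine H.anti _ _ _ ?_ this
    linarith
  have hlim : Tendsto (fun n => ENNReal.ofReal K * ν (N n ∩ U')) atTop (𝓝 0) := by
    have h1 := tendsto_measure_iInter_atTop (μ := ν) (s := fun n => N n ∩ U')
      (fun n => ((hNm n).inter hU'm).nullMeasurableSet)
      (fun i j hij => Set.inter_subset_inter_left _ (hNanti hij)) ⟨0, measure_ne_top _ _⟩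
    rw [hempty, measure_empty] at h1
    simpa using ENNReal.Tendsto.const_mul h1 (Or.inr ENNReal.ofReal_ne_top)
  have hzero : ν Uᶜ = 0 := le_antisymm (ge_of_tendsto' hlim hclaim) zero_le
  have hset : Uᶜ = {ξ | ¬ ∃ q ∈ P₀, m ≤ T q ∧ ξ ∈ S q (T q + ψ (T q))} := by
    ext ξ
    simp only [hU, Set.mem_compl_iff, Set.mem_iUnion, exists_prop, Set.mem_ofPred_eq, and_assoc]
  rwa [hset] at hzero

end CuspShadows

end HypBoundary

namespace HypBoundary

/-! ### The abstract hypotheses hold for the group. -/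

section Khinchin

variable {Γ : Type*} [Group Γ] {X : Type*} [MetricSpace X] [MulAction Γ X] [IsIsometricSMul Γ X]
  {o : X} {r : Boundary X → ℝ} {δ : ℝ} {ν : Measure (Boundary X)} [IsFiniteMeasure ν]

variable (hX : IsBusemannRegularHyperbolic X) (hr : IsHoroballPacking Γ o r)
  (hne : (limitSet Γ o).Nontrivial) (hΓ : IsGeometricallyFinite Γ o) (hδ : 0 < δ)
  (hs : SatisfiesShadowLemma Γ o r δ ν)
include hX hr hne hΓ hδ hs

theorem exists_separatedShadows :
    ∃ a, SeparatedShadows ν (parabolicPoints Γ o) (horoballDist r) (visualBall o) a δ := by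
  obtain ⟨α, hα⟩ := hX.hyperbolic
  obtain ⟨a, ha0, ha⟩ := exists_neg_le_horoballDist (Γ := Γ) hX hr
  obtain ⟨A, hA, hbounds⟩ := exists_visualBall_parabolic_bounds hX hr hne hΓ hδ hs
  have : Nonempty X := ⟨o⟩
  have hα0 := FourPoint.nonneg hα
  have haa := le_abs_self a
  exact ⟨4 * α + 1 + |a|,
    { nonneg := by positivity
      dim_pos := hδ
      isOpen := isOpen_visualBall hX o
      anti := fun ξ s t h => visualBall_anti o ξ h
      symm := fun ξ η t h => visualBall_symm h
      trans := fun ξ η ζ t h h' =>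
        visualBall_anti o ξ (by linarith) (visualBall_trans hX hα h h')
      self_mem := mem_visualBall_self hX o
      separated := fun p hp q hq hpq t h => le_of_mem_visualBall_parabolic hX hr hα ha hp hq hpq h
      neg_le := fun p hp => by linarith [ha p hp]
      lower := ⟨A⁻¹, by positivity, fun p hp s hs0 => by
        refine le_trans ?_ (hbounds p hp s hs0).1
        refine mul_le_mul_of_nonneg_left (Real.exp_le_exp.2 ?_) (by positivity)
        nlinarith [rank_nonneg (Γ := Γ) (o := o) p]⟩ }⟩

/-- Rank is constant on orbits, and there are finitely many orbits of parabolic points: the entry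
point of the ray to `p` is near some `g • o`, so `g⁻¹` brings the horoball to bounded level, where
there are only finitely many. -/
theorem exists_rank_eq_maxRank (hpar : (parabolicPoints Γ o).Nonempty) :
    ∃ p₀ ∈ parabolicPoints Γ o, rank Γ o p₀ = maxRank Γ o ∧
      ∀ p ∈ parabolicPoints Γ o, rank Γ o p ≤ maxRank Γ o := by
  obtain ⟨a, ha⟩ := exists_separatedShadows hX hr hne hΓ hδ hs
  obtain ⟨D, hD0, hD⟩ := exists_infDist_orbit_bounds hX hr hne hΓ
  have hfin := ha.finite_level (D + 1)
  have hrep : ∀ p ∈ parabolicPoints Γ o, ∃ g : Γ, horoballDist r (g • p) ≤ D + 1 := by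
    intro p hp
    rcases le_or_gt (horoballDist r p) 0 with h | h
    · exact ⟨1, by rw [one_smul]; linarith⟩
    · obtain ⟨γ, hγ⟩ := exists_isRay hX o p
      obtain ⟨t, ht⟩ : ∃ t : ℝ≥0, (t : ℝ) = horoballDist r p := ⟨⟨_, h.le⟩, rfl⟩
      have h1 := (le_abs_self _).trans (hD p hp γ hγ t)
      rw [ht, sub_self, abs_zero, sub_zero, max_self, mul_zero, add_zero] at h1
      obtain ⟨_, ⟨g, rfl⟩, hg⟩ := (Metric.infDist_lt_iff ⟨o, MulAction.mem_orbit_self o⟩).1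
        (h1.trans_lt (lt_add_one D))
      change dist (γ t) (g • o) < D + 1 at hg
      refine ⟨g⁻¹, ?_⟩
      have h2 := busemann_orbit hX hr hne g hp
      have h3 := busemann_add hX p (g • o) (γ t) o
      have h4 := busemann_le_dist hX p (g • o) (γ t)
      rw [dist_comm] at h4
      rw [hγ.busemann_eq hX] at h3
      linarith
  have hrep' : ∀ p ∈ parabolicPoints Γ o, ∃ q ∈ {q ∈ parabolicPoints Γ o | horoballDist r q ≤ D + 1},
      rank Γ o q = rank Γ o p := fun p hp =>
    let ⟨g, hg⟩ := hrep p hp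
    ⟨g • p, ⟨smul_mem_parabolicPoints hX o g hp, hg⟩, rank_smul hΓ.discrete g p⟩
  obtain ⟨p, hp⟩ := hpar
  obtain ⟨q, hq, -⟩ := hrep' p hp
  obtain ⟨p₀, hp₀, hmax⟩ := Set.exists_max_image _ (rank Γ o) hfin ⟨q, hq⟩
  have hle : ∀ p ∈ parabolicPoints Γ o, rank Γ o p ≤ rank Γ o p₀ := fun p hp => by
    obtain ⟨q, hq, hqp⟩ := hrep' p hp
    exact hqp ▸ hmax q hq
  have heq : rank Γ o p₀ = maxRank Γ o := by
    have : Nonempty (parabolicPoints Γ o) := ⟨⟨p₀, hp₀.1⟩⟩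
    refine le_antisymm ?_ (ciSup_le fun p => hle p p.2)
    exact le_ciSup (f := fun p : parabolicPoints Γ o => rank Γ o (p : Boundary X))
      ⟨rank Γ o p₀, by rintro _ ⟨p, rfl⟩; exact hle p p.2⟩ ⟨p₀, hp₀.1⟩
  exact ⟨p₀, hp₀.1, heq, fun p hp => heq ▸ hle p hp⟩

theorem exists_cuspShadows (hpar : (parabolicPoints Γ o).Nonempty)
    (hΛ : ν (limitSet Γ o)ᶜ = 0) :
    ∃ a P₀, CuspShadows ν (parabolicPoints Γ o) P₀ (horoballDist r) (visualBall o) a δ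
      (2 * δ - maxRank Γ o) := by
  obtain ⟨a, ha⟩ := exists_separatedShadows hX hr hne hΓ hδ hs
  obtain ⟨p₀, hp₀, hrank, hle⟩ := exists_rank_eq_maxRank hX hr hne hΓ hδ hs hpar
  obtain ⟨A, hA, hbounds⟩ := exists_visualBall_parabolic_bounds hX hr hne hΓ hδ hs
  have hsub : MulAction.orbit Γ p₀ ⊆ parabolicPoints Γ o := by
    rintro _ ⟨g, rfl⟩
    exact smul_mem_parabolicPoints hX o g hp₀
  have hκ : 0 < 2 * δ - maxRank Γ o := by
    have := rank_lt hX hr hne hΓ hδ hs hp₀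
    linarith
  refine ⟨a, MulAction.orbit Γ p₀,
    { toSeparatedShadows := ha
      exponent_pos := hκ
      subset := hsub
      upper := fun b => ?_
      lower_sharp := ⟨A⁻¹, by positivity, fun p hp s hs0 => ?_⟩
      dichotomy := fun h => ?_ }⟩
  · obtain ⟨A', hA', hbound⟩ := exists_visualBall_parabolic_le hX hr hne hΓ hδ hs b
    refine ⟨A + A', by positivity, fun p hp s hsb => ?_⟩
    rw [add_mul]
    rcases le_or_gt 0 s with h | h
    · have h1 := (hbounds p hp s h).2
      have h2 : A * Real.exp (-δ * horoballDist r p - (2 * δ - rank Γ o p) * s) ≤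
          A * Real.exp (-δ * horoballDist r p - (2 * δ - maxRank Γ o) * s) := by
        refine mul_le_mul_of_nonneg_left (Real.exp_le_exp.2 ?_) hA.le
        nlinarith [hle p hp]
      have h3 : 0 ≤ A' * Real.exp (-δ * horoballDist r p - (2 * δ - maxRank Γ o) * s) := by
        positivity
      linarith
    · have h1 : ν.real (visualBall o p (horoballDist r p + s)) ≤
          ν.real (visualBall o p (horoballDist r p - b)) :=
        measureReal_mono (visualBall_anti o p (by linarith))
      have h2 : A' * Real.exp (-δ * horoballDist r p) ≤
          A' * Real.exp (-δ * horoballDist r p - (2 * δ - maxRank Γ o) * s) := by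
        refine mul_le_mul_of_nonneg_left (Real.exp_le_exp.2 ?_) hA'.le
        nlinarith
      have h3 : 0 ≤ A * Real.exp (-δ * horoballDist r p - (2 * δ - maxRank Γ o) * s) := by
        positivity
      linarith [hbound p hp]
  · obtain ⟨g, rfl⟩ := hp
    have h1 := (hbounds (g • p₀) (smul_mem_parabolicPoints hX o g hp₀) s hs0).1
    rwa [rank_smul hΓ.discrete, hrank] at h1
  · obtain ⟨C, hC⟩ := exists_cusp_dichotomy hX hr hne hΓ hp₀ h
    refine ⟨C, ?_⟩
    have : ∀ᵐ ξ ∂ν, ξ ∈ limitSet Γ o := hΛ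
    filter_upwards [this] with ξ hξ
    exact hC ξ hξ

omit hX hne hΓ hδ hs [IsFiniteMeasure ν] in
theorem horoballLevel_eq {l : ℝ} (hl : 0 < l) (n : ℕ) :
    horoballLevel Γ o r l n = {p ∈ parabolicPoints Γ o |
      n * -Real.log l ≤ horoballDist r p ∧ horoballDist r p ≤ (n + 1) * -Real.log l} := by
  ext p
  refine and_congr_right fun hp => ?_
  have hrp := hr.pos p hp
  rw [← Real.log_le_log_iff (by positivity) hrp, ← Real.log_le_log_iff hrp (by positivity),
    Real.log_pow, Real.log_pow, horoballDist]
  push_cast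
  constructor <;> rintro ⟨h1, h2⟩ <;> constructor <;> linarith

end Khinchin

theorem IsKhinchinFunction.log_mul {φ : ℝ → ℝ} (hφ : IsKhinchinFunction φ) {x : ℝ} (hx : 0 < x) :
    Real.log (x * φ x) = Real.log x + Real.log (φ x) :=
  Real.log_mul hx.ne' (hφ.pos x hx).ne'

end HypBoundary

/-! ### The zero–full law for the limsup set. -/

open HypBoundary in
theorem theoremT {Γ : Type*} [Group Γ] {X : Type*} [MetricSpace X] [MulAction Γ X]
    [IsIsometricSMul Γ X] (hX : IsBusemannRegularHyperbolic X) (o : X)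
    (hΓ : IsGeometricallyFinite Γ o) (hne : 2 < (limitSet Γ o).encard)
    (hpar : (parabolicPoints Γ o).Nonempty)
    (r : Boundary X → ℝ) (hr : IsHoroballPacking Γ o r)
    (δ : ℝ) (μ : X → MeasureTheory.Measure (Boundary X)) (hμ : IsConformalDensity Γ o δ μ)
    (hshadow : SatisfiesShadowLemma Γ o r δ (μ o))
    (φ : ℝ → ℝ) (hφ : IsKhinchinFunction φ) (l : ℝ) (hl0 : 0 < l) (hl1 : l < 1) :
    (Summable (fun n : ℕ => φ (l ^ n) ^ (2 * δ - maxRank Γ o)) →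
        μ o (khinchinSet Γ o r l φ) = 0) ∧
      (¬ Summable (fun n : ℕ => φ (l ^ n) ^ (2 * δ - maxRank Γ o)) →
        μ o (khinchinSet Γ o r l φ)ᶜ = 0) := by
  have hfin := hμ.finite o
  have hnt : (limitSet Γ o).Nontrivial :=
    Set.one_lt_encard_iff_nontrivial.1 (lt_trans (by norm_num) hne)
  obtain ⟨a, P₀, H⟩ := exists_cuspShadows hX hr hnt hΓ hμ.dim_pos hshadow hpar (hμ.supported o)
  have hκ := H.exponent_pos
  set κ := 2 * δ - maxRank Γ o
  set w := -Real.log l with hw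
  have hw0 : 0 < w := by rw [hw, neg_pos]; exact Real.log_neg hl0 hl1
  have hpow : ∀ n : ℕ, l ^ n = Real.exp (-(n * w)) := fun n => by
    rw [hw, mul_neg, neg_neg, Real.exp_nat_mul, Real.exp_log hl0]
  have hφn : ∀ n : ℕ, 0 < φ (l ^ n) := fun n => hφ.pos _ (pow_pos hl0 n)
  have hexp : ∀ p ∈ parabolicPoints Γ o, Real.exp (-horoballDist r p) = r p := fun p hp => by
    rw [horoballDist, neg_neg, Real.exp_log (hr.pos p hp)]
  have hlog : ∀ p ∈ parabolicPoints Γ o, Real.log (r p * φ (r p)) =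
      -horoballDist r p + Real.log (φ (r p)) := fun p hp => by
    rw [hφ.log_mul (hr.pos p hp), horoballDist, neg_neg]
  constructor
  · intro hsum
    obtain ⟨n₀, hn₀⟩ := eventually_atTop.1
      (hsum.tendsto_atTop_zero.eventually_lt_const one_pos)
    refine measure_mono_null ?_ (H.measure_limsup_eq_zero (w := w)
      (fun p => -Real.log (φ (r p)) - 1) 1 (fun n => Real.exp κ * φ (l ^ n) ^ κ)
      (hsum.mul_left _) (fun n => mul_nonneg (Real.exp_pos _).le
        (Real.rpow_nonneg (hφn n).le _)) n₀ fun n hn p hp h1 h2 => ?_)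
    · refine Set.iInter_mono fun n => Set.iUnion₂_mono fun m hm => ?_
      rw [horoballLevel_eq hr hl0]
      refine Set.iUnion₂_mono fun p hp => ?_
      refine (shadowOf_horoball_subset hX o p
        (T := horoballDist r p - Real.log (φ (r p))) ?_).trans (visualBall_anti o p ?_)
      · rw [hlog p hp.1]; linarith
      · linarith
    · have hle : φ (r p) ≤ φ (l ^ n) := by
        refine hφ.mono (hr.pos p hp) (pow_pos hl0 n) ?_
        rw [← hexp p hp, hpow]
        exact Real.exp_le_exp.2 (by linarith)
      -- The terms of the series tend to 0 and `κ > 0`, so the horoballs really shrink for large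
      -- `n`; this bounds the levels from below by `-1`.
      have hlt : φ (l ^ n) < 1 := by
        by_contra! hge
        exact absurd (hn₀ n hn) (not_lt.2 (Real.one_le_rpow hge hκ.le))
      have hpos := hφ.pos _ (hr.pos p hp)
      have h3 := Real.log_neg hpos (hle.trans_lt hlt)
      refine ⟨by linarith, ?_⟩
      have h4 : φ (r p) ^ κ ≤ φ (l ^ n) ^ κ := Real.rpow_le_rpow hpos.le hle hκ.le
      refine le_trans (le_of_eq ?_) (mul_le_mul_of_nonneg_left h4 (Real.exp_pos κ).le)
      rw [Real.rpow_def_of_pos hpos, ← Real.exp_add]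
      ring_nf
  · intro hdiv
    obtain ⟨α, hα⟩ := hX.hyperbolic
    have : Nonempty X := ⟨o⟩
    have hα0 := FourPoint.nonneg hα
    -- Truncation at 0 covers `φ ≥ 1`, and `4 α` is the loss between visual balls and shadows of
    -- horoballs.
    set ψ : ℝ → ℝ := fun t => max (-Real.log (φ (Real.exp (-t)))) 0 + 4 * α with hψ
    have hψm : Monotone ψ := fun s t hst => by
      refine add_le_add_left (max_le_max_right _ (neg_le_neg ?_)) _
      exact Real.log_le_log (hφ.pos _ (Real.exp_pos _)) (hφ.mono (Real.exp_pos _) (Real.exp_pos _)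
        (Real.exp_le_exp.2 (by linarith)))
    have hψ0 : ∀ t, 0 ≤ ψ t := fun t => add_nonneg (le_max_right _ _) (by positivity)
    have hψdiv : ¬ Summable fun n : ℕ => Real.exp (-κ * ψ (n * w)) := by
      intro hs
      apply hdiv
      have hs' : Summable fun n : ℕ => Real.exp (-κ * max (-Real.log (φ (l ^ n))) 0) := by
        refine (hs.mul_left (Real.exp (κ * (4 * α)))).congr fun n => ?_
        rw [← Real.exp_add, hψ, hpow]
        ring_nf
      -- If the truncated series converged, its terms would eventually be below 1, where the
      -- truncation is inactive.
      refine (summable_congr_atTop ?_).1 hs'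
      filter_upwards [hs'.tendsto_atTop_zero.eventually_lt_const one_pos] with n hn
      rw [Real.exp_lt_one_iff] at hn
      have h1 : 0 < max (-Real.log (φ (l ^ n))) 0 := by
        by_contra! hle
        nlinarith
      have h2 : 0 < -Real.log (φ (l ^ n)) := by
        rcases lt_max_iff.1 h1 with h | h
        · exact h
        · exact absurd h (lt_irrefl _)
      rw [max_eq_left h2.le, Real.rpow_def_of_pos (hφn n)]
      ring_nf
    have hae : ∀ᵐ ξ ∂μ o, ∀ m : ℕ, ∃ q ∈ P₀, (m : ℝ) ≤ horoballDist r q ∧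
        ξ ∈ visualBall o q (horoballDist r q + ψ (horoballDist r q)) :=
      ae_all_iff.2 fun m => H.ae_forall_exists_mem hψm hψ0 hw0 hψdiv m
    refine measure_mono_null (Set.compl_subset_compl.2 fun ξ hξ => ?_) (ae_iff.1 hae)
    refine Set.mem_iInter.2 fun n => ?_
    obtain ⟨N, hN⟩ := exists_nat_ge (n * w)
    obtain ⟨q, hq, hqN, hmem⟩ := hξ N
    have hqP := H.subset hq
    have hT0 : 0 ≤ horoballDist r q := (Nat.cast_nonneg N).trans hqN
    have hdiv0 : 0 ≤ horoballDist r q / w := div_nonneg hT0 hw0.le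
    refine Set.mem_iUnion₂.2 ⟨⌊horoballDist r q / w⌋₊, ?_, ?_⟩
    · exact Nat.le_floor ((le_div_iff₀ hw0).2 (hN.trans hqN))
    · rw [horoballLevel_eq hr hl0]
      refine Set.mem_iUnion₂.2 ⟨q, ⟨hqP, ?_, ?_⟩, ?_⟩
      · exact (le_div_iff₀ hw0).1 (Nat.floor_le hdiv0)
      · exact ((div_lt_iff₀ hw0).1 (Nat.lt_floor_add_one _)).le
      · refine visualBall_subset_shadowOf hX hα o q
          (T := horoballDist r q + max (-Real.log (φ (r q))) 0)
          (add_nonneg hT0 (le_max_right _ _)) ?_ ?_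
        · rw [hlog q hqP]
          linarith [le_max_left (-Real.log (φ (r q))) 0]
        · simp only [hψ, hexp q hqP] at hmem
          rwa [add_assoc]
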